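/- **Theorem 1.1.** Let $Y\subset\mathbb{P}^3$ be the split quadric surface over $\mathbb{Q}$ given by $y_0y_1=y_2y_3$, and let $X\subset\mathbb{P}^3\times\mathbb{P}^3$ be the variety over $\mathbb{Q}$ given by $$y_0x_0^2+y_1x_1^2+y_2x_2^2+y_3x_3^2=0,\qquad y_0y_1=y_2y_3,$$ with projection $\pi\colon X\to Y$, $(y,x)\mapsto y$. For $y\in Y(\mathbb{Q})$ let $H(y)=\max_{0\le i\le 3}|y_i|^2$ be the anticanonical height, where $(y_0,\dots,y_3)\in\mathbb{Z}^4$ is a vector with $\gcd(y_0,\dots,y_3)=1$ that represents $y$. Let $\widetilde X\to X$ be a desingularisation, that is, a proper birational morphism from a smooth integral $\mathbb{Q}$-scheme, let $\widetilde\pi\colon\widetilde X\to Y$ be its composition with $\pi$, and put $$N_{\mathrm{loc}}(\widetilde\pi,B)=\#\{y\in Y(\mathbb{Q})\cap\widetilde\pi(\widetilde X(\mathbf{A}_{\mathbb{Q}})) : H(y)\le B\},$$ where $\mathbf{A}_{\mathbb{Q}}$ is the ring of adèles of $\mathbb{Q}$. Then $$B\ll N_{\mathrm{loc}}(\widetilde\pi,B)\ll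 B .$$ That is, there are constants $c,C>0$, independent of the choice of $\widetilde X\to X$, such that for every real $B\ge 1$ the set that is counted is finite and $cB\le N_{\mathrm{loc}}(\widetilde\pi,B)\le CB$. -/

import Mathlib

open AlgebraicGeometry CategoryTheory CategoryTheory.Limits

noncomputable section

namespace QuadricFamily

/-! ### Projective 3-space over `ℚ` -/

/-- The standard grading of `ℚ[z₀, z₁, z₂, z₃]` by total degree. -/
abbrev grading : ℕ → Submodule ℚ (MvPolynomial (Fin 4) ℚ) :=
  MvPolynomial.homogeneousSubmodule (Fin 4) ℚ

/-- Polynomials decompose into their homogeneous components. -/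
instance : GradedAlgebra grading := MvPolynomial.gradedAlgebra

/-- Projective space `ℙ³` over `ℚ`. -/
abbrev P3 : Scheme.{0} := Proj grading

/-- The structure morphism `ℙ³ ⟶ Spec ℚ`. -/
def P3.toSpec : P3 ⟶ Spec (.of ℚ) :=
  Proj.toSpecZero grading ≫ Spec.map (CommRingCat.ofHom (algebraMap ℚ (grading 0)))

theorem X_mem (i : Fin 4) : (MvPolynomial.X i : MvPolynomial (Fin 4) ℚ) ∈ grading 1 :=
  MvPolynomial.isHomogeneous_X ℚ i

/-- The standard affine chart `zᵢ ≠ 0` of `ℙ³`. -/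
def P3.chart (i : Fin 4) : P3.Opens := Proj.basicOpen grading (MvPolynomial.X i)

/-- The regular function `zₖ / zᵢ` on the chart `zᵢ ≠ 0` of `ℙ³`. -/
def P3.ratio (i k : Fin 4) : Γ(P3, P3.chart i) :=
  Proj.awayToSection grading (MvPolynomial.X i)
    (HomogeneousLocalization.Away.mk grading (X_mem i) 1 (MvPolynomial.X k) (X_mem k))

theorem irrelevant_map_eq_top (v : Fin 4 → ℚ) (hv : v ≠ 0) :
    (HomogeneousIdeal.irrelevant grading).toIdeal.map
      ((Scheme.ΓSpecIso (.of ℚ)).inv.hom.comp (MvPolynomial.aeval v).toRingHom) = ⊤ := by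
  obtain ⟨i, hi⟩ := Function.ne_iff.mp hv
  refine Ideal.eq_top_of_isUnit_mem _ (Ideal.mem_map_of_mem _
    (HomogeneousIdeal.mem_irrelevant_of_mem grading one_pos (X_mem i))) ?_
  rw [RingHom.comp_apply]
  refine IsUnit.map _ ?_
  simpa using hi

/-- The rational point `[v₀ : v₁ : v₂ : v₃]` of `ℙ³` with homogeneous coordinates `v ≠ 0`. -/
def P3.point (v : Fin 4 → ℚ) (hv : v ≠ 0) : Spec (.of ℚ) ⟶ P3 :=
  Proj.fromOfGlobalSections grading
    ((Scheme.ΓSpecIso (.of ℚ)).inv.hom.comp (MvPolynomial.aeval v).toRingHom)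
    (irrelevant_map_eq_top v hv)

/-! ### The split quadric surface `Y : y₀ y₁ = y₂ y₃` in `ℙ³` -/

/-- The quadratic form `y₀ y₁ - y₂ y₃`. -/
def splitForm : MvPolynomial (Fin 4) ℚ :=
  MvPolynomial.X 0 * MvPolynomial.X 1 - MvPolynomial.X 2 * MvPolynomial.X 3

/-- The closed set of zeros of `y₀ y₁ - y₂ y₃` in `ℙ³`. -/
def Y.zeros : TopologicalSpace.Closeds P3 := (Proj.basicOpen grading splitForm).compl

/-- The variety `Y ⊂ ℙ³`: the zero locus of `y₀ y₁ - y₂ y₃`, with its reduced structure. -/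
def Y : Scheme.{0} := (Scheme.IdealSheafData.vanishingIdeal Y.zeros).subscheme

/-- The inclusion of `Y` in `ℙ³`. -/
def Y.ι : Y ⟶ P3 := (Scheme.IdealSheafData.vanishingIdeal Y.zeros).subschemeι

/-! ### The family `X` of diagonal quadric surfaces over `Y` -/

/-- The product `Y × ℙ³` over `ℚ`, a closed subvariety of `ℙ³ × ℙ³`; the coordinates of the two
factors are written `y` and `x`. -/
def YP3 : Scheme.{0} := pullback (Y.ι ≫ P3.toSpec) P3.toSpec

/-- The projection of `Y × ℙ³` to `Y`. -/
def YP3.fst : YP3 ⟶ Y := pullback.fst _ _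

/-- The projection of `Y × ℙ³` to `ℙ³`. -/
def YP3.snd : YP3 ⟶ P3 := pullback.snd _ _

/-- The open subset `yᵢ xⱼ ≠ 0` of `Y × ℙ³`. -/
def YP3.chart (i j : Fin 4) : YP3.Opens :=
  ((YP3.fst ≫ Y.ι) ⁻¹ᵁ P3.chart i) ⊓ (YP3.snd ⁻¹ᵁ P3.chart j)

/-- The regular function
`(y₀ x₀² + y₁ x₁² + y₂ x₂² + y₃ x₃²) / (yᵢ xⱼ²) = ∑ₖ (yₖ / yᵢ) (xₖ / xⱼ)²`
on the open subset `yᵢ xⱼ ≠ 0` of `Y × ℙ³`. -/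
def YP3.diagForm (i j : Fin 4) : Γ(YP3, YP3.chart i j) :=
  ∑ k : Fin 4,
    (YP3.fst ≫ Y.ι).appLE (P3.chart i) (YP3.chart i j) inf_le_left (P3.ratio i k) *
      (YP3.snd.appLE (P3.chart j) (YP3.chart i j) inf_le_right (P3.ratio j k)) ^ 2

/-- The closed set of zeros of `y₀ x₀² + y₁ x₁² + y₂ x₂² + y₃ x₃²` in `Y × ℙ³`; its complement
is the union over all charts of the open sets where the form is invertible. -/
def X.zeros : TopologicalSpace.Closeds YP3 :=
  (⨆ (i : Fin 4) (j : Fin 4), YP3.basicOpen (YP3.diagForm i j)).compl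

/-- The variety `X ⊂ ℙ³ × ℙ³` given by `y₀ x₀² + y₁ x₁² + y₂ x₂² + y₃ x₃² = 0` and
`y₀ y₁ = y₂ y₃`, with its reduced structure. -/
def X : Scheme.{0} := (Scheme.IdealSheafData.vanishingIdeal X.zeros).subscheme

/-- The inclusion of `X` in `Y × ℙ³`. -/
def X.ι : X ⟶ YP3 := (Scheme.IdealSheafData.vanishingIdeal X.zeros).subschemeι

/-- The projection `π : X ⟶ Y`. -/
def X.π : X ⟶ Y := X.ι ≫ YP3.fst

/-- The structure morphism `X ⟶ Spec ℚ`. -/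
def X.toSpec : X ⟶ Spec (.of ℚ) := X.π ≫ Y.ι ≫ P3.toSpec

/-! ### Desingularisations -/

/-- `f : X' ⟶ X` is a desingularisation of `X`: a proper birational morphism from an integral
scheme which is smooth over `ℚ`. As `X'` is integral, birationality of the proper morphism `f`
means that `f` is an isomorphism above some nonempty open subset of `X`. -/
structure IsDesingularisation {X' : Scheme.{0}} (f : X' ⟶ X) : Prop where
  isIntegral : IsIntegral X'
  smooth : Smooth (f ≫ X.toSpec)
  isProper : IsProper f
  birational : ∃ U : X.Opens, (U : Set X).Nonempty ∧ IsIso (f ∣_ U)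

/-! ### The counting function -/

/-- The rational point `y` of `Y` has anticanonical height `h`: if `y = [v₀ : v₁ : v₂ : v₃]` with
coprime integers `vᵢ` (which `y` determines up to a common sign), then `h = (maxᵢ |vᵢ|)²`. -/
def HasHeight (y : Spec (.of ℚ) ⟶ Y) (h : ℕ) : Prop :=
  ∃ (v : Fin 4 → ℤ) (hv : (fun i => (v i : ℚ)) ≠ 0),
    Finset.univ.gcd v = 1 ∧
    y ≫ Y.ι = P3.point (fun i => (v i : ℚ)) hv ∧
    h = (Finset.univ.sup fun i => (v i).natAbs) ^ 2

/-- The ring of adèles of `ℚ`. -/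
abbrev Adeles : Type := NumberField.AdeleRing (NumberField.RingOfIntegers ℚ) ℚ

/-- For `p : Z ⟶ Y`, the set of rational points `y ∈ Y(ℚ) ∩ p(Z(𝐀))` of anticanonical height at
most `B`. A morphism `Spec ℚ ⟶ Y` is automatically a morphism over `ℚ`, and similarly for
`Spec 𝐀 ⟶ Z`. -/
def locSolublePoints {Z : Scheme.{0}} (p : Z ⟶ Y) (B : ℝ) : Set (Spec (.of ℚ) ⟶ Y) :=
  {y | (∃ h : ℕ, HasHeight y h ∧ (h : ℝ) ≤ B) ∧
    ∃ z : Spec (.of Adeles) ⟶ Z,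
      z ≫ p = Spec.map (CommRingCat.ofHom (algebraMap ℚ Adeles)) ≫ y}

/-- The counting function `N_loc(p, B)`. -/
def Nloc {Z : Scheme.{0}} (p : Z ⟶ Y) (B : ℝ) : ℕ := (locSolublePoints p B).ncard

end QuadricFamily

end

/-!
The points of `Y ≅ ℙ¹ × ℙ¹` are `y = (ac, bd, ad, bc)` with coprime `(a, b)` and coprime `(c, d)`.
The height of `y` is the square of `max(|a|, |b|) max(|c|, |d|)`, and the fibre of `X` over `y` is
the quadric `c (a x₀² + b x₃²) + d (b x₁² + a x₂²) = 0`. There are about `B log B` points of height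
at most `B`; the condition of local solubility saves a logarithm on average, and the points with
`(c, d) = (1, -1)` already account for the order of magnitude `B`.

*Lower bound.* For coprime `a, b > 0` the fibre over `(a, -b, -a, b)` has the rational point
`x = (1, 1, 1, 1)`, but `X` may be singular there, so that this point has to be lifted to `X'`. By
the valuative criterion it suffices that it is the special point of some `Spec ℚ⟦t⟧ ⟶ X` whose
generic point lies in the open set over which `f` is an isomorphism (`X.exists_curve`,
`X.exists_lift`). Such a curve is the image of a line under a rational parametrisation of `X`, once
this parametrisation is known to be dominant (`X.exists_param_mem`). For this it is shown that
every nonempty open set of `X` contains a sufficiently general point over some field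
(`X.exists_containsPoint`), by moving any given point along curves in `X`.

*Upper bound.* If the fibre has points over all `ℚ_p`, then every prime modulo which `n = -ab` is
not a square divides `c` and `d` to an even power, since `a x₀² + b x₃²` is then, up to units, the
norm form of an unramified extension of `ℚ_p` (`IsPadicSoluble.isNormLike`). By symmetry one may
assume that `max(|a|, |b|) ≤ max(|c|, |d|)`. The number of such `c ≤ x` is `normCount n x`.

* Chebyshev's bound gives `normCount n x ≪ (x / log x) ∑ 1 / u`, where `u ≤ x` runs through the
  squarefree integers composed of primes modulo which `n` is a square
  (`exists_normCount_mul_log_le`). The square of the last sum is at most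
  `normSum n (x ^ 2) = ∑ r(m) / m` over `m ≤ x ^ 2`, with `r = 1 * (n / ·)`, up to a factor from the
  ramified primes (`splitSum_sq_le`).
* By periodicity of the character, `normSum n x` grows at most like a logarithm once `x` exceeds a
  power of `n` (`normSum_le_mul_log`), while below such a power the values of `normSum n` at `w` and
  at powers of `w` are comparable, by convolution with a nonnegative complement
  (`normSum_mul_sq_le`). So if `|a|, |b| ≤ A ≤ x ^ 2`, then `normCount n x ^ 2` is at most
  `x ^ 2 / (log x log A)` times `normSum n √A`, essentially (`exists_normCount_sq_le`).
* On average over `|a|, |b| ≤ A`, the sum `normSum n √A` is `O(log A)`, because the character sums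
  over `a` and over `b` cancel unless the modulus is a square (`exists_sum_normSum_le`).

With `T = √B` and `x = T / max(|a|, |b|)`, each dyadic range of `max(|a|, |b|)` therefore
contributes `O(T ^ 2 / log T)` points, and there are `O(log T)` ranges
(`exists_sum_normCount_sq_le_of_not_isSquare`). The pairs `(a, b)` for which `-ab` is a square are
so sparse that the trivial bound suffices.
-/

open AlgebraicGeometry CategoryTheory CategoryTheory.Limits

noncomputable section

namespace QuadricFamily

/-! ### Affine charts of `ℙ³` -/

theorem eval₂Hom_mul_of_isHomogeneous {R : Type*} [CommRing R] (φ : ℚ →+* R) (g : Fin 4 → R)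
    (c : R) {n : ℕ} {p : MvPolynomial (Fin 4) ℚ} (hp : p.IsHomogeneous n) :
    MvPolynomial.eval₂Hom φ (fun k => c * g k) p = c ^ n * MvPolynomial.eval₂Hom φ g p := by
  simp only [MvPolynomial.coe_eval₂Hom, MvPolynomial.eval₂_eq', Finset.mul_sum]
  refine Finset.sum_congr rfl fun d hd => ?_
  have hdeg : ∑ i, d i = n := by
    rw [hp.degree_eq_sum_deg_support hd]
    exact (Finset.sum_subset (Finset.subset_univ _) (by simp)).symm
  simp only [mul_pow, Finset.prod_mul_distrib]
  rw [Finset.prod_pow_eq_pow_sum, hdeg]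
  ring

/-- The coordinate ring `ℚ[z₀ / zᵢ, …, z₃ / zᵢ]` of the chart `zᵢ ≠ 0` of `ℙ³`. -/
abbrev ChartRing (i : Fin 4) : Type := HomogeneousLocalization.Away grading (MvPolynomial.X i)

/-- The element `zₖ / zᵢ` of the coordinate ring of the chart `zᵢ ≠ 0`. -/
def ChartRing.coord (i k : Fin 4) : ChartRing i :=
  HomogeneousLocalization.Away.mk grading (X_mem i) 1 (MvPolynomial.X k) (X_mem k)

theorem ChartRing.X_mul_val_coord (i k : Fin 4) :
    algebraMap (MvPolynomial (Fin 4) ℚ)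
        (Localization.Away (MvPolynomial.X i : MvPolynomial (Fin 4) ℚ)) (MvPolynomial.X i) *
          (coord i k).val =
      algebraMap (MvPolynomial (Fin 4) ℚ) _ (MvPolynomial.X k) := by
  rw [coord, HomogeneousLocalization.Away.val_mk, Localization.mk_eq_mk', mul_comm]
  simp

/-- The ring homomorphism `zₖ ↦ zₖ / zᵢ`. -/
def ChartRing.dehom (i : Fin 4) : MvPolynomial (Fin 4) ℚ →+* ChartRing i :=
  MvPolynomial.eval₂Hom
    ((HomogeneousLocalization.fromZeroRingHom grading _).comp (algebraMap ℚ (grading 0))) (coord i)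

theorem ChartRing.mk_eq_dehom (i : Fin 4) (n : ℕ) (p : MvPolynomial (Fin 4) ℚ)
    (hp : p ∈ grading (n • 1)) :
    HomogeneousLocalization.Away.mk grading (X_mem i) n p hp = dehom i p := by
  have hp' : p.IsHomogeneous n := by simpa using hp
  apply HomogeneousLocalization.val_injective
  have h1 : (dehom i p).val = MvPolynomial.eval₂Hom ((algebraMap (MvPolynomial (Fin 4) ℚ)
      (Localization.Away (MvPolynomial.X i : MvPolynomial (Fin 4) ℚ))).comp MvPolynomial.C)
      (fun k => (coord i k).val) p := by
    change ((algebraMap (ChartRing i) (Localization.Away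
      (MvPolynomial.X i : MvPolynomial (Fin 4) ℚ))).comp (dehom i)) p = _
    congr 1
    apply MvPolynomial.ringHom_ext'
    · exact RingHom.ext_rat _ _
    · intro k
      simp [dehom]
  have h2 : algebraMap (MvPolynomial (Fin 4) ℚ)
      (Localization.Away (MvPolynomial.X i : MvPolynomial (Fin 4) ℚ)) (MvPolynomial.X i) ^ n *
        (dehom i p).val = algebraMap _ _ p := by
    rw [h1, ← eval₂Hom_mul_of_isHomogeneous _ _ _ hp']
    simp only [X_mul_val_coord]
    refine congrArg (fun φ : _ →+* _ => φ p) (MvPolynomial.ringHom_ext' ?_ fun k => ?_)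
    · exact RingHom.ext_rat _ _
    · simp
  rw [HomogeneousLocalization.Away.val_mk, Localization.mk_eq_mk', eq_comm,
    IsLocalization.eq_mk'_iff_mul_eq, mul_comm]
  simpa using h2

/-- The coordinate ring of a chart is generated by the `zₖ / zᵢ` as a ring, up to rational
constants, which every ring homomorphism respects. -/
theorem ChartRing.hom_ext {R : Type*} [CommRing R] {i : Fin 4} {φ ψ : ChartRing i →+* R}
    (h : ∀ k, φ (coord i k) = ψ (coord i k)) : φ = ψ := by
  ext x
  obtain ⟨n, p, hp, rfl⟩ := HomogeneousLocalization.Away.mk_surjective grading (X_mem i) x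
  rw [mk_eq_dehom, ← RingHom.comp_apply, ← RingHom.comp_apply]
  congr 1
  apply MvPolynomial.ringHom_ext'
  · exact RingHom.ext_rat _ _
  · intro k
    simpa [dehom] using h k

/-- The point of the chart `zᵢ ≠ 0` with values in `R` that a ring homomorphism defines. -/
def P3.ofChart {R : Type} [CommRing R] (i : Fin 4) (ψ : ChartRing i →+* R) : Spec (.of R) ⟶ P3 :=
  Spec.map (CommRingCat.ofHom ψ) ≫ Proj.awayι grading (MvPolynomial.X i) (X_mem i) one_pos

theorem P3.SpecMap_ofChart {R S : Type} [CommRing R] [CommRing S] (φ : R →+* S) (i : Fin 4)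
    (ψ : ChartRing i →+* R) :
    Spec.map (CommRingCat.ofHom φ) ≫ P3.ofChart i ψ = P3.ofChart i (φ.comp ψ) := by
  simp [P3.ofChart]

theorem P3.exists_eq_ofChart {R : Type} [CommRing R] (i : Fin 4) (g : Spec (.of R) ⟶ P3)
    (hg : g ⁻¹ᵁ P3.chart i = ⊤) : ∃ ψ, g = P3.ofChart i ψ := by
  have hr : Set.range g ⊆
      Set.range (Proj.awayι grading (MvPolynomial.X i) (X_mem i) one_pos) := by
    have := Proj.opensRange_awayι grading _ (X_mem i) one_pos
    rintro _ ⟨x, rfl⟩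
    change g x ∈ (Proj.awayι grading (MvPolynomial.X i) (X_mem i) one_pos).opensRange
    rw [this]
    have : x ∈ g ⁻¹ᵁ P3.chart i := by rw [hg]; trivial
    exact this
  obtain ⟨φ, hφ⟩ := Spec.map_surjective (IsOpenImmersion.lift _ g hr)
  refine ⟨φ.hom, ?_⟩
  rw [P3.ofChart, CommRingCat.ofHom_hom, hφ, IsOpenImmersion.lift_fac]

theorem appLE_comp_appTop {X Y Z : Scheme.{0}} (f : X ⟶ Y) (g : Y ⟶ Z) (U : Z.Opens)
    (h : ⊤ ≤ g ⁻¹ᵁ U) (h' : ⊤ ≤ (f ≫ g) ⁻¹ᵁ U) :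
    g.appLE U ⊤ h ≫ f.appTop = (f ≫ g).appLE U ⊤ h' := by
  have h1 : ⊤ ≤ f ⁻¹ᵁ ⊤ := le_top
  have h2 : f.appTop = f.appLE ⊤ ⊤ h1 := f.app_eq_appLE
  rw [h2, Scheme.Hom.appLE_comp_appLE]

theorem awayToSection_comp_awayι_appLE (i : Fin 4)
    (h : ⊤ ≤ Proj.awayι grading (MvPolynomial.X i) (X_mem i) one_pos ⁻¹ᵁ
      Proj.basicOpen grading (MvPolynomial.X i)) :
    Proj.awayToSection grading (MvPolynomial.X i) ≫
      (Proj.awayι grading (MvPolynomial.X i) (X_mem i) one_pos).appLE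
        (Proj.basicOpen grading (MvPolynomial.X i)) ⊤ h =
    (Scheme.ΓSpecIso _).inv := by
  have h1 : (Proj.basicOpenIsoSpec grading _ (X_mem i) one_pos).hom.appTop =
      (Scheme.ΓSpecIso _).hom ≫ Proj.awayToSection grading (MvPolynomial.X i) ≫
        (Proj.basicOpen grading (MvPolynomial.X i)).topIso.inv :=
    Proj.basicOpenToSpec_app_top grading (MvPolynomial.X i)
  have : IsIso (Proj.basicOpenIsoSpec grading _ (X_mem i) one_pos).hom.appTop :=
    inferInstanceAs (IsIso (Scheme.Hom.app _ ⊤))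
  rw [← cancel_mono (Proj.basicOpenIsoSpec grading _ (X_mem i) one_pos).hom.appTop, Category.assoc]
  conv_rhs => rw [h1, Iso.inv_hom_id_assoc]
  congr 1
  have h2 : (Proj.basicOpenIsoSpec grading _ (X_mem i) one_pos).hom ≫
      Proj.awayι grading (MvPolynomial.X i) (X_mem i) one_pos =
      (Proj.basicOpen grading (MvPolynomial.X i)).ι := by
    rw [Proj.awayι, Iso.hom_inv_id_assoc]
  rw [appLE_comp_appTop _ _ _ _ (by rw [h2]; simp)]
  simp only [h2]
  simp only [Scheme.Opens.topIso, Scheme.Opens.ι_appLE]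
  rfl

theorem P3.ofChart_appLE_ratio {R : Type} [CommRing R] (i k : Fin 4) (ψ : ChartRing i →+* R)
    (h : ⊤ ≤ P3.ofChart i ψ ⁻¹ᵁ P3.chart i) :
    (P3.ofChart i ψ).appLE (P3.chart i) ⊤ h (P3.ratio i k) =
      (Scheme.ΓSpecIso (.of R)).inv (ψ (ChartRing.coord i k)) := by
  have h0 : ⊤ ≤ Proj.awayι grading (MvPolynomial.X i) (X_mem i) one_pos ⁻¹ᵁ
      Proj.basicOpen grading (MvPolynomial.X i) := by
    rw [← Proj.opensRange_awayι grading _ (X_mem i) one_pos]; simp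
  have h1 := awayToSection_comp_awayι_appLE i h0
  have h2 : Proj.awayToSection grading (MvPolynomial.X i) ≫
      Scheme.Hom.appLE (Spec.map (CommRingCat.ofHom ψ) ≫
        Proj.awayι grading (MvPolynomial.X i) (X_mem i) one_pos)
        (Proj.basicOpen grading (MvPolynomial.X i)) ⊤ h =
      CommRingCat.ofHom ψ ≫ (Scheme.ΓSpecIso (.of R)).inv := by
    rw [Scheme.ΓSpecIso_inv_naturality, ← h1, Category.assoc]
    congr 1
  exact congrArg (fun φ => φ.hom (ChartRing.coord i k)) h2

/-! ### Points of `ℙ³` with given homogeneous coordinates -/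

theorem irrelevant_map_eq_top_of_isUnit {X : Scheme.{0}} (φ : MvPolynomial (Fin 4) ℚ →+* Γ(X, ⊤))
    (h : ∃ i, IsUnit (φ (MvPolynomial.X i))) :
    (HomogeneousIdeal.irrelevant grading).toIdeal.map φ = ⊤ := by
  obtain ⟨i, hi⟩ := h
  exact Ideal.eq_top_of_isUnit_mem _ (Ideal.mem_map_of_mem _
    (HomogeneousIdeal.mem_irrelevant_of_mem grading one_pos (X_mem i))) hi

/-- The ring homomorphism `zₖ / zᵢ ↦ φ(zₖ) / φ(zᵢ)`. -/
def ChartRing.lift {R : Type*} [CommRing R] (φ : MvPolynomial (Fin 4) ℚ →+* R) (i : Fin 4)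
    (h : IsUnit (φ (MvPolynomial.X i))) : ChartRing i →+* R :=
  (IsLocalization.Away.lift (MvPolynomial.X i : MvPolynomial (Fin 4) ℚ) h).comp
    (algebraMap (ChartRing i) (Localization.Away (MvPolynomial.X i : MvPolynomial (Fin 4) ℚ)))

theorem ChartRing.mul_lift_coord {R : Type*} [CommRing R] (φ : MvPolynomial (Fin 4) ℚ →+* R)
    (i : Fin 4) (h : IsUnit (φ (MvPolynomial.X i))) (k : Fin 4) :
    φ (MvPolynomial.X i) * lift φ i h (coord i k) = φ (MvPolynomial.X k) := by
  have := congrArg (IsLocalization.Away.lift (MvPolynomial.X i : MvPolynomial (Fin 4) ℚ) h)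
    (X_mul_val_coord i k)
  rw [map_mul, IsLocalization.Away.lift_eq, IsLocalization.Away.lift_eq] at this
  exact this

/-- The morphism to `ℙ³` given by homogeneous coordinates of which the `i`-th is a unit factors
through the `i`-th chart. -/
theorem fromOfGlobalSections_eq_ofChart {R : Type} [CommRing R]
    (φ : MvPolynomial (Fin 4) ℚ →+* R) (i : Fin 4) (h : IsUnit (φ (MvPolynomial.X i)))
    (h' : (HomogeneousIdeal.irrelevant grading).toIdeal.map
      ((Scheme.ΓSpecIso (.of R)).inv.hom.comp φ) = ⊤) :
    Proj.fromOfGlobalSections grading ((Scheme.ΓSpecIso (.of R)).inv.hom.comp φ) h' =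
      P3.ofChart i (ChartRing.lift φ i h) := by
  set f := (Scheme.ΓSpecIso (.of R)).inv.hom.comp φ with hf
  have hu : IsUnit (f (MvPolynomial.X i)) := h.map (Scheme.ΓSpecIso (.of R)).inv.hom
  have h1 := Proj.fromOfGlobalSections_resLE grading f h' one_pos (X_mem i)
  have h2 : (Spec (.of R)).basicOpen (f (MvPolynomial.X i)) = ⊤ := by
    rw [Scheme.basicOpen_of_isUnit _ hu]
  have h3 := congrArg (fun t => t ≫ (Proj.basicOpen grading (MvPolynomial.X i)).ι) h1
  simp only [Scheme.Hom.resLE_comp_ι] at h3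
  have : IsIso ((Spec (.of R)).basicOpen (f (MvPolynomial.X i))).ι := by
    rw [h2, ← Scheme.topIso_hom]; infer_instance
  rw [← cancel_epi ((Spec (.of R)).basicOpen (f (MvPolynomial.X i))).ι, h3]
  simp only [Proj.toBasicOpenOfGlobalSections, Category.assoc, Proj.basicOpenIsoSpec_inv_ι,
    P3.ofChart]
  have h5 : Submonoid.powers (MvPolynomial.X i : MvPolynomial (Fin 4) ℚ) ≤
      (Submonoid.powers (f (MvPolynomial.X i))).comap f := by
    rw [← Submonoid.map_le_iff_le_comap, Submonoid.map_powers]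
  have h4 : (IsLocalization.map (S := Localization.Away (MvPolynomial.X i : MvPolynomial (Fin 4) ℚ))
      (Localization.Away (f (MvPolynomial.X i))) f h5).comp
        (algebraMap (ChartRing i) (Localization.Away (MvPolynomial.X i))) =
      (algebraMap _ (Localization.Away (f (MvPolynomial.X i)))).comp
        ((Scheme.ΓSpecIso (.of R)).inv.hom.comp (ChartRing.lift φ i h)) := by
    rw [ChartRing.lift, ← RingHom.comp_assoc, ← RingHom.comp_assoc]
    congr 1
    apply IsLocalization.ringHom_ext (Submonoid.powers (MvPolynomial.X i : MvPolynomial (Fin 4) ℚ))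
    ext x <;> simp [hf]
  rw [h4]
  simp only [CommRingCat.ofHom_comp, Spec.map_comp, CommRingCat.ofHom_hom, Category.assoc,
    basicOpenIsoSpecAway_hom_SpecMap_assoc]
  have h6 := morphismRestrict_ι_assoc (Spec (.of R)).toSpecΓ
    (PrimeSpectrum.basicOpen (f (MvPolynomial.X i)))
    (Spec.map (Scheme.ΓSpecIso (.of R)).inv ≫ Spec.map (CommRingCat.ofHom (ChartRing.lift φ i h)) ≫
      Proj.awayι grading (MvPolynomial.X i) (X_mem i) one_pos)
  refine (congrArg (((Spec (.of R)).isoOfEq _).inv ≫ ·) h6).trans ?_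
  rw [toSpecΓ_SpecMap_ΓSpecIso_inv_assoc, Scheme.isoOfEq_inv_ι_assoc]

/-- The point `[v₀ : v₁ : v₂ : v₃]` of `ℙ³` with values in a `ℚ`-algebra `R`, where some coordinate
is a unit. -/
def P3.pt {R : Type} [CommRing R] [Algebra ℚ R] (v : Fin 4 → R) (hv : ∃ i, IsUnit (v i)) :
    Spec (.of R) ⟶ P3 :=
  Proj.fromOfGlobalSections grading
    ((Scheme.ΓSpecIso (.of R)).inv.hom.comp (MvPolynomial.aeval v).toRingHom)
    (irrelevant_map_eq_top_of_isUnit _ (by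
      obtain ⟨i, hi⟩ := hv
      refine ⟨i, ?_⟩
      rw [RingHom.comp_apply]
      refine IsUnit.map _ ?_
      simpa using hi))

theorem exists_isUnit_of_ne_zero {K : Type*} [Field K] {v : Fin 4 → K} (hv : v ≠ 0) :
    ∃ i, IsUnit (v i) := by
  obtain ⟨i, hi⟩ := Function.ne_iff.mp hv
  exact ⟨i, isUnit_iff_ne_zero.mpr hi⟩

theorem P3.point_eq_pt (v : Fin 4 → ℚ) (hv : v ≠ 0) :
    P3.point v hv = P3.pt v (exists_isUnit_of_ne_zero hv) := rfl

section pt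

variable {R : Type} [CommRing R] [Algebra ℚ R] {v w : Fin 4 → R} (hv : ∃ i, IsUnit (v i))
  (hw : ∃ i, IsUnit (w i))

theorem P3.pt_eq_ofChart {i : Fin 4} (hi : IsUnit (v i)) (ψ : ChartRing i →+* R)
    (hψ : ∀ k, v i * ψ (ChartRing.coord i k) = v k) : P3.pt v hv = P3.ofChart i ψ := by
  have hi' : IsUnit ((MvPolynomial.aeval v : MvPolynomial (Fin 4) ℚ →ₐ[ℚ] R).toRingHom
    (MvPolynomial.X i)) := by simpa using hi
  rw [P3.pt, fromOfGlobalSections_eq_ofChart _ i hi']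
  congr 1
  refine ChartRing.hom_ext fun k => hi.mul_left_cancel ?_
  rw [hψ]
  simpa using ChartRing.mul_lift_coord
      (MvPolynomial.aeval v : MvPolynomial (Fin 4) ℚ →ₐ[ℚ] R).toRingHom i hi' k

theorem P3.exists_pt_eq_ofChart {i : Fin 4} (hi : IsUnit (v i)) :
    ∃ ψ : ChartRing i →+* R, (∀ k, v i * ψ (ChartRing.coord i k) = v k) ∧
      P3.pt v hv = P3.ofChart i ψ := by
  have hi' : IsUnit ((MvPolynomial.aeval v : MvPolynomial (Fin 4) ℚ →ₐ[ℚ] R).toRingHom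
    (MvPolynomial.X i)) := by simpa using hi
  have h : ∀ k, v i * ChartRing.lift _ i hi' (ChartRing.coord i k) = v k := fun k => by
    simpa using ChartRing.mul_lift_coord
      (MvPolynomial.aeval v : MvPolynomial (Fin 4) ℚ →ₐ[ℚ] R).toRingHom i hi' k
  exact ⟨_, h, P3.pt_eq_ofChart hv hi _ h⟩

theorem P3.SpecMap_pt {S : Type} [CommRing S] [Algebra ℚ S] (φ : R →+* S)
    (hv' : ∃ i, IsUnit (φ (v i))) :
    Spec.map (CommRingCat.ofHom φ) ≫ P3.pt v hv = P3.pt (fun i => φ (v i)) hv' := by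
  obtain ⟨i, hi⟩ := id hv
  obtain ⟨ψ, hψ, h⟩ := P3.exists_pt_eq_ofChart hv hi
  rw [h, P3.SpecMap_ofChart, P3.pt_eq_ofChart hv' (hi.map φ) (φ.comp ψ)]
  intro k
  rw [RingHom.comp_apply, ← map_mul, hψ]

/-- Proportional coordinates define the same point. The factor `u` is a unit because some coordinate
`v i` is. -/
theorem P3.pt_eq_pt (u : R) (h : ∀ k, v k = u * w k) : P3.pt v hv = P3.pt w hw := by
  obtain ⟨i, hi⟩ := id hv
  have hi' : IsUnit (w i) := isUnit_of_mul_isUnit_right (by rw [← h]; exact hi)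
  obtain ⟨ψ, hψ, h'⟩ := P3.exists_pt_eq_ofChart hw hi'
  rw [h', P3.pt_eq_ofChart hv hi ψ]
  intro k
  rw [h, h, mul_assoc, hψ]

theorem P3.pt_preimage_basicOpen {n : ℕ} (hn : 0 < n) {p : MvPolynomial (Fin 4) ℚ}
    (hp : p ∈ grading n) :
    P3.pt v hv ⁻¹ᵁ Proj.basicOpen grading p =
      (Spec (.of R)).basicOpen ((Scheme.ΓSpecIso (.of R)).inv (MvPolynomial.aeval v p)) :=
  Proj.fromOfGlobalSections_preimage_basicOpen _ _ _ hn hp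

theorem P3.pt_mem_basicOpen {n : ℕ} (hn : 0 < n) {p : MvPolynomial (Fin 4) ℚ}
    (hp : p ∈ grading n) (s : Spec (.of R)) :
    P3.pt v hv s ∈ Proj.basicOpen grading p ↔ MvPolynomial.aeval v p ∉ s.asIdeal := by
  have h := P3.pt_preimage_basicOpen hv hn hp
  rw [basicOpen_eq_of_affine] at h
  have h' : s ∈ P3.pt v hv ⁻¹ᵁ Proj.basicOpen grading p ↔
      s ∈ PrimeSpectrum.basicOpen (MvPolynomial.aeval v p) := by
    rw [h]
    exact Iff.rfl
  exact h'

theorem P3.pt_mem_chart (i : Fin 4) (s : Spec (.of R)) :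
    P3.pt v hv s ∈ P3.chart i ↔ v i ∉ s.asIdeal := by
  rw [P3.chart, P3.pt_mem_basicOpen hv one_pos (X_mem i), MvPolynomial.aeval_X]

theorem P3.top_le_pt_preimage_chart_iff (i : Fin 4) :
    ⊤ ≤ P3.pt v hv ⁻¹ᵁ P3.chart i ↔ IsUnit (v i) := by
  constructor
  · intro h
    by_contra hi
    obtain ⟨m, hm, hi⟩ := exists_max_ideal_of_mem_nonunits hi
    exact (P3.pt_mem_chart hv i ⟨m, hm.isPrime⟩).mp (h trivial) hi
  · intro h s _
    refine (P3.pt_mem_chart hv i s).mpr fun hs => ?_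
    exact s.isPrime.ne_top (Ideal.eq_top_of_isUnit_mem _ hs h)

theorem P3.pt_appLE_ratio (i k : Fin 4) (h : ⊤ ≤ P3.pt v hv ⁻¹ᵁ P3.chart i) :
    ∃ r : R, v i * r = v k ∧ (P3.pt v hv).appLE (P3.chart i) ⊤ h (P3.ratio i k) =
      (Scheme.ΓSpecIso (.of R)).inv r := by
  have hi : IsUnit (v i) := (P3.top_le_pt_preimage_chart_iff hv i).mp h
  obtain ⟨ψ, hψ, h'⟩ := P3.exists_pt_eq_ofChart hv hi
  refine ⟨_, hψ k, ?_⟩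
  rw [← P3.ofChart_appLE_ratio i k ψ (by rw [← h']; exact h)]
  simp only [h']

end pt

theorem P3.exists_eq_pt {K : Type} [Field K] [Algebra ℚ K] (g : Spec (.of K) ⟶ P3) :
    ∃ (v : Fin 4 → K) (hv : v ≠ 0), g = P3.pt v (exists_isUnit_of_ne_zero hv) := by
  have hcov : ⨆ i, P3.chart i = ⊤ := by
    refine Proj.iSup_basicOpen_eq_top' grading _ (fun i => ⟨1, X_mem i⟩) ?_
    refine top_le_iff.mp fun p _ => ?_
    have hp : p ∈ Algebra.adjoin ℚ (Set.range (MvPolynomial.X : Fin 4 → _)) := by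
      rw [MvPolynomial.adjoin_range_X]; trivial
    induction hp using Algebra.adjoin_induction with
    | mem x hx => exact Algebra.subset_adjoin hx
    | algebraMap r => exact Subalgebra.algebraMap_mem _ (algebraMap ℚ (grading 0) r)
    | add x y _ _ hx hy => exact add_mem (hx trivial) (hy trivial)
    | mul x y _ _ hx hy => exact mul_mem (hx trivial) (hy trivial)
  have hs : g (IsLocalRing.closedPoint K) ∈ ⨆ i, P3.chart i := by rw [hcov]; trivial
  obtain ⟨i, hi⟩ := TopologicalSpace.Opens.mem_iSup.mp hs
  have hi' : g ⁻¹ᵁ P3.chart i = ⊤ := by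
    ext s
    have : s = IsLocalRing.closedPoint K := Subsingleton.elim _ _
    subst this
    exact ⟨fun _ => trivial, fun _ => hi⟩
  obtain ⟨ψ, rfl⟩ := P3.exists_eq_ofChart i g hi'
  have h1 : ψ (ChartRing.coord i i) = 1 := by
    have : ChartRing.coord i i = 1 := by
      rw [ChartRing.coord]
      apply HomogeneousLocalization.val_injective
      rw [HomogeneousLocalization.Away.val_mk, HomogeneousLocalization.val_one]
      simp only [pow_one]
      exact Localization.mk_self
        (⟨_, 1, pow_one _⟩ : Submonoid.powers (MvPolynomial.X i : MvPolynomial (Fin 4) ℚ))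
    rw [this, map_one]
  refine ⟨fun k => ψ (ChartRing.coord i k), fun h0 => ?_, ?_⟩
  · exact one_ne_zero (h1.symm.trans (congrFun h0 i))
  · rw [P3.pt_eq_ofChart _ (by simp [h1]) ψ (by simp [h1])]

/-- Homogeneous coordinates of a point are unique up to scaling. -/
theorem P3.mul_eq_mul_of_pt_eq {K : Type} [Field K] [Algebra ℚ K] {v w : Fin 4 → K} {hv hw}
    (h : P3.pt v hv = P3.pt w hw) (i k : Fin 4) : v i * w k = w i * v k := by
  have key : ∀ i k, v i ≠ 0 → v i * w k = w i * v k := by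
    intro i k hi
    have h1 : ⊤ ≤ P3.pt v hv ⁻¹ᵁ P3.chart i :=
      (P3.top_le_pt_preimage_chart_iff hv i).mpr (isUnit_iff_ne_zero.mpr hi)
    obtain ⟨r, hr, hr'⟩ := P3.pt_appLE_ratio hv i k h1
    obtain ⟨s, hs, hs'⟩ := P3.pt_appLE_ratio hw i k (by rw [← h]; exact h1)
    simp only [h] at hr'
    have : r = s := by
      have := hr'.symm.trans hs'
      exact (ConcreteCategory.bijective_of_isIso (Scheme.ΓSpecIso (.of K)).inv).1 this
    subst this
    rw [← hr, ← hs]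
    ring
  by_cases hi : v i = 0
  · by_cases hk : v k = 0
    · rw [hi, hk]; ring
    · linear_combination -key k i hk
  · exact key i k hi

/-! ### Lifting morphisms from reduced schemes to reduced closed subschemes -/

/-- A morphism from a reduced scheme whose image lies in a closed set factors through the reduced
closed subscheme on that set. -/
theorem exists_lift_vanishingIdeal {T Z : Scheme.{0}} [IsReduced T] (g : T ⟶ Z) [QuasiCompact g]
    (C : TopologicalSpace.Closeds Z) (h : ∀ t, g t ∈ C) :
    ∃ g' : T ⟶ (Scheme.IdealSheafData.vanishingIdeal C).subscheme,
      g' ≫ (Scheme.IdealSheafData.vanishingIdeal C).subschemeι = g := by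
  have hle : Scheme.IdealSheafData.vanishingIdeal C ≤ g.ker := by
    have h1 : g.ker.support ≤ C := by
      intro x hx
      have hx' : x ∈ closure (Set.range g) := by
        have := g.support_ker
        rw [← this]; exact hx
      exact closure_minimal (by rintro _ ⟨t, rfl⟩; exact h t) C.isClosed hx'
    refine (Scheme.IdealSheafData.vanishingIdeal_antimono h1).trans ?_
    rw [Scheme.IdealSheafData.vanishingIdeal_support]
    intro U
    rw [Scheme.Hom.ker_apply]
    intro x hx
    have hx' : x ∈ (RingHom.ker (g.app U.1).hom).radical := by
      rw [← Scheme.Hom.ker_apply]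
      exact hx
    obtain ⟨n, hn⟩ := hx'
    rw [RingHom.mem_ker, map_pow] at hn
    exact (IsReduced.eq_zero _ ⟨n, hn⟩ : (g.app U.1).hom x = 0)
  refine ⟨IsClosedImmersion.lift (Scheme.IdealSheafData.vanishingIdeal C).subschemeι g ?_,
    IsClosedImmersion.lift_fac _ _ _⟩
  rw [Scheme.IdealSheafData.ker_subschemeι]
  exact hle

theorem mem_of_vanishingIdeal_subscheme {Z : Scheme.{0}} (C : TopologicalSpace.Closeds Z)
    (t : (Scheme.IdealSheafData.vanishingIdeal C).subscheme) :
    (Scheme.IdealSheafData.vanishingIdeal C).subschemeι t ∈ C := by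
  have h1 : (Scheme.IdealSheafData.vanishingIdeal C).subschemeι t ∈
      (Scheme.IdealSheafData.vanishingIdeal C).support := by
    have := (Scheme.IdealSheafData.vanishingIdeal C).range_subschemeι
    rw [← SetLike.mem_coe, ← this]
    exact ⟨t, rfl⟩
  have h2 : (Scheme.IdealSheafData.vanishingIdeal C).support ≤ C :=
    (Scheme.IdealSheafData.coe_support_vanishingIdeal C).le
  exact h2 h1

/-! ### Points of `Y` -/

theorem splitForm_mem : splitForm ∈ grading 2 := by
  refine Submodule.sub_mem _ ?_ ?_ <;>
  exact (MvPolynomial.isHomogeneous_X ℚ _).mul (MvPolynomial.isHomogeneous_X ℚ _)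

instance : Mono Y.ι := inferInstanceAs (Mono (Scheme.IdealSheafData.subschemeι _))

instance : Mono X.ι := inferInstanceAs (Mono (Scheme.IdealSheafData.subschemeι _))

theorem P3.pt_mem_Y_zeros {R : Type} [CommRing R] [Algebra ℚ R] {v : Fin 4 → R}
    (hv : ∃ i, IsUnit (v i)) (s : Spec (.of R)) :
    P3.pt v hv s ∈ Y.zeros ↔ v 0 * v 1 - v 2 * v 3 ∈ s.asIdeal := by
  have h := P3.pt_mem_basicOpen hv two_pos splitForm_mem s
  have h' : MvPolynomial.aeval v splitForm = v 0 * v 1 - v 2 * v 3 := by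
    simp [splitForm]
  rw [h'] at h
  rw [← not_iff_not, ← h]
  exact not_not

theorem Y.eq_of_comp_ι_eq_pt {K : Type} [Field K] [Algebra ℚ K] {v : Fin 4 → K} {hv}
    (y : Spec (.of K) ⟶ Y) (h : y ≫ Y.ι = P3.pt v hv) : v 0 * v 1 = v 2 * v 3 := by
  let s : Spec (.of K) := IsLocalRing.closedPoint K
  have h1 : (y ≫ Y.ι) s ∈ Y.zeros := mem_of_vanishingIdeal_subscheme _ (y s)
  rw [h, P3.pt_mem_Y_zeros] at h1
  have h2 : s.asIdeal = ⊥ := (Ideal.eq_bot_or_top s.asIdeal).resolve_right s.isPrime.ne_top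
  rw [h2, Ideal.mem_bot, sub_eq_zero] at h1
  exact h1

theorem Y.exists_pt {R : Type} [CommRing R] [Algebra ℚ R] [_root_.IsReduced R] {v : Fin 4 → R}
    (hv : ∃ i, IsUnit (v i)) (h : v 0 * v 1 = v 2 * v 3) :
    ∃ y : Spec (.of R) ⟶ Y, y ≫ Y.ι = P3.pt v hv := by
  have : IsReduced (Spec (.of R)) := inferInstance
  refine exists_lift_vanishingIdeal (P3.pt v hv) Y.zeros fun s => ?_
  rw [P3.pt_mem_Y_zeros, h, sub_self]
  exact zero_mem _

/-! ### Points of `X` -/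

theorem hom_SpecRat_ext {R : Type} [CommRing R] (f g : Spec (.of R) ⟶ Spec (.of ℚ)) : f = g := by
  obtain ⟨φ, rfl⟩ := Spec.map_surjective f
  obtain ⟨ψ, rfl⟩ := Spec.map_surjective g
  congr 1
  ext x
  exact congrArg (fun χ : ℚ →+* R => χ x) (RingHom.ext_rat φ.hom ψ.hom)

theorem appLE_appLE_apply {A B C : Scheme.{0}} (f : A ⟶ B) (g : B ⟶ C) {f' : A ⟶ C}
    (hf : f ≫ g = f') {U : C.Opens} {V : B.Opens} {W : A.Opens} (e₁ : V ≤ g ⁻¹ᵁ U)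
    (e₂ : W ≤ f ⁻¹ᵁ V) (e₃ : W ≤ f' ⁻¹ᵁ U) (x : Γ(C, U)) :
    f.appLE V W e₂ (g.appLE U V e₁ x) = f'.appLE U W e₃ x := by
  subst hf
  rw [← CommRingCat.comp_apply, Scheme.Hom.appLE_comp_appLE]

/-- The open sets which define `X.zeros` chart by chart cut out the expected equation on points over
a field. -/
theorem mem_X_zeros_iff_of_field {K : Type} [Field K] [Algebra ℚ K] {v w : Fin 4 → K} {hv hw}
    (g : Spec (.of K) ⟶ YP3) (h1 : g ≫ YP3.fst ≫ Y.ι = P3.pt v hv)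
    (h2 : g ≫ YP3.snd = P3.pt w hw) (s : Spec (.of K)) :
    g s ∈ X.zeros ↔ ∑ k, v k * w k ^ 2 = 0 := by
  have hsing : ∀ (U : (Spec (.of K)).Opens), s ∈ U → ⊤ ≤ U := by
    intro U hU t _
    have : t = s := Subsingleton.elim (α := PrimeSpectrum K) t s
    rw [this]; exact hU
  have hch : ∀ i j, g s ∈ YP3.chart i j ↔ v i ≠ 0 ∧ w j ≠ 0 := by
    intro i j
    have e1 : g s ∈ YP3.chart i j ↔ (g ≫ YP3.fst ≫ Y.ι) s ∈ P3.chart i ∧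
      (g ≫ YP3.snd) s ∈ P3.chart j := Iff.rfl
    have h3 : s.asIdeal = ⊥ := (Ideal.eq_bot_or_top s.asIdeal).resolve_right s.isPrime.ne_top
    rw [e1, h1, h2, P3.pt_mem_chart, P3.pt_mem_chart, h3, Ideal.mem_bot, Ideal.mem_bot]
  have hval : ∀ i j (h : ⊤ ≤ g ⁻¹ᵁ YP3.chart i j), ∃ r : K, v i * w j ^ 2 * r = ∑ k, v k * w k ^ 2 ∧
      g.appLE (YP3.chart i j) ⊤ h (YP3.diagForm i j) = (Scheme.ΓSpecIso (.of K)).inv r := by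
    intro i j h
    have hi : ⊤ ≤ P3.pt v hv ⁻¹ᵁ P3.chart i := by
      rw [← h1]; exact h.trans fun t ht => ht.1
    have hj : ⊤ ≤ P3.pt w hw ⁻¹ᵁ P3.chart j := by
      rw [← h2]; exact h.trans fun t ht => ht.2
    choose r hr hr' using fun k => P3.pt_appLE_ratio hv i k hi
    choose t ht ht' using fun k => P3.pt_appLE_ratio hw j k hj
    refine ⟨∑ k, r k * t k ^ 2, ?_, ?_⟩
    · rw [Finset.mul_sum]
      refine Finset.sum_congr rfl fun k _ => ?_
      have : v k * w k ^ 2 = v i * r k * (w j * t k) ^ 2 := by rw [hr, ht]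
      rw [this]; ring
    · have e1 : ∀ k, g.appLE (YP3.chart i j) ⊤ h ((YP3.fst ≫ Y.ι).appLE (P3.chart i)
          (YP3.chart i j) inf_le_left (P3.ratio i k)) = (Scheme.ΓSpecIso (.of K)).inv (r k) := by
        intro k
        rw [← hr' k]
        exact appLE_appLE_apply g (YP3.fst ≫ Y.ι) h1 _ _ _ _
      have e2 : ∀ k, g.appLE (YP3.chart i j) ⊤ h (YP3.snd.appLE (P3.chart j)
          (YP3.chart i j) inf_le_right (P3.ratio j k)) = (Scheme.ΓSpecIso (.of K)).inv (t k) := by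
        intro k
        rw [← ht' k]
        exact appLE_appLE_apply g YP3.snd h2 _ _ _ _
      rw [YP3.diagForm, map_sum, map_sum]
      refine Finset.sum_congr rfl fun k _ => ?_
      rw [map_mul, map_pow, e1, e2, map_mul, map_pow]
  have hmem : ∀ i j (h : ⊤ ≤ g ⁻¹ᵁ YP3.chart i j), g s ∈ YP3.basicOpen (YP3.diagForm i j) ↔
      ∑ k, v k * w k ^ 2 ≠ 0 := by
    intro i j h
    obtain ⟨r, hr, hr'⟩ := hval i j h
    obtain ⟨hi, hj⟩ := (hch i j).mp (h (Set.mem_univ s))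
    have e := Scheme.basicOpen_appLE g ⊤ (YP3.chart i j) h (YP3.diagForm i j)
    rw [hr', basicOpen_eq_of_affine] at e
    have e' : s ∈ PrimeSpectrum.basicOpen r ↔ s ∈ ⊤ ⊓ g ⁻¹ᵁ YP3.basicOpen (YP3.diagForm i j) := by
      rw [← e]; exact Iff.rfl
    have h3 : s.asIdeal = ⊥ := (Ideal.eq_bot_or_top s.asIdeal).resolve_right s.isPrime.ne_top
    have e3 : s ∈ PrimeSpectrum.basicOpen r ↔ r ≠ 0 :=
      (PrimeSpectrum.mem_basicOpen r s).trans (by rw [h3, Ideal.mem_bot])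
    rw [e3] at e'
    rw [← hr]
    constructor
    · intro h4
      have := e'.mpr ⟨trivial, h4⟩
      positivity
    · intro h4
      exact (e'.mp (right_ne_zero_of_mul h4)).2
  have hz : g s ∈ X.zeros ↔ ¬ ∃ i j, g s ∈ YP3.basicOpen (YP3.diagForm i j) := by
    simp only [← TopologicalSpace.Opens.mem_iSup]
    exact Iff.rfl
  rw [hz]
  constructor
  · intro h
    by_contra h4
    obtain ⟨i, hi⟩ := id hv
    obtain ⟨j, hj⟩ := id hw
    have hij := (hch i j).mpr ⟨hi.ne_zero, hj.ne_zero⟩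
    exact h ⟨i, j, (hmem i j (hsing _ hij)).mpr h4⟩
  · rintro h ⟨i, j, hij⟩
    exact (hmem i j (hsing _ (YP3.basicOpen_le _ hij))).mp hij h

/-- `g` is the point of `X` with homogeneous coordinates `(y, x)`. -/
def X.HasCoords {R : Type} [CommRing R] [Algebra ℚ R] (g : Spec (.of R) ⟶ X) (y x : Fin 4 → R) :
    Prop :=
  ∃ hy hx, g ≫ X.π ≫ Y.ι = P3.pt y hy ∧ g ≫ X.ι ≫ YP3.snd = P3.pt x hx

theorem X.hom_ext {R : Type} [CommRing R] [Algebra ℚ R] {g g' : Spec (.of R) ⟶ X}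
    {y x : Fin 4 → R} (h : HasCoords g y x) (h' : HasCoords g' y x) : g = g' := by
  obtain ⟨hy, hx, h1, h2⟩ := h
  obtain ⟨_, _, h3, h4⟩ := h'
  rw [← cancel_mono X.ι]
  refine pullback.hom_ext ?_ ?_
  · rw [← cancel_mono Y.ι]
    change ((g ≫ X.ι) ≫ YP3.fst) ≫ Y.ι = ((g' ≫ X.ι) ≫ YP3.fst) ≫ Y.ι
    simpa [X.π] using h1.trans h3.symm
  · change (g ≫ X.ι) ≫ YP3.snd = (g' ≫ X.ι) ≫ YP3.snd
    simpa using h2.trans h4.symm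

theorem X.HasCoords.comp {R S : Type} [CommRing R] [Algebra ℚ R] [CommRing S] [Algebra ℚ S]
    {g : Spec (.of R) ⟶ X} {y x : Fin 4 → R} (h : HasCoords g y x) (φ : R →+* S) :
    HasCoords (Spec.map (CommRingCat.ofHom φ) ≫ g) (fun i => φ (y i)) (fun i => φ (x i)) := by
  obtain ⟨hy, hx, h1, h2⟩ := h
  refine ⟨hy.imp fun i hi => hi.map φ, hx.imp fun i hi => hi.map φ, ?_, ?_⟩
  · rw [Category.assoc, h1, P3.SpecMap_pt]
  · rw [Category.assoc, h2, P3.SpecMap_pt]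

theorem X.HasCoords.eqs {K : Type} [Field K] [Algebra ℚ K] {g : Spec (.of K) ⟶ X}
    {y x : Fin 4 → K} (h : HasCoords g y x) :
    y 0 * y 1 = y 2 * y 3 ∧ ∑ k, y k * x k ^ 2 = 0 := by
  obtain ⟨hy, hx, h1, h2⟩ := h
  refine ⟨Y.eq_of_comp_ι_eq_pt (g ≫ X.π) (by simpa using h1), ?_⟩
  rw [← mem_X_zeros_iff_of_field (g ≫ X.ι) (by simpa [X.π] using h1) (by simpa using h2)
    (IsLocalRing.closedPoint K)]
  exact mem_of_vanishingIdeal_subscheme _ (g (IsLocalRing.closedPoint K))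

theorem X.exists_hasCoords {K : Type} [Field K] [Algebra ℚ K] (g : Spec (.of K) ⟶ X) :
    ∃ y x : Fin 4 → K, HasCoords g y x := by
  obtain ⟨y, hy, h1⟩ := P3.exists_eq_pt (g ≫ X.π ≫ Y.ι)
  obtain ⟨x, hx, h2⟩ := P3.exists_eq_pt (g ≫ X.ι ≫ YP3.snd)
  exact ⟨y, x, _, _, h1, h2⟩

instance : QuasiSeparatedSpace YP3 := by
  have h1 : QuasiSeparated P3.toSpec := by
    rw [P3.toSpec]; infer_instance
  have h2 : QuasiSeparated YP3.fst :=
    inferInstanceAs (QuasiSeparated (pullback.fst (Y.ι ≫ P3.toSpec) P3.toSpec))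
  have h3 : QuasiSeparatedSpace Y := by
    have : IsSeparated Y.ι :=
      inferInstanceAs (IsSeparated (Scheme.IdealSheafData.vanishingIdeal Y.zeros).subschemeι)
    exact quasiSeparatedSpace_of_quasiSeparated Y.ι
  exact quasiSeparatedSpace_of_quasiSeparated YP3.fst

/-- Solutions of the equations in a domain define points of `X`. Since `X` carries the reduced
structure, the equations need only be checked at the points of the spectrum. -/
theorem X.exists_of_coords {R : Type} [CommRing R] [IsDomain R] [Algebra ℚ R] {y x : Fin 4 → R}
    (hy : ∃ i, IsUnit (y i)) (hx : ∃ i, IsUnit (x i)) (h1 : y 0 * y 1 = y 2 * y 3)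
    (h2 : ∑ k, y k * x k ^ 2 = 0) : ∃ g : Spec (.of R) ⟶ X, HasCoords g y x := by
  obtain ⟨gy, hgy⟩ := Y.exists_pt hy h1
  let g0 : Spec (.of R) ⟶ YP3 := pullback.lift gy (P3.pt x hx) (hom_SpecRat_ext _ _)
  have e1 : g0 ≫ YP3.fst = gy := pullback.lift_fst _ _ _
  have e2 : g0 ≫ YP3.snd = P3.pt x hx := pullback.lift_snd _ _ _
  have : IsReduced (Spec (.of R)) := inferInstance
  obtain ⟨g, hg⟩ : ∃ g : Spec (.of R) ⟶ X, g ≫ X.ι = g0 := by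
    refine exists_lift_vanishingIdeal g0 X.zeros fun s => ?_
    have := s.isPrime
    let φ : R →+* s.asIdeal.ResidueField := algebraMap R _
    have hs : ∃ t, Spec.map (CommRingCat.ofHom φ) t = s := by
      refine ⟨(⊥ : PrimeSpectrum s.asIdeal.ResidueField), PrimeSpectrum.ext ?_⟩
      exact Ideal.ker_algebraMap_residueField s.asIdeal
    obtain ⟨t, ht⟩ := hs
    rw [← ht]
    have := (mem_X_zeros_iff_of_field (v := fun i => φ (y i)) (w := fun i => φ (x i))
      (hv := hy.imp fun i hi => hi.map φ) (hw := hx.imp fun i hi => hi.map φ)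
      (Spec.map (CommRingCat.ofHom φ) ≫ g0) (by
        rw [Category.assoc, reassoc_of% e1, hgy, P3.SpecMap_pt]) (by
        rw [Category.assoc, e2, P3.SpecMap_pt]) t).mpr (by
          rw [← map_zero φ, ← h2]; simp)
    exact this
  refine ⟨g, hy, hx, ?_, ?_⟩
  · rw [X.π, Category.assoc, reassoc_of% hg, reassoc_of% e1, hgy]
  · rw [reassoc_of% hg, e2]

/-! ### Moving points of `X` into general position -/

theorem X.HasCoords.scale {R : Type} [CommRing R] [Algebra ℚ R] {g : Spec (.of R) ⟶ X}
    {y x y' x' : Fin 4 → R} (h : HasCoords g y x) (u w : R) (hu : ∀ i, y i = u * y' i)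
    (hw : ∀ i, x i = w * x' i) : HasCoords g y' x' := by
  obtain ⟨hy, hx, h1, h2⟩ := h
  have hy' : ∃ i, IsUnit (y' i) := hy.imp fun i hi =>
    isUnit_of_mul_isUnit_right (by rw [← hu]; exact hi)
  have hx' : ∃ i, IsUnit (x' i) := hx.imp fun i hi =>
    isUnit_of_mul_isUnit_right (by rw [← hw]; exact hi)
  exact ⟨hy', hx', h1.trans (P3.pt_eq_pt hy hy' u hu), h2.trans (P3.pt_eq_pt hx hx' w hw)⟩

/-- The parametrisation of the quadric `y₀ y₁ = y₂ y₃` by pairs `(a, b)`, `(c, d)`. -/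
theorem exists_segre {K : Type*} [Field K] {y : Fin 4 → K}
    (h : y 0 * y 1 = y 2 * y 3) :
    ∃ a b c d : K, y = ![a * c, b * d, a * d, b * c] := by
  by_cases h0 : y 0 = 0
  · by_cases h2 : y 2 = 0
    · refine ⟨0, 1, y 3, y 1, ?_⟩
      ext i; fin_cases i <;> simp [h0, h2]
    · have h3 : y 3 = 0 := by
        rw [h0, zero_mul] at h
        exact (mul_eq_zero.mp h.symm).resolve_left h2
      refine ⟨y 2, y 1, 0, 1, ?_⟩
      ext i; fin_cases i <;> simp [h0, h3]
  · refine ⟨y 0, y 3, 1, y 2 / y 0, ?_⟩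
    ext i; fin_cases i
    · simp
    · simp only [Fin.mk_one, Matrix.cons_val_one, Matrix.cons_val_zero]
      field_simp
      linear_combination h
    · simp; field_simp
    · simp

/-- An open set which contains `s` contains all generisations of `s`. -/
theorem specMap_mem_of_ker_le {R L : Type} [CommRing R] [Field L] (φ : R →+* L)
    (V : (Spec (.of R)).Opens) (s : Spec (.of R)) (hs : s ∈ V) (h : RingHom.ker φ ≤ s.asIdeal)
    (t : Spec (.of L)) : Spec.map (CommRingCat.ofHom φ) t ∈ V := by
  have h1 : (Spec.map (CommRingCat.ofHom φ) t).asIdeal ≤ s.asIdeal := by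
    have ht : t.asIdeal = ⊥ := (Ideal.eq_bot_or_top t.asIdeal).resolve_right t.isPrime.ne_top
    intro x hx
    refine h ?_
    have : φ x ∈ t.asIdeal := hx
    rwa [ht] at this
  have h2 : (Spec.map (CommRingCat.ofHom φ) t) ⤳ s :=
    (PrimeSpectrum.le_iff_specializes _ _).mp h1
  exact h2.mem_open V.isOpen hs

/-- The open set `U ⊆ X` contains the point over the field `K` with coordinates
`y = (ac, bd, ad, bc)` and `x`. -/
def X.ContainsPoint (U : X.Opens) (K : Type) [Field K] [Algebra ℚ K] (a b c d : K)
    (x : Fin 4 → K) : Prop :=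
  ∃ g : Spec (.of K) ⟶ X, HasCoords g ![a * c, b * d, a * d, b * c] x ∧
    g (IsLocalRing.closedPoint K) ∈ U

open Polynomial in
/-- The inclusion of `K[t]` in the field of fractions of `K⟦t⟧`. -/
def polyToLaurent (K : Type) [Field K] : K[X] →+* FractionRing (PowerSeries K) :=
  (algebraMap (PowerSeries K) _).comp Polynomial.coeToPowerSeries.ringHom

theorem polyToLaurent_injective (K : Type) [Field K] : Function.Injective (polyToLaurent K) :=
  (IsFractionRing.injective (PowerSeries K) _).comp (Polynomial.coe_injective K)

open Polynomial in
/-- If `U` contains the special point of a curve in `X`, then it contains its generic point. -/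
theorem X.ContainsPoint.generize {U : X.Opens} {K : Type} [Field K] [Algebra ℚ K]
    {a b c d : K} {x : Fin 4 → K} (h : ContainsPoint U K a b c d x) (A B C D : K[X])
    (ξ : Fin 4 → K[X]) (hA : A.eval 0 = a) (hB : B.eval 0 = b) (hC : C.eval 0 = c)
    (hD : D.eval 0 = d) (hξ : ∀ i, (ξ i).eval 0 = x i)
    (heq : C * (A * ξ 0 ^ 2 + B * ξ 3 ^ 2) + D * (B * ξ 1 ^ 2 + A * ξ 2 ^ 2) = 0) :
    ContainsPoint U (FractionRing (PowerSeries K)) (polyToLaurent K A) (polyToLaurent K B)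
      (polyToLaurent K C) (polyToLaurent K D) (fun i => polyToLaurent K (ξ i)) := by
  obtain ⟨g, hg, hgU⟩ := h
  obtain ⟨hy, hx, -, -⟩ := id hg
  have hcoe : ∀ p : K[X], PowerSeries.constantCoeff (p : PowerSeries K) = p.eval 0 := fun p => by
    rw [Polynomial.constantCoeff_coe, Polynomial.coeff_zero_eq_eval_zero]
  let Y' : Fin 4 → PowerSeries K := fun i => ((![A * C, B * D, A * D, B * C] i : K[X]))
  let X' : Fin 4 → PowerSeries K := fun i => (ξ i : K[X])
  have hY : ∀ i, PowerSeries.constantCoeff (Y' i) = ![a * c, b * d, a * d, b * c] i := by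
    intro i
    simp only [Y', hcoe]
    fin_cases i <;> simp [hA, hB, hC, hD]
  have hX : ∀ i, PowerSeries.constantCoeff (X' i) = x i := fun i => by
    simp only [X', hcoe, hξ]
  obtain ⟨G, hG⟩ := X.exists_of_coords (y := Y') (x := X')
    (hy.imp fun i hi => PowerSeries.isUnit_iff_constantCoeff.mpr (by rw [hY]; exact hi))
    (hx.imp fun i hi => PowerSeries.isUnit_iff_constantCoeff.mpr (by rw [hX]; exact hi))
    (by simp [Y']; ring) (by
      have := congrArg (fun p : K[X] => (p : PowerSeries K)) heq
      simp only [Polynomial.coe_add, Polynomial.coe_mul, Polynomial.coe_pow,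
        Polynomial.coe_zero] at this
      simp [Y', X', Fin.sum_univ_four]
      linear_combination this)
  have e1 : Spec.map (CommRingCat.ofHom (PowerSeries.constantCoeff (R := K))) ≫ G = g := by
    have := hG.comp (PowerSeries.constantCoeff (R := K))
    simp only [hY, hX] at this
    exact X.hom_ext this hg
  refine ⟨Spec.map (CommRingCat.ofHom
    (algebraMap (PowerSeries K) (FractionRing (PowerSeries K)))) ≫ G, ?_, ?_⟩
  · have := hG.comp (algebraMap (PowerSeries K) (FractionRing (PowerSeries K)))
    convert! this using 1
    ext i
    fin_cases i <;> simp [Y', polyToLaurent]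
  · refine specMap_mem_of_ker_le _ (G ⁻¹ᵁ U)
      (Spec.map (CommRingCat.ofHom (PowerSeries.constantCoeff (R := K)))
        (IsLocalRing.closedPoint K)) ?_ ?_ _
    · rw [← e1] at hgU
      exact hgU
    · rw [(RingHom.injective_iff_ker_eq_bot _).mp (IsFractionRing.injective (PowerSeries K) _)]
      exact bot_le

theorem X.ContainsPoint.eqs {U : X.Opens} {K : Type} [Field K] [Algebra ℚ K]
    {a b c d : K} {x : Fin 4 → K} (h : ContainsPoint U K a b c d x) :
    c * (a * x 0 ^ 2 + b * x 3 ^ 2) + d * (b * x 1 ^ 2 + a * x 2 ^ 2) = 0 ∧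
      (a ≠ 0 ∨ b ≠ 0) ∧ (c ≠ 0 ∨ d ≠ 0) := by
  obtain ⟨g, hg, -⟩ := h
  refine ⟨?_, ?_, ?_⟩
  · have := hg.eqs.2
    simp [Fin.sum_univ_four] at this
    linear_combination this
  all_goals
    obtain ⟨⟨i, hi⟩, -⟩ := hg
    by_contra! h0
    fin_cases i <;> simp [h0] at hi

open Polynomial in
/-- A nonempty open set containing a point over which `(c, d)` is determined by `(a, b)` and `x`
contains such a point which is generic enough: one may move `(a, b, x)` along a line. -/
theorem X.ContainsPoint.exists_ne_zero {U : X.Opens} {K : Type} [Field K] [Algebra ℚ K]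
    {a b c d : K} {x : Fin 4 → K} (h : ContainsPoint U K a b c d x)
    (hPQ : a * x 0 ^ 2 + b * x 3 ^ 2 ≠ 0 ∨ b * x 1 ^ 2 + a * x 2 ^ 2 ≠ 0) :
    ∃ (L : Type) (_ : Field L) (_ : Algebra ℚ L) (a b c d : L) (x : Fin 4 → L),
      ContainsPoint U L a b c d x ∧ a ≠ 0 ∧ c ≠ 0 ∧ x 0 ≠ 0 ∧ b * x 1 ^ 2 + a * x 2 ^ 2 ≠ 0 := by
  have : CharZero K := algebraRat.charZero K
  obtain ⟨h0, -, hcd⟩ := h.eqs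
  obtain ⟨l, hc, hd⟩ : ∃ l : K, c = l * (b * x 1 ^ 2 + a * x 2 ^ 2) ∧
      d = - (l * (a * x 0 ^ 2 + b * x 3 ^ 2)) := by
    generalize a * x 0 ^ 2 + b * x 3 ^ 2 = P at *
    generalize b * x 1 ^ 2 + a * x 2 ^ 2 = Q at *
    rcases hPQ with hP | hQ
    · refine ⟨-d / P, ?_, by field_simp⟩
      field_simp
      linear_combination h0
    · refine ⟨c / Q, by field_simp, ?_⟩
      field_simp
      linear_combination h0
  have hl : l ≠ 0 := by
    rintro rfl
    simp [hc, hd] at hcd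
  let Q : K[X] := (Polynomial.X + C b) * (Polynomial.X + C (x 1)) ^ 2 +
    (Polynomial.X + C a) * (Polynomial.X + C (x 2)) ^ 2
  let P : K[X] := (Polynomial.X + C a) * (Polynomial.X + C (x 0)) ^ 2 +
    (Polynomial.X + C b) * (Polynomial.X + C (x 3)) ^ 2
  have hQ : Q ≠ 0 := by
    intro hQ
    have e : Q = C 2 * Polynomial.X ^ 3 + C (b + 2 * x 1 + a + 2 * x 2) * Polynomial.X ^ 2 +
        C (2 * x 1 * b + x 1 ^ 2 + 2 * x 2 * a + x 2 ^ 2) * Polynomial.X +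
        C (b * x 1 ^ 2 + a * x 2 ^ 2) := by
      simp only [Q, map_add, map_mul, map_pow, map_ofNat]
      ring
    have hco : ∀ u v w : K, (C 2 * Polynomial.X ^ 3 + C u * Polynomial.X ^ 2 +
        C v * Polynomial.X + C w).coeff 3 = 2 := fun u v w => by simp
    rw [hQ] at e
    have := hco _ _ _ ▸ congrArg (fun p => coeff p 3) e
    simp at this
  have key := h.generize (Polynomial.X + C a) (Polynomial.X + C b) (C l * Q) (-(C l * P))
    (fun i => Polynomial.X + C (x i))
    (by simp) (by simp) (by simp [Q, hc]) (by simp [P, hd]) (by simp) (by simp only [P, Q]; ring)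
  refine ⟨_, _, inferInstance, _, _, _, _, _, key, ?_, ?_, ?_, ?_⟩
  · exact (map_ne_zero_iff _ (polyToLaurent_injective K)).mpr (X_add_C_ne_zero _)
  · exact (map_ne_zero_iff _ (polyToLaurent_injective K)).mpr
      (mul_ne_zero (by simpa using hl) hQ)
  · exact (map_ne_zero_iff _ (polyToLaurent_injective K)).mpr (X_add_C_ne_zero _)
  · have := (map_ne_zero_iff _ (polyToLaurent_injective K)).mpr hQ
    simpa [Q] using this

open Polynomial in
/-- Moving a point along a curve in a fibre of `X`, with `a`, `b`, `c`, `d` fixed. -/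
theorem X.ContainsPoint.move {U : X.Opens} {K : Type} [Field K] [Algebra ℚ K]
    {a b c d : K} {x : Fin 4 → K} (h : ContainsPoint U K a b c d x) (ξ : Fin 4 → K[X])
    (hξ : ∀ i, (ξ i).eval 0 = x i)
    (heq : C c * (C a * ξ 0 ^ 2 + C b * ξ 3 ^ 2) + C d * (C b * ξ 1 ^ 2 + C a * ξ 2 ^ 2) = 0)
    (hPQ : C a * ξ 0 ^ 2 + C b * ξ 3 ^ 2 ≠ 0 ∨ C b * ξ 1 ^ 2 + C a * ξ 2 ^ 2 ≠ 0) :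
    ∃ (L : Type) (_ : Field L) (_ : Algebra ℚ L) (a b c d : L) (x : Fin 4 → L),
      ContainsPoint U L a b c d x ∧
        (a * x 0 ^ 2 + b * x 3 ^ 2 ≠ 0 ∨ b * x 1 ^ 2 + a * x 2 ^ 2 ≠ 0) := by
  have key := h.generize (C a) (C b) (C c) (C d) ξ
    (by simp) (by simp) (by simp) (by simp) hξ heq
  refine ⟨_, _, inferInstance, _, _, _, _, _, key, ?_⟩
  refine hPQ.imp (fun hP => ?_) (fun hP => ?_) <;>
  · have := (map_ne_zero_iff _ (polyToLaurent_injective K)).mpr hP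
    simpa using this

open Polynomial in
/-- Moving a point in the case where the two halves of the quadratic form are both products of two
linear forms, `m₁ m₂` and `l₁ l₂`. -/
theorem X.ContainsPoint.move_of_split {U : X.Opens} {K : Type} [Field K] [Algebra ℚ K]
    {a b c d : K} {x : Fin 4 → K} (h : ContainsPoint U K a b c d x) {s : K} (hs0 : s ≠ 0)
    (ha : a ≠ 0) (hc : c ≠ 0) (hs : b = - (a * s ^ 2)) (m₁ m₂ l₁ l₂ : K[X])
    (hm₁ : m₁.eval 0 = x 0 - s * x 3) (hm₂ : m₂.eval 0 = x 0 + s * x 3)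
    (hl₁ : l₁.eval 0 = x 2 - s * x 1) (hl₂ : l₂.eval 0 = x 2 + s * x 1)
    (heq : m₁ * m₂ = C (-(d / c)) * (l₁ * l₂)) (hne : m₁ * m₂ ≠ 0) :
    ∃ (L : Type) (_ : Field L) (_ : Algebra ℚ L) (a b c d : L) (x : Fin 4 → L),
      ContainsPoint U L a b c d x ∧
        (a * x 0 ^ 2 + b * x 3 ^ 2 ≠ 0 ∨ b * x 1 ^ 2 + a * x 2 ^ 2 ≠ 0) := by
  have : CharZero K := algebraRat.charZero K
  have e2 : C (1 / 2 : K) * 2 = 1 := by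
    rw [← map_ofNat C, ← C_mul]; norm_num
  have es : C (1 / (2 * s) : K) * C s = C (1 / 2) := by
    rw [← C_mul]; congr 1; field_simp
  have e4 : C (1 / 2 : K) ^ 2 * 4 = 1 := by linear_combination (C (1 / 2 : K) * 2 + 1) * e2
  have e1 : C a * (C (1 / 2) * (m₁ + m₂)) ^ 2 + C b * (C (1 / (2 * s)) * (m₂ - m₁)) ^ 2 =
      C a * (m₁ * m₂) := by
    rw [hs, C_neg, C_mul, C_pow]
    linear_combination -C a * (m₂ - m₁) ^ 2 * (C (1 / (2 * s) : K) * C s + C (1 / 2)) * es +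
      C a * m₁ * m₂ * e4
  have e1' : C b * (C (1 / (2 * s)) * (l₂ - l₁)) ^ 2 + C a * (C (1 / 2) * (l₁ + l₂)) ^ 2 =
      C a * (l₁ * l₂) := by
    rw [hs, C_neg, C_mul, C_pow]
    linear_combination -C a * (l₂ - l₁) ^ 2 * (C (1 / (2 * s) : K) * C s + C (1 / 2)) * es +
      C a * l₁ * l₂ * e4
  have ec : C c * C (-(d / c)) = - C d := by
    rw [← C_mul, ← C_neg]; congr 1; field_simp
  refine h.move ![C (1 / 2) * (m₁ + m₂), C (1 / (2 * s)) * (l₂ - l₁), C (1 / 2) * (l₁ + l₂),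
    C (1 / (2 * s)) * (m₂ - m₁)] ?_ ?_ (Or.inl ?_)
  · intro i
    fin_cases i <;> simp [hm₁, hm₂, hl₁, hl₂] <;> field_simp <;> ring
  · simp only [Matrix.cons_val, e1, e1', heq]
    linear_combination C a * l₁ * l₂ * ec
  · simp only [Matrix.cons_val, e1]
    exact mul_ne_zero (by simpa using ha) hne

open Polynomial in
/-- If both halves `a x₀² + b x₃²` and `b x₁² + a x₂²` of the form vanish at a point, then the point
is the specialisation of one where they do not both vanish. The curve depends on which of `a`, `b`,
`c`, `d` are zero; if none of them is, both halves are products of two linear forms. -/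
theorem X.ContainsPoint.exists_of_isAlgClosed {U : X.Opens} {K : Type} [Field K] [IsAlgClosed K]
    [Algebra ℚ K] {a b c d : K} {x : Fin 4 → K} (h : ContainsPoint U K a b c d x) :
    ∃ (L : Type) (_ : Field L) (_ : Algebra ℚ L) (a b c d : L) (x : Fin 4 → L),
      ContainsPoint U L a b c d x ∧
        (a * x 0 ^ 2 + b * x 3 ^ 2 ≠ 0 ∨ b * x 1 ^ 2 + a * x 2 ^ 2 ≠ 0) := by
  have : CharZero K := algebraRat.charZero K
  by_cases hPQ : a * x 0 ^ 2 + b * x 3 ^ 2 ≠ 0 ∨ b * x 1 ^ 2 + a * x 2 ^ 2 ≠ 0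
  · exact ⟨K, _, _, a, b, c, d, x, h, hPQ⟩
  push Not at hPQ
  obtain ⟨hP, hQ⟩ := hPQ
  obtain ⟨-, hab, hcd⟩ := h.eqs
  -- a quadratic polynomial in `t` vanishing at `±1` and `0` is zero
  have hquad : ∀ u v z : K, u ≠ 0 → C u * (C v + Polynomial.X) ^ 2 + C z ≠ 0 := by
    intro u v z hu h0
    have h1 := congrArg (eval 1) h0
    have h2 := congrArg (eval (-1)) h0
    have h3 := congrArg (eval 0) h0
    simp at h1 h2 h3
    apply hu
    linear_combination (1 / 2 : K) * h1 + (1 / 2 : K) * h2 - h3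
  have hP' := congrArg C hP
  have hQ' := congrArg C hQ
  simp only [map_add, map_mul, map_pow, map_zero] at hP' hQ'
  by_cases hd : d = 0
  · by_cases hb : b = 0
    · refine h.move ![C (x 0), C (x 1), C (x 2) + Polynomial.X, C (x 3)] ?_ ?_ (Or.inr ?_)
      · intro i; fin_cases i <;> simp
      · simp [hd]; right; exact hP'
      · have := hquad a (x 2) (b * x 1 ^ 2) (by simpa [hb] using hab)
        simpa [add_comm] using this
    · refine h.move ![C (x 0), C (x 1) + Polynomial.X, C (x 2), C (x 3)] ?_ ?_ (Or.inr ?_)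
      · intro i; fin_cases i <;> simp
      · simp [hd]; right; exact hP'
      · have := hquad b (x 1) (a * x 2 ^ 2) hb
        simpa [add_comm] using this
  by_cases hc : c = 0
  · by_cases hb : b = 0
    · refine h.move ![C (x 0) + Polynomial.X, C (x 1), C (x 2), C (x 3)] ?_ ?_ (Or.inl ?_)
      · intro i; fin_cases i <;> simp
      · simp [hc]; right; exact hQ'
      · have := hquad a (x 0) (b * x 3 ^ 2) (by simpa [hb] using hab)
        simpa [add_comm] using this
    · refine h.move ![C (x 0), C (x 1), C (x 2), C (x 3) + Polynomial.X] ?_ ?_ (Or.inl ?_)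
      · intro i; fin_cases i <;> simp
      · simp [hc]; right; exact hQ'
      · have := hquad b (x 3) (a * x 0 ^ 2) hb
        simpa [add_comm] using this
  by_cases hb : b = 0
  · have ha : a ≠ 0 := by simpa [hb] using hab
    have h0 : x 0 = 0 := by simpa [hb, ha] using hP
    have h2 : x 2 = 0 := by simpa [hb, ha] using hQ
    obtain ⟨e, he⟩ := IsAlgClosed.exists_pow_nat_eq (-(c / d)) two_pos
    have he' : C c + C d * C e ^ 2 = 0 := by
      rw [← C_pow, he, ← C_mul, ← C_add, ← C_0]; congr 1; field_simp; ring
    refine h.move ![Polynomial.X, C (x 1), C e * Polynomial.X, C (x 3)] ?_ ?_ (Or.inl ?_)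
    · intro i; fin_cases i <;> simp [h0, h2]
    · simp [hb]; linear_combination C a * Polynomial.X ^ 2 * he'
    · simp [hb, ha]
  by_cases ha : a = 0
  · have h0 : x 3 = 0 := by simpa [hb, ha] using hP
    have h2 : x 1 = 0 := by simpa [hb, ha] using hQ
    obtain ⟨e, he⟩ := IsAlgClosed.exists_pow_nat_eq (-(c / d)) two_pos
    have he' : C c + C d * C e ^ 2 = 0 := by
      rw [← C_pow, he, ← C_mul, ← C_add, ← C_0]; congr 1; field_simp; ring
    refine h.move ![C (x 0), C e * Polynomial.X, C (x 2), Polynomial.X] ?_ ?_ (Or.inl ?_)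
    · intro i; fin_cases i <;> simp [h0, h2]
    · simp [ha]; linear_combination C b * Polynomial.X ^ 2 * he'
    · simp [hb, ha]
  obtain ⟨s, hs0, hs, hm⟩ : ∃ s : K, s ≠ 0 ∧ b = -(a * s ^ 2) ∧ x 0 - s * x 3 = 0 := by
    obtain ⟨s, hs⟩ := IsAlgClosed.exists_pow_nat_eq (-(b / a)) two_pos
    have hb' : b = -(a * s ^ 2) := by rw [hs]; field_simp
    have hs0 : s ≠ 0 := by rintro rfl; simp [hb] at hb'
    have : (x 0 - s * x 3) * (x 0 + s * x 3) = 0 := by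
      refine (mul_eq_zero.mp ?_ : a = 0 ∨ _).resolve_left ha
      linear_combination hP - x 3 ^ 2 * hb'
    rcases mul_eq_zero.mp this with h1 | h1
    · exact ⟨s, hs0, hb', h1⟩
    · exact ⟨-s, neg_ne_zero.mpr hs0, by rw [neg_sq]; exact hb', by linear_combination h1⟩
  have hl : (x 2 - s * x 1) * (x 2 + s * x 1) = 0 := by
    refine (mul_eq_zero.mp ?_ : a = 0 ∨ _).resolve_left ha
    linear_combination hQ - x 1 ^ 2 * hs
  -- The factors `m₁` and `l₁` (or `l₂`) which vanish at the point become multiples of `t`, chosen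
  -- such that `c m₁ m₂ + d l₁ l₂ = 0` remains true; the other two factors are moved by `t`.
  have hk : C (-(d / c)) ≠ 0 := by simp [hc, hd]
  have hX : ∀ z : K, C z + Polynomial.X ≠ 0 := fun z => by rw [add_comm]; exact X_add_C_ne_zero z
  rcases mul_eq_zero.mp hl with hl | hl
  · refine h.move_of_split hs0 ha hc hs
      (C (-(d / c)) * (Polynomial.X * (C (x 2 + s * x 1) + Polynomial.X)))
      (C (x 0 + s * x 3) + Polynomial.X) (Polynomial.X * (C (x 0 + s * x 3) + Polynomial.X))
      (C (x 2 + s * x 1) + Polynomial.X)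
      (by simp [hm]) (by simp) (by simp [hl]) (by simp) (by ring) ?_
    exact mul_ne_zero (mul_ne_zero hk (mul_ne_zero X_ne_zero (hX _))) (hX _)
  · refine h.move_of_split hs0 ha hc hs
      (C (-(d / c)) * (Polynomial.X * (C (x 2 - s * x 1) + Polynomial.X)))
      (C (x 0 + s * x 3) + Polynomial.X) (C (x 2 - s * x 1) + Polynomial.X)
      (Polynomial.X * (C (x 0 + s * x 3) + Polynomial.X))
      (by simp [hm]) (by simp) (by simp) (by simp [hl]) (by ring) ?_
    exact mul_ne_zero (mul_ne_zero hk (mul_ne_zero X_ne_zero (hX _))) (hX _)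

/-- A nonempty open subset of `X` contains a point at which the rational parametrisation of `X` can
be inverted. -/
theorem X.exists_containsPoint {U : X.Opens} (hU : (U : Set X).Nonempty) :
    ∃ (L : Type) (_ : Field L) (_ : Algebra ℚ L) (a b c d : L) (x : Fin 4 → L),
      ContainsPoint U L a b c d x ∧ a ≠ 0 ∧ c ≠ 0 ∧ x 0 ≠ 0 ∧ b * x 1 ^ 2 + a * x 2 ^ 2 ≠ 0 := by
  obtain ⟨u, hu⟩ := hU
  let K := AlgebraicClosure (X.residueField u)
  let g : Spec (.of K) ⟶ X :=
    Spec.map (CommRingCat.ofHom (algebraMap (X.residueField u) K)) ≫ X.fromSpecResidueField u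
  let _ : Algebra ℚ K := (Spec.preimage (g ≫ X.toSpec)).hom.toAlgebra
  obtain ⟨y, x, hg⟩ := X.exists_hasCoords g
  obtain ⟨a, b, c, d, rfl⟩ := exists_segre hg.eqs.1
  have h : ContainsPoint U K a b c d x := ⟨g, hg, by
    have : g (IsLocalRing.closedPoint K) = u :=
      X.fromSpecResidueField_apply u _
    rw [this]; exact hu⟩
  obtain ⟨L, _, _, a, b, c, d, x, h, hPQ⟩ := h.exists_of_isAlgClosed
  exact h.exists_ne_zero hPQ

/-! ### A rational parametrisation of `X` -/

open MvPolynomial in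
/-- The denominator of the parametrisation of `X`. -/
def paramDenom : MvPolynomial (Fin 4) ℚ := .X 0 * .X 1 ^ 2 + .X 2 ^ 2

theorem paramDenom_ne_zero : paramDenom ≠ 0 := by
  intro h
  have := congrArg (MvPolynomial.eval (fun _ => (1 : ℚ))) h
  norm_num [paramDenom] at this

/-- The ring of functions on the source of the parametrisation of `X`. -/
abbrev ParamRing : Type := Localization.Away paramDenom

instance : IsDomain ParamRing :=
  IsLocalization.isDomain_localization
    (powers_le_nonZeroDivisors_of_noZeroDivisors paramDenom_ne_zero)

/-- The coordinates `y` of the parametrisation, as polynomials: in terms of parameters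
`β, t₁, t₂, t₃`, this is the point `(1, β)` of the first and the point `(γ, δ)` of the second factor
of `ℙ¹ × ℙ¹`, where `(γ, δ)` is chosen such that `(1, t₁, t₂, t₃)` lies on the fibre. -/
def paramY : Fin 4 → MvPolynomial (Fin 4) ℚ :=
  ![paramDenom, - (.X 0 * (1 + .X 0 * .X 3 ^ 2)), - (1 + .X 0 * .X 3 ^ 2), .X 0 * paramDenom]

/-- The coordinates `x` of the parametrisation, as polynomials. -/
def paramX : Fin 4 → MvPolynomial (Fin 4) ℚ := ![1, .X 1, .X 2, .X 3]

/-- The parametrisation is a morphism to `X` from the open set of `𝔸⁴` where the denominator does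
not vanish. -/
theorem exists_param : ∃ Φ : Spec (.of ParamRing) ⟶ X,
    X.HasCoords Φ (fun i => algebraMap _ ParamRing (paramY i))
      (fun i => algebraMap _ ParamRing (paramX i)) := by
  refine X.exists_of_coords ⟨0, IsLocalization.Away.algebraMap_isUnit paramDenom⟩
    ⟨0, by simp [paramX]⟩ ?_ ?_
  · simp only [← map_mul]
    congr 1
    simp [paramY]; ring
  · simp only [← map_mul, ← map_pow, ← map_sum]
    rw [← map_zero (algebraMap (MvPolynomial (Fin 4) ℚ) ParamRing)]
    congr 1
    simp [paramY, paramX, Fin.sum_univ_four, paramDenom]; ring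

theorem mem_basicOpen_of_ne_zero {R L : Type} [CommRing R] [Field L] (φ : R →+* L) {r : R}
    (h : φ r ≠ 0) (t : Spec (.of L)) :
    Spec.map (CommRingCat.ofHom φ) t ∈ PrimeSpectrum.basicOpen r := by
  have ht : t.asIdeal = ⊥ := (Ideal.eq_bot_or_top t.asIdeal).resolve_right t.isPrime.ne_top
  intro h1
  have h2 : φ r ∈ t.asIdeal := h1
  rw [ht] at h2
  exact h h2

open MvPolynomial in
/-- The parametrisation is dominant: off the zeros of a nonzero polynomial, it takes values
in a given nonempty open set. -/
theorem X.exists_param_mem {U : X.Opens} (hU : (U : Set X).Nonempty) (Φ : Spec (.of ParamRing) ⟶ X)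
    (hΦ : X.HasCoords Φ (fun i => algebraMap _ ParamRing (paramY i))
      (fun i => algebraMap _ ParamRing (paramX i))) :
    ∃ s : MvPolynomial (Fin 4) ℚ, s ≠ 0 ∧ ∀ (L : Type) [Field L] (φ : ParamRing →+* L)
      (t : Spec (.of L)), φ (algebraMap _ _ s) ≠ 0 →
        (Spec.map (CommRingCat.ofHom φ) ≫ Φ) t ∈ U := by
  obtain ⟨L, _, _, a, b, c, d, x, h, ha, hc, hx, hQ⟩ := X.exists_containsPoint hU
  obtain ⟨h0, -, -⟩ := h.eqs
  obtain ⟨g, hg, hgU⟩ := h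
  -- the parameters of the given point, at which the parametrisation takes the value `g`
  let φ₀ : MvPolynomial (Fin 4) ℚ →+* L :=
    (aeval ![b / a, x 1 / x 0, x 2 / x 0, x 3 / x 0] : _ →ₐ[ℚ] L)
  have hγ : φ₀ paramDenom = (b * x 1 ^ 2 + a * x 2 ^ 2) / (a * x 0 ^ 2) := by
    simp [φ₀, paramDenom]; field_simp
  have hγu : IsUnit (φ₀ paramDenom) := by
    rw [hγ]; exact (div_ne_zero hQ (by positivity)).isUnit
  let φ : ParamRing →+* L := IsLocalization.Away.lift paramDenom hγu
  have hφ : ∀ p, φ (algebraMap _ _ p) = φ₀ p := fun p => IsLocalization.Away.lift_eq _ _ _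
  have e : g = Spec.map (CommRingCat.ofHom φ) ≫ Φ := by
    refine X.hom_ext (hg.scale (a * c * (a * x 0 ^ 2) / (b * x 1 ^ 2 + a * x 2 ^ 2)) (x 0) ?_ ?_)
      (hΦ.comp φ)
    · intro i
      simp only [hφ]
      fin_cases i
      · simp [paramY, hγ]; field_simp
      · simp [paramY, φ₀]; field_simp; linear_combination b * h0
      · simp [paramY, φ₀]; field_simp; linear_combination h0
      · simp [paramY, hγ]; simp [φ₀]; field_simp
    · intro i
      simp only [hφ]
      fin_cases i <;> simp [paramX, φ₀] <;> field_simp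
  have hne : Spec.map (CommRingCat.ofHom φ) (IsLocalRing.closedPoint L) ∈ Φ ⁻¹ᵁ U := by
    rw [e] at hgU; exact hgU
  obtain ⟨_, ⟨r, rfl⟩, hr, hrU⟩ :=
    PrimeSpectrum.isTopologicalBasis_basic_opens.exists_subset_of_mem_open hne (Φ ⁻¹ᵁ U).isOpen
  obtain ⟨n, s, hs⟩ := IsLocalization.Away.surj paramDenom r
  have hr0 : r ≠ 0 := by
    rintro rfl
    simp at hr
    exact hr
  refine ⟨s, ?_, ?_⟩
  · rintro rfl
    rw [map_zero] at hs
    exact hr0 ((mul_eq_zero.mp hs).resolve_right (pow_ne_zero _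
      (IsLocalization.Away.algebraMap_isUnit (S := ParamRing) paramDenom).ne_zero))
  · intro L' _ φ' t ht
    refine hrU (mem_basicOpen_of_ne_zero φ' (fun h1 => ht ?_) t)
    rw [← hs, map_mul, h1, zero_mul]

open Polynomial in
/-- The rational point with coordinates `y = (a, -b, -a, b)` and `x = (1, 1, 1, 1)` is the special
point of a curve in `X` whose generic point is in a given nonempty open set. -/
theorem X.exists_curve {U : X.Opens} (hU : (U : Set X).Nonempty) {a b : ℚ} (ha : 0 < a)
    (hb : 0 < b) : ∃ G : Spec (.of (PowerSeries ℚ)) ⟶ X,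
    X.HasCoords (Spec.map (CommRingCat.ofHom (PowerSeries.constantCoeff (R := ℚ))) ≫ G)
      ![a, -b, -a, b] ![1, 1, 1, 1] ∧
    ∀ t, (Spec.map (CommRingCat.ofHom
      (algebraMap (PowerSeries ℚ) (FractionRing (PowerSeries ℚ)))) ≫ G) t ∈ U := by
  obtain ⟨Φ, hΦ⟩ := exists_param
  obtain ⟨s, hs0, hs⟩ := X.exists_param_mem hU Φ hΦ
  obtain ⟨τ, hτ⟩ : ∃ τ : Fin 4 → ℚ, MvPolynomial.eval τ s ≠ 0 := by
    by_contra! h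
    exact hs0 (MvPolynomial.funext fun x => by rw [h x, map_zero])
  -- the line from `τ₀`, which parametrises the given point, to the general point `τ`
  let τ₀ : Fin 4 → ℚ := ![b / a, 1, 1, 1]
  let σ : MvPolynomial (Fin 4) ℚ →+* ℚ[X] :=
    (MvPolynomial.aeval fun i => C (τ₀ i) + Polynomial.X * C (τ i - τ₀ i) : _ →ₐ[ℚ] ℚ[X])
  have hσ0 : ∀ p, (σ p).eval 0 = MvPolynomial.eval τ₀ p := by
    intro p
    have : (Polynomial.evalRingHom 0).comp σ = MvPolynomial.eval τ₀ := by
      refine MvPolynomial.ringHom_ext (fun r => by simp [σ]) fun i => by simp [σ]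
    exact congrArg (fun φ : _ →+* ℚ => φ p) this
  have hσ1 : ∀ p, (σ p).eval 1 = MvPolynomial.eval τ p := by
    intro p
    have : (Polynomial.evalRingHom 1).comp σ = MvPolynomial.eval τ := by
      refine MvPolynomial.ringHom_ext (fun r => by simp [σ]) fun i => by simp [σ]
    exact congrArg (fun φ : _ →+* ℚ => φ p) this
  let ψ₀ : MvPolynomial (Fin 4) ℚ →+* PowerSeries ℚ := Polynomial.coeToPowerSeries.ringHom.comp σ
  have hψ₀ : ∀ p, PowerSeries.constantCoeff (ψ₀ p) = MvPolynomial.eval τ₀ p := fun p => by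
    simp only [ψ₀, RingHom.comp_apply, Polynomial.coeToPowerSeries.ringHom_apply]
    rw [Polynomial.constantCoeff_coe, Polynomial.coeff_zero_eq_eval_zero, hσ0]
  have hu : IsUnit (ψ₀ paramDenom) := by
    rw [PowerSeries.isUnit_iff_constantCoeff, hψ₀]
    have : MvPolynomial.eval τ₀ paramDenom = b / a + 1 := by simp [paramDenom, τ₀]
    rw [this]
    exact (by positivity : b / a + 1 ≠ 0).isUnit
  let ψ : ParamRing →+* PowerSeries ℚ := IsLocalization.Away.lift paramDenom hu
  have hψ : ∀ p, ψ (algebraMap _ _ p) = ψ₀ p := fun p => IsLocalization.Away.lift_eq _ _ _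
  refine ⟨Spec.map (CommRingCat.ofHom ψ) ≫ Φ, ?_, ?_⟩
  · have := (hΦ.comp ψ).comp (PowerSeries.constantCoeff (R := ℚ))
    simp only [hψ, hψ₀] at this
    refine this.scale ((a + b) / a ^ 2) 1 ?_ ?_
    · intro i
      fin_cases i <;> simp [paramY, paramDenom, τ₀] <;> field_simp <;> ring
    · intro i
      fin_cases i <;> simp [paramX, τ₀]
  · intro t
    have := hs _ ((algebraMap (PowerSeries ℚ) (FractionRing (PowerSeries ℚ))).comp ψ) t (by
      rw [RingHom.comp_apply, hψ, map_ne_zero_iff _ (IsFractionRing.injective _ _)]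
      intro h0
      apply hτ
      have h1 : σ s = 0 := Polynomial.coe_injective ℚ (by simpa [ψ₀] using h0)
      rw [← hσ1, h1, eval_zero])
    rwa [CommRingCat.ofHom_comp, Spec.map_comp, Category.assoc] at this

/-- Above a nonempty open set over which the proper morphism `f` is an isomorphism, the generic
point of a curve lifts, and hence the special point lifts as well. -/
theorem X.exists_lift {X' : Scheme.{0}} {f : X' ⟶ X} (hf : IsDesingularisation f) {a b : ℚ}
    (ha : 0 < a) (hb : 0 < b) : ∃ z : Spec (.of ℚ) ⟶ X',
      X.HasCoords (z ≫ f) ![a, -b, -a, b] ![1, 1, 1, 1] := by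
  obtain ⟨U, hU, hiso⟩ := hf.birational
  have := hf.isProper
  obtain ⟨G, hG, hGU⟩ := X.exists_curve hU ha hb
  let j : Spec (.of (FractionRing (PowerSeries ℚ))) ⟶ Spec (.of (PowerSeries ℚ)) :=
    Spec.map (CommRingCat.ofHom (algebraMap (PowerSeries ℚ) (FractionRing (PowerSeries ℚ))))
  let η : Spec (.of (FractionRing (PowerSeries ℚ))) ⟶ U :=
    IsOpenImmersion.lift U.ι (j ≫ G) (by
      rw [Scheme.Opens.range_ι]
      rintro _ ⟨t, rfl⟩
      exact hGU t)
  have hη : η ≫ U.ι = j ≫ G := IsOpenImmersion.lift_fac _ _ _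
  let i₁ : Spec (.of (FractionRing (PowerSeries ℚ))) ⟶ X' := η ≫ inv (f ∣_ U) ≫ (f ⁻¹ᵁ U).ι
  have hi₁ : i₁ ≫ f = j ≫ G := by
    rw [← hη]
    simp only [i₁, Category.assoc]
    rw [← morphismRestrict_ι, IsIso.inv_hom_id_assoc]
  have hex : ValuativeCriterion.Existence f := by
    have : UniversallyClosed f := inferInstance
    rw [UniversallyClosed.eq_valuativeCriterion] at this
    exact this.1
  obtain ⟨⟨l⟩⟩ := hex ⟨PowerSeries ℚ, FractionRing (PowerSeries ℚ), i₁, G, ⟨hi₁⟩⟩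
  refine ⟨Spec.map (CommRingCat.ofHom (PowerSeries.constantCoeff (R := ℚ))) ≫ l.l, ?_⟩
  rw [Category.assoc, l.fac_right]
  exact hG

/-! ### From adelic points to the solubility of quadratic forms -/

/-- The projection of the adeles to their component at `p`. -/
theorem nonempty_adeles_to_padic (p : ℕ) [hp : Fact p.Prime] : Nonempty (Adeles →+* ℚ_[p]) := by
  let R := NumberField.RingOfIntegers ℚ
  let v : IsDedekindDomain.HeightOneSpectrum R :=
    (Rat.HeightOneSpectrum.primesEquiv (R := R)).symm ⟨p, hp.out⟩
  let e1 : Adeles →+* IsDedekindDomain.FiniteAdeleRing R ℚ := RingHom.snd _ _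
  let e2 : IsDedekindDomain.FiniteAdeleRing R ℚ →+* v.adicCompletion ℚ :=
    RestrictedProduct.evalRingHom _ v
  let e3 : v.adicCompletion ℚ →+* ℚ_[p] :=
    (Padic.adicCompletionEquiv R ⟨p, hp.out⟩).symm.toAlgEquiv.toRingEquiv.toRingHom
  exact ⟨e3.comp (e2.comp e1)⟩

/-- The quadratic form `c (a x₀² + b x₃²) + d (b x₁² + a x₂²)`, which defines the fibre of `X` over
the point `(ac, bd, ad, bc)` of `Y`, is isotropic over all `ℚ_p`. -/
def IsPadicSoluble (a b c d : ℤ) : Prop :=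
  ∀ (p : ℕ) [Fact p.Prime], ∃ x : Fin 4 → ℚ_[p], x ≠ 0 ∧
    c * (a * x 0 ^ 2 + b * x 3 ^ 2) + d * (b * x 1 ^ 2 + a * x 2 ^ 2) = 0

/-- The parametrisation of the primitive integral points of the quadric `y₀ y₁ = y₂ y₃` by pairs of
coprime integers. -/
theorem exists_segre_int {v : Fin 4 → ℤ} (hg : Finset.univ.gcd v = 1)
    (h : v 0 * v 1 = v 2 * v 3) :
    ∃ a b c d : ℤ, IsCoprime a b ∧ IsCoprime c d ∧ v = ![a * c, b * d, a * d, b * c] := by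
  have hdvd : ∀ g : ℤ, (∀ i, g ∣ v i) → IsUnit g := fun g hgv =>
    isUnit_of_dvd_one (hg ▸ Finset.dvd_gcd fun i _ => hgv i)
  by_cases h0 : v 0 = 0 ∧ v 3 = 0
  · refine ⟨v 2, v 1, 0, 1, ?_, isCoprime_zero_left.mpr isUnit_one, ?_⟩
    · rw [← isRelPrime_iff_isCoprime]
      intro g h2 h1
      refine hdvd g fun i => ?_
      fin_cases i <;> simp [h0, h1, h2]
    · ext i; fin_cases i <;> simp [h0]
  · have hne : Int.gcd (v 0) (v 3) ≠ 0 := by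
      rw [Ne, Int.gcd_eq_zero_iff]; exact h0
    obtain ⟨a, b, hab, ha, hb⟩ := Int.exists_gcd_one (Nat.pos_of_ne_zero hne)
    set c : ℤ := (Int.gcd (v 0) (v 3) : ℤ) with hc
    have hc0 : c ≠ 0 := by rw [hc]; exact_mod_cast hne
    obtain ⟨u, w, huw⟩ := Int.isCoprime_iff_gcd_eq_one.mpr hab
    have h' : a * v 1 = b * v 2 := by
      refine mul_left_cancel₀ hc0 ?_
      rw [ha, hb] at h
      linear_combination h
    have hd2 : v 2 = a * (u * v 2 + w * v 1) := by linear_combination (-v 2) * huw - w * h'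
    have hd1 : v 1 = b * (u * v 2 + w * v 1) := by linear_combination (-v 1) * huw + u * h'
    refine ⟨a, b, c, u * v 2 + w * v 1, ⟨u, w, huw⟩, ?_, ?_⟩
    · rw [← isRelPrime_iff_isCoprime]
      intro g h2 h1
      refine hdvd g fun i => ?_
      fin_cases i
      · exact ha ▸ h2.mul_left a
      · exact hd1 ▸ h1.mul_left b
      · exact hd2 ▸ h1.mul_left a
      · exact hb ▸ h2.mul_left b
    · ext i
      fin_cases i
      · exact ha
      · exact hd1
      · exact hd2
      · exact hb

/-- The height is a product of the heights on the two factors of `ℙ¹ × ℙ¹`. -/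
theorem sup_natAbs_segre (a b c d : ℤ) :
    (Finset.univ.sup fun i => (![a * c, b * d, a * d, b * c] i).natAbs) =
      max a.natAbs b.natAbs * max c.natAbs d.natAbs := by
  have : (Finset.univ.sup fun i => (![a * c, b * d, a * d, b * c] i).natAbs) =
      max (max (a * c).natAbs (b * d).natAbs) (max (a * d).natAbs (b * c).natAbs) := by
    rw [show (Finset.univ : Finset (Fin 4)) = {0, 1, 2, 3} from rfl]
    simp [Finset.sup_insert, Finset.sup_singleton, sup_assoc]
  rw [this]
  simp only [Int.natAbs_mul, max_mul, mul_max]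
  ac_rfl

/-- The fibre over an everywhere locally soluble point is isotropic over all `ℚ_p`. -/
theorem exists_of_mem_locSolublePoints {X' : Scheme.{0}} {f : X' ⟶ X} {B : ℝ}
    {y : Spec (.of ℚ) ⟶ Y} (hy : y ∈ locSolublePoints (f ≫ X.π) B) :
    ∃ a b c d : ℤ, IsCoprime a b ∧ IsCoprime c d ∧ IsPadicSoluble a b c d ∧
      (((max a.natAbs b.natAbs * max c.natAbs d.natAbs) ^ 2 : ℕ) : ℝ) ≤ B ∧
      ∃ hv, y ≫ Y.ι = P3.point (fun i => (![a * c, b * d, a * d, b * c] i : ℚ)) hv := by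
  obtain ⟨⟨h, ⟨v, hv, hg, hyv, rfl⟩, hB⟩, z, hz⟩ := hy
  have h1 := Y.eq_of_comp_ι_eq_pt (hv := exists_isUnit_of_ne_zero hv) y hyv
  obtain ⟨a, b, c, d, hab, hcd, rfl⟩ := exists_segre_int hg (by exact_mod_cast h1)
  rw [sup_natAbs_segre] at hB
  refine ⟨a, b, c, d, hab, hcd, ?_, hB, hv, hyv⟩
  intro p _
  obtain ⟨φ⟩ := nonempty_adeles_to_padic p
  let g : Spec (.of ℚ_[p]) ⟶ X := Spec.map (CommRingCat.ofHom φ) ≫ z ≫ f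
  have hgy : g ≫ X.π ≫ Y.ι =
      Spec.map (CommRingCat.ofHom (algebraMap ℚ ℚ_[p])) ≫ y ≫ Y.ι := by
    have e : Spec.map (CommRingCat.ofHom φ) ≫ Spec.map (CommRingCat.ofHom (algebraMap ℚ Adeles)) =
        Spec.map (CommRingCat.ofHom (algebraMap ℚ ℚ_[p])) := hom_SpecRat_ext _ _
    rw [← reassoc_of% e, ← reassoc_of% hz]
    simp [g]
  obtain ⟨y', x, hg'⟩ := X.exists_hasCoords g
  obtain ⟨-, hx⟩ := hg'.eqs
  obtain ⟨hy', hx', h3, -⟩ := hg'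
  rw [hgy, hyv, P3.point_eq_pt, P3.SpecMap_pt _ _ ((exists_isUnit_of_ne_zero hv).imp
    fun i hi => hi.map (algebraMap ℚ ℚ_[p]))] at h3
  refine ⟨x, ?_, ?_⟩
  · rintro rfl
    obtain ⟨i, hi⟩ := hx'
    simp at hi
  · obtain ⟨i, hi⟩ := hy'
    have hprop := fun k => P3.mul_eq_mul_of_pt_eq h3 i k
    refine (mul_eq_zero.mp ?_ : y' i = 0 ∨ _).resolve_left hi.ne_zero
    have e0 := hprop 0
    have e1 := hprop 1
    have e2 := hprop 2
    have e3 := hprop 3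
    rw [Fin.sum_univ_four] at hx
    simp at e0 e1 e2 e3
    linear_combination ((![a * c, b * d, a * d, b * c] i : ℤ) : ℚ_[p]) * hx - x 0 ^ 2 * e0 -
      x 1 ^ 2 * e1 - x 2 ^ 2 * e2 - x 3 ^ 2 * e3

/-- For coprime `a, b > 0` the fibre over `(a, -b, -a, b)` is counted: its rational point `(1, 1, 1,
1)` lifts to the desingularisation. -/
theorem mem_locSolublePoints {X' : Scheme.{0}} {f : X' ⟶ X} (hf : IsDesingularisation f) {B : ℝ}
    {a b : ℤ} (ha : 0 < a) (hb : 0 < b) (hab : IsCoprime a b)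
    (hB : (((max a.natAbs b.natAbs) ^ 2 : ℕ) : ℝ) ≤ B) :
    ∃ y ∈ locSolublePoints (f ≫ X.π) B, ∃ hv,
      y ≫ Y.ι = P3.point (fun i => (![a, -b, -a, b] i : ℚ)) hv := by
  obtain ⟨z, hz⟩ := X.exists_lift hf (a := a) (b := b) (by exact_mod_cast ha)
    (by exact_mod_cast hb)
  have hcast : (fun i => ((![a, -b, -a, b] i : ℤ) : ℚ)) = ![(a : ℚ), -b, -a, b] := by
    ext i; fin_cases i <;> simp
  have hv : (fun i => ((![a, -b, -a, b] i : ℤ) : ℚ)) ≠ 0 := by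
    intro h0
    have := congrFun h0 0
    simp [ha.ne'] at this
  have hy : (z ≫ f ≫ X.π) ≫ Y.ι = P3.point (fun i => ((![a, -b, -a, b] i : ℤ) : ℚ)) hv := by
    obtain ⟨hy, -, h1, -⟩ := hz
    rw [P3.point_eq_pt]
    simp only [Category.assoc] at h1 ⊢
    rw [h1]
    congr 1
    exact hcast.symm
  refine ⟨z ≫ f ≫ X.π, ⟨⟨_, ⟨![a, -b, -a, b], hv, ?_, hy, rfl⟩, ?_⟩,
    Spec.map (CommRingCat.ofHom (algebraMap ℚ Adeles)) ≫ z, by simp⟩, hv, hy⟩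
  · have h1 : Finset.univ.gcd ![a, -b, -a, b] ∣ 1 := by
      obtain ⟨u, w, huw⟩ := hab
      rw [← huw]
      refine dvd_add (Dvd.dvd.mul_left ?_ _) (Dvd.dvd.mul_left ?_ _)
      · exact Finset.gcd_dvd (f := ![a, -b, -a, b]) (Finset.mem_univ 0)
      · exact Finset.gcd_dvd (f := ![a, -b, -a, b]) (Finset.mem_univ 3)
    rw [← Finset.normalize_gcd]
    exact normalize_eq_one.mpr (isUnit_of_dvd_one h1)
  · have := sup_natAbs_segre a b 1 (-1)
    simp only [mul_one, mul_neg] at this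
    rw [this]
    simpa using hB

/-! ### Norm forms over `ℚ_p` -/

/-- The form `s² + n t²` is the norm form of an unramified quadratic extension of `ℚ_p`, so that its
values have even valuation. -/
theorem padic_norm_sq_add {p : ℕ} [Fact p.Prime] {n : ℤ} (hn : ¬ IsSquare ((-n : ℤ) : ZMod p))
    (s t : ℚ_[p]) : ‖s ^ 2 + n * t ^ 2‖ = max ‖s‖ ‖t‖ ^ 2 := by
  have hn0 : ‖(n : ℚ_[p])‖ = 1 := by
    refine le_antisymm (Padic.norm_int_le_one n) (not_lt.mp fun h => hn ?_)
    rw [Padic.norm_intCast_lt_one_iff] at h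
    have : ((n : ℤ) : ZMod p) = 0 := (ZMod.intCast_zmod_eq_zero_iff_dvd n p).mpr h
    simp [this]
  by_cases hst : ‖s‖ = ‖t‖
  · rw [hst, max_self]
    by_cases ht : t = 0
    · have hs : s = 0 := by simpa [ht] using hst
      simp [hs, ht]
    have ht' : ‖t‖ ≠ 0 := norm_ne_zero_iff.mpr ht
    have hz : ‖s / t‖ ≤ 1 := by rw [norm_div, hst, div_self ht']
    let z : ℤ_[p] := ⟨s / t, hz⟩
    have hzn : ‖z ^ 2 + (n : ℤ_[p])‖ = 1 := by
      refine le_antisymm (PadicInt.norm_le_one _) (not_lt.mp fun h => hn ?_)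
      have h1 : PadicInt.toZMod (z ^ 2 + (n : ℤ_[p])) = 0 := by
        rw [← RingHom.mem_ker, PadicInt.ker_toZMod, IsLocalRing.mem_maximalIdeal,
          mem_nonunits_iff, PadicInt.isUnit_iff]
        exact h.ne
      refine ⟨PadicInt.toZMod z, ?_⟩
      rw [map_add, map_pow, map_intCast] at h1
      push_cast
      linear_combination -h1
    have h2 : s ^ 2 + n * t ^ 2 = ((z ^ 2 + (n : ℤ_[p]) : ℤ_[p]) : ℚ_[p]) * t ^ 2 := by
      have hzc : ((z ^ 2 : ℤ_[p]) : ℚ_[p]) = (s / t) ^ 2 := PadicInt.coe_pow z 2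
      rw [PadicInt.coe_add, hzc, PadicInt.coe_intCast]
      field_simp
    rw [h2, norm_mul, norm_pow, ← PadicInt.norm_def, hzn, one_mul]
  · have h3 : ‖s ^ 2‖ ≠ ‖(n : ℚ_[p]) * t ^ 2‖ := by
      rw [norm_mul, hn0, one_mul, norm_pow, norm_pow]
      intro h
      exact hst ((pow_left_inj₀ (norm_nonneg _) (norm_nonneg _) two_ne_zero).mp h)
    rw [Padic.add_eq_max_of_ne h3, norm_mul, hn0, one_mul, norm_pow, norm_pow]
    rcases le_total ‖s‖ ‖t‖ with h | h
    · rw [max_eq_right h, max_eq_right (by gcongr)]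
    · rw [max_eq_left h, max_eq_left (by gcongr)]

/-- The integer `n` is a square modulo every prime which divides `c` to an odd power. It
holds for `c = 0`, which has valuation zero by convention. -/
def IsNormLike (n c : ℤ) : Prop :=
  ∀ p : ℕ, p.Prime → Odd (padicValInt p c) → IsSquare (n : ZMod p)

/-- If `-ab` is not a square modulo `p`, then both halves of the form have values of even valuation,
while `d` is a unit when `p` divides `c`; so `c` has even valuation. -/
theorem IsPadicSoluble.isNormLike {a b c d : ℤ} (h : IsPadicSoluble a b c d)
    (hcd : IsCoprime c d) : IsNormLike (-(a * b)) c := by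
  intro p hp hodd
  have : Fact p.Prime := ⟨hp⟩
  by_contra hsq
  have hc : c ≠ 0 := by rintro rfl; simp at hodd
  have hpc : (p : ℤ) ∣ c := by
    by_contra hpc
    rw [padicValInt.eq_zero_of_not_dvd hpc] at hodd
    exact absurd hodd (by decide)
  have hd : ‖(d : ℚ_[p])‖ = 1 := by
    refine le_antisymm (Padic.norm_int_le_one d) (not_lt.mp fun h => ?_)
    rw [Padic.norm_intCast_lt_one_iff] at h
    exact (Nat.prime_iff_prime_int.mp hp).not_isUnit (hcd.isUnit_of_dvd' hpc h)
  have hunit : ∀ e : ℤ, e ∣ a * b → ‖(e : ℚ_[p])‖ = 1 := by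
    intro e he
    refine le_antisymm (Padic.norm_int_le_one e) (not_lt.mp fun h => hsq ?_)
    rw [Padic.norm_intCast_lt_one_iff] at h
    have : ((a * b : ℤ) : ZMod p) = 0 := (ZMod.intCast_zmod_eq_zero_iff_dvd _ p).mpr (h.trans he)
    rw [Int.cast_neg, this]
    simp
  have ha := hunit a (dvd_mul_right a b)
  have hb := hunit b (dvd_mul_left b a)
  obtain ⟨x, hx0, hx⟩ := h p
  have hn1 : ‖a * x 0 ^ 2 + b * x 3 ^ 2‖ = max ‖x 0‖ ‖x 3‖ ^ 2 := by
    have h1 := padic_norm_sq_add hsq (a * x 0) (x 3)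
    have h2 : (a * x 0) ^ 2 + ((a * b : ℤ) : ℚ_[p]) * x 3 ^ 2 =
      a * (a * x 0 ^ 2 + b * x 3 ^ 2) := by push_cast; ring
    rwa [h2, norm_mul, norm_mul, ha, one_mul, one_mul] at h1
  have hn2 : ‖b * x 1 ^ 2 + a * x 2 ^ 2‖ = max ‖x 1‖ ‖x 2‖ ^ 2 := by
    have h1 := padic_norm_sq_add hsq (b * x 1) (x 2)
    have h2 : (b * x 1) ^ 2 + ((a * b : ℤ) : ℚ_[p]) * x 2 ^ 2 =
      b * (b * x 1 ^ 2 + a * x 2 ^ 2) := by push_cast; ring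
    rwa [h2, norm_mul, norm_mul, hb, one_mul, one_mul] at h1
  have hnorm : ‖(c : ℚ_[p])‖ * max ‖x 0‖ ‖x 3‖ ^ 2 = max ‖x 1‖ ‖x 2‖ ^ 2 := by
    rw [← hn1, ← hn2, ← norm_mul, ← one_mul ‖b * x 1 ^ 2 + a * x 2 ^ 2‖, ← hd, ← norm_mul,
      eq_neg_of_add_eq_zero_left hx, norm_neg]
  have hmax : ∀ s t : ℚ_[p], max ‖s‖ ‖t‖ ≠ 0 → ∃ k : ℤ, max ‖s‖ ‖t‖ = (p : ℝ) ^ (-k) := by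
    intro s t h0
    rcases max_choice ‖s‖ ‖t‖ with h1 | h1 <;> rw [h1] at h0 ⊢
    · exact ⟨_, Padic.norm_eq_zpow_neg_valuation (norm_ne_zero_iff.mp h0)⟩
    · exact ⟨_, Padic.norm_eq_zpow_neg_valuation (norm_ne_zero_iff.mp h0)⟩
  have hc' : ‖(c : ℚ_[p])‖ = (p : ℝ) ^ (-(padicValInt p c : ℤ)) := by
    rw [Padic.norm_eq_zpow_neg_valuation (by exact_mod_cast hc), Padic.valuation_intCast]
  have hp1 : (1 : ℝ) < p := by exact_mod_cast hp.one_lt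
  have hcpos : ‖(c : ℚ_[p])‖ ≠ 0 := by rw [hc']; positivity
  by_cases h0 : max ‖x 0‖ ‖x 3‖ = 0
  · have h0' : max ‖x 1‖ ‖x 2‖ = 0 := by
      rw [h0] at hnorm
      simpa using hnorm.symm
    apply hx0
    have e0 := le_max_left ‖x 0‖ ‖x 3‖
    have e3 := le_max_right ‖x 0‖ ‖x 3‖
    have e1 := le_max_left ‖x 1‖ ‖x 2‖
    have e2 := le_max_right ‖x 1‖ ‖x 2‖
    rw [h0, norm_le_zero_iff] at e0 e3
    rw [h0', norm_le_zero_iff] at e1 e2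
    ext i
    fin_cases i
    exacts [e0, e1, e2, e3]
  · have h0' : max ‖x 1‖ ‖x 2‖ ≠ 0 := by
      intro h0'
      rw [h0'] at hnorm
      simp [hcpos] at hnorm
      exact h0 hnorm
    obtain ⟨k, hk⟩ := hmax _ _ h0
    obtain ⟨l, hl⟩ := hmax _ _ h0'
    rw [hk, hl, hc', ← zpow_natCast, ← zpow_natCast, ← zpow_mul, ← zpow_mul,
      ← zpow_add₀ (by positivity)] at hnorm
    have := zpow_right_injective₀ (by positivity) hp1.ne' hnorm
    obtain ⟨m, hm⟩ := hodd
    push_cast at this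
    omega

/-- The condition is symmetric in `c` and `d`. -/
theorem IsPadicSoluble.swap {a b c d : ℤ} (h : IsPadicSoluble a b c d) :
    IsPadicSoluble a b d c := by
  intro p _
  obtain ⟨x, hx0, hx⟩ := h p
  refine ⟨![x 2, x 3, x 0, x 1], ?_, ?_⟩
  · contrapose! hx0
    ext i
    fin_cases i
    exacts [congrFun hx0 2, congrFun hx0 3, congrFun hx0 0, congrFun hx0 1]
  · simp; linear_combination hx

/-- The condition is symmetric under the exchange of the two factors of `ℙ¹ × ℙ¹`. -/
theorem IsPadicSoluble.symm {a b c d : ℤ} (h : IsPadicSoluble a b c d) :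
    IsPadicSoluble c d a b := by
  intro p _
  obtain ⟨x, hx0, hx⟩ := h p
  refine ⟨![x 0, x 1, x 3, x 2], ?_, ?_⟩
  · contrapose! hx0
    ext i
    fin_cases i
    exacts [congrFun hx0 0, congrFun hx0 1, congrFun hx0 3, congrFun hx0 2]
  · simp; linear_combination hx

/-! ### Quadratic characters -/

theorem sum_range_eq_of_periodic {f : ℕ → ℝ} {q : ℕ} (hq : 0 < q) (hf : Function.Periodic f q)
    (h0 : ∑ v ∈ Finset.range q, f v = 0) (N : ℕ) :
    ∑ v ∈ Finset.range N, f v = ∑ v ∈ Finset.range (N % q), f v := by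
  induction N using Nat.strong_induction_on with
  | _ N ih =>
    rcases lt_or_ge N q with h | h
    · rw [Nat.mod_eq_of_lt h]
    · obtain ⟨m, rfl⟩ := Nat.exists_eq_add_of_le h
      rw [Finset.sum_range_add, h0, zero_add, Nat.add_mod_left, ← ih m (by omega)]
      exact Finset.sum_congr rfl fun v _ => by rw [add_comm]; exact hf v

theorem abs_sum_Ico_le_of_periodic {f : ℕ → ℝ} {q : ℕ} (hq : 0 < q) (hf : Function.Periodic f q)
    (h0 : ∑ v ∈ Finset.range q, f v = 0) (h1 : ∀ v, |f v| ≤ 1) (x y : ℕ) :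
    |∑ v ∈ Finset.Ico x y, f v| ≤ q := by
  have key : ∀ r s : ℕ, r ≤ s → s < q →
      |∑ v ∈ Finset.range s, f v - ∑ v ∈ Finset.range r, f v| ≤ q := by
    intro r s hrs hs
    rw [← Finset.sum_Ico_eq_sub _ hrs]
    refine (Finset.abs_sum_le_sum_abs _ _).trans ((Finset.sum_le_sum fun v _ => h1 v).trans ?_)
    rw [Finset.sum_const, Nat.card_Ico, nsmul_eq_mul, mul_one]
    exact_mod_cast (by omega : s - r ≤ q)
  rcases le_or_gt x y with hxy | hxy
  · rw [Finset.sum_Ico_eq_sub _ hxy, sum_range_eq_of_periodic hq hf h0 y,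
      sum_range_eq_of_periodic hq hf h0 x]
    rcases le_total (x % q) (y % q) with h | h
    · exact key _ _ h (Nat.mod_lt _ hq)
    · rw [abs_sub_comm]
      exact key _ _ h (Nat.mod_lt _ hq)
  · rw [Finset.Ico_eq_empty_of_le hxy.le]
    simp

/-- A periodic function which changes sign under multiplication by a unit `u` has sum zero over a
period. -/
theorem sum_range_eq_zero_of_mul {f : ℕ → ℝ} {q : ℕ} (hq : 0 < q) (hf : Function.Periodic f q)
    {u : ℕ} (hu : u.Coprime q) (h : ∀ v, f (u * v) = - f v) :
    ∑ v ∈ Finset.range q, f v = 0 := by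
  have hinj : Set.InjOn (fun v => u * v % q) (Finset.range q : Set ℕ) := by
    intro v hv w hw hvw
    simp only [Finset.coe_range, Set.mem_Iio] at hv hw
    have h1 : v ≡ w [MOD q] := Nat.ModEq.cancel_left_of_coprime hu.symm hvw
    rwa [Nat.ModEq, Nat.mod_eq_of_lt hv, Nat.mod_eq_of_lt hw] at h1
  have hmaps : Set.MapsTo (fun v => u * v % q) (Finset.range q : Set ℕ) (Finset.range q) :=
    fun v _ => by simpa using Nat.mod_lt _ hq
  have h2 : ∑ v ∈ Finset.range q, f (u * v) = ∑ v ∈ Finset.range q, f v := by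
    refine Finset.sum_nbij (fun v => u * v % q) hmaps hinj
      (Finset.surjOn_of_injOn_of_card_le _ hmaps hinj le_rfl) fun v _ => ?_
    exact (hf.map_mod_nat (u * v)).symm
  simp only [h, Finset.sum_neg_distrib] at h2
  linarith

/-- The quadratic character `v ↦ (n / v)`, extended by zero to even `v`. -/
def quadChar (n : ℤ) (v : ℕ) : ℝ := if Odd v then (jacobiSym n v : ℝ) else 0

theorem quadChar_of_odd (n : ℤ) {v : ℕ} (hv : Odd v) : quadChar n v = jacobiSym n v := if_pos hv

theorem quadChar_of_even (n : ℤ) {v : ℕ} (hv : Even v) : quadChar n v = 0 :=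
  if_neg (Nat.not_odd_iff_even.mpr hv)

@[simp] theorem quadChar_one (n : ℤ) : quadChar n 1 = 1 := by
  rw [quadChar_of_odd n odd_one, jacobiSym.one_right, Int.cast_one]

theorem quadChar_mul (n : ℤ) (v w : ℕ) : quadChar n (v * w) = quadChar n v * quadChar n w := by
  rcases Nat.even_or_odd v with hv | hv
  · rw [quadChar_of_even n hv, quadChar_of_even n (hv.mul_right w), zero_mul]
  rcases Nat.even_or_odd w with hw | hw
  · rw [quadChar_of_even n hw, quadChar_of_even n (hw.mul_left v), mul_zero]
  have : NeZero v := ⟨by rintro rfl; simp at hv⟩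
  have : NeZero w := ⟨by rintro rfl; simp at hw⟩
  rw [quadChar_of_odd n hv, quadChar_of_odd n hw, quadChar_of_odd n (hv.mul hw),
    jacobiSym.mul_right, Int.cast_mul]

theorem quadChar_mul_left (m n : ℤ) (v : ℕ) : quadChar (m * n) v = quadChar m v * quadChar n v := by
  unfold quadChar
  split_ifs
  · rw [jacobiSym.mul_left, Int.cast_mul]
  · simp

theorem quadChar_trichotomy (n : ℤ) (v : ℕ) :
    quadChar n v = 0 ∨ quadChar n v = 1 ∨ quadChar n v = -1 := by
  unfold quadChar
  split_ifs
  · rcases jacobiSym.trichotomy n v with h | h | h <;> simp [h]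
  · simp

theorem abs_quadChar_le_one (n : ℤ) (v : ℕ) : |quadChar n v| ≤ 1 := by
  rcases quadChar_trichotomy n v with h | h | h <;> simp [h]

theorem quadChar_periodic_left (v : ℕ) :
    Function.Periodic (fun a : ℕ => quadChar (a : ℤ) v) v := by
  intro a
  simp only [quadChar]
  split_ifs
  · congr 1
    rw [jacobiSym.mod_left, jacobiSym.mod_left (a : ℤ)]
    simp
  · rfl

theorem quadChar_periodic (n : ℤ) : Function.Periodic (quadChar n) (4 * n.natAbs) := by
  intro v
  have hpar : Odd (v + 4 * n.natAbs) ↔ Odd v := by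
    rw [Nat.odd_add]
    have : Even (4 * n.natAbs) := (by decide : Even 4).mul_right _
    simp [this]
  simp only [quadChar, hpar]
  split_ifs with hv
  · rw [jacobiSym.mod_right n (hpar.mpr hv), jacobiSym.mod_right n hv, Nat.add_mod_right]
  · rfl

/-- A non-square is divisible by some prime to an odd power exactly. -/
theorem exists_odd_padicValNat_of_not_isSquare {v : ℕ} (hv0 : v ≠ 0) (hv : ¬ IsSquare v) :
    ∃ p e w : ℕ, p.Prime ∧ Odd e ∧ ¬ p ∣ w ∧ v = p ^ e * w := by
  by_contra! hcon
  apply hv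
  obtain ⟨u, k, hk, hu⟩ := Nat.sq_mul_squarefree v
  by_cases hu1 : u = 1
  · exact ⟨k, by rw [← hk, hu1]; ring⟩
  obtain ⟨p, hp, hpu⟩ := Nat.exists_prime_and_dvd hu1
  exfalso
  have : Fact p.Prime := ⟨hp⟩
  refine absurd (Nat.exists_eq_pow_mul_and_not_dvd hv0 p hp.ne_one) ?_
  rintro ⟨e, w, hw, rfl⟩
  refine hcon p e w hp ?_ hw rfl
  have h1 := congrArg (padicValNat p) hk
  have hw0 : w ≠ 0 := by rintro rfl; simp at hw
  have hk0 : k ≠ 0 := by rintro rfl; exact hv0 (by rw [← hk]; simp)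
  have hu0 : u ≠ 0 := hu.ne_zero
  rw [padicValNat.mul (pow_ne_zero _ hk0) hu0, padicValNat.mul (pow_ne_zero _ hp.ne_zero) hw0,
    padicValNat.pow, padicValNat.prime_pow, padicValNat.eq_zero_of_not_dvd hw] at h1
  have h2 : padicValNat p u = 1 := by
    refine le_antisymm ?_ (one_le_padicValNat_of_dvd hu0 hpu)
    have := hu.natFactorization_le_one p
    rwa [Nat.factorization_def u hp] at this
  rw [h2, add_zero] at h1
  exact ⟨padicValNat p k, h1.symm⟩

theorem exists_jacobiSym_eq_neg_one {p : ℕ} (hp : p.Prime) (hp2 : p ≠ 2) :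
    ∃ a : ℕ, jacobiSym a p = -1 := by
  have : Fact p.Prime := ⟨hp⟩
  obtain ⟨x, hx⟩ := FiniteField.exists_nonsquare (F := ZMod p) (by rwa [ZMod.ringChar_zmod_n])
  refine ⟨x.val, ?_⟩
  rw [← jacobiSym.legendreSym.to_jacobiSym, legendreSym.eq_neg_one_iff]
  simpa using hx

/-- As a function of the numerator, the Jacobi symbol modulo a non-square is a nontrivial character.
-/
theorem abs_sum_quadChar_left_le {v : ℕ} (hv : ¬ IsSquare v) (x y : ℕ) :
    |∑ a ∈ Finset.Ico x y, quadChar (a : ℤ) v| ≤ v := by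
  have hv0 : v ≠ 0 := by rintro rfl; exact hv ⟨0, rfl⟩
  rcases Nat.even_or_odd v with he | ho
  · simp [quadChar_of_even _ he]
  refine abs_sum_Ico_le_of_periodic (Nat.pos_of_ne_zero hv0) (quadChar_periodic_left v) ?_
    (fun a => abs_quadChar_le_one a v) x y
  obtain ⟨p, e, w, hp, hodd, hpw, rfl⟩ := exists_odd_padicValNat_of_not_isSquare hv0 hv
  have hp2 : p ≠ 2 := by
    rintro rfl
    rw [Nat.odd_mul] at ho
    exact absurd (ho.1) (by rw [Nat.odd_pow_iff hodd.pos.ne']; decide)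
  obtain ⟨a, ha⟩ := exists_jacobiSym_eq_neg_one hp hp2
  obtain ⟨u, hu1, hu2⟩ := Nat.chineseRemainder ((Nat.Prime.coprime_iff_not_dvd hp).mpr hpw) a 1
  have hu : jacobiSym u (p ^ e * w) = -1 := by
    have : NeZero w := ⟨by rintro rfl; simp at hpw⟩
    have : NeZero p := ⟨hp.ne_zero⟩
    rw [jacobiSym.mul_right, jacobiSym.pow_right,
      jacobiSym.mod_left' (by exact_mod_cast hu1 : (u : ℤ) % p = (a : ℤ) % p), ha,
      jacobiSym.mod_left' (by exact_mod_cast hu2 : (u : ℤ) % w = ((1 : ℕ) : ℤ) % w), Nat.cast_one,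
      jacobiSym.one_left, hodd.neg_one_pow]
    rfl
  refine sum_range_eq_zero_of_mul (u := u) (Nat.pos_of_ne_zero hv0) (quadChar_periodic_left _) ?_ ?_
  · by_contra hc
    have := (jacobiSym.eq_zero_iff (a := u) (b := p ^ e * w)).mpr
      ⟨hv0, by rwa [Int.gcd_natCast_natCast]⟩
    rw [hu] at this
    exact absurd this (by decide)
  · intro b
    rw [Nat.cast_mul, quadChar_mul_left, quadChar_of_odd _ ho, hu]
    simp

/-- Quadratic reciprocity for `u ≡ 1` modulo `4 w` and `u` a suitable residue modulo `p`. -/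
theorem exists_jacobiSym_right_eq_neg_one_of_prime {p e w : ℕ} (hp : p.Prime) (hp2 : p ≠ 2)
    (he : Odd e) (hpw : ¬ p ∣ w) (s : ℤ) (hs : s.natAbs = 1) :
    ∃ u : ℕ, Odd u ∧ jacobiSym (s * (p ^ e * w : ℕ)) u = -1 := by
  obtain ⟨a, ha⟩ := exists_jacobiSym_eq_neg_one hp hp2
  have hcop : p.Coprime (4 * w) := by
    rw [Nat.Prime.coprime_iff_not_dvd hp, hp.dvd_mul, not_or]
    refine ⟨fun h4 => hp2 ?_, hpw⟩
    exact (Nat.prime_dvd_prime_iff_eq hp Nat.prime_two).mp (hp.dvd_of_dvd_pow (n := 2) h4)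
  obtain ⟨u, hu1, hu2⟩ := Nat.chineseRemainder hcop a 1
  have hu4 : u % 4 = 1 := hu2.of_mul_right w
  have hu : Odd u := Nat.odd_iff.mpr (Nat.odd_of_mod_four_eq_one hu4)
  refine ⟨u, hu, ?_⟩
  have h1 : jacobiSym (s * w) u = 1 := by
    rw [jacobiSym.mod_right _ hu, Int.natAbs_mul, hs, one_mul, Int.natAbs_natCast,
      (hu2 : u % (4 * w) = 1 % (4 * w))]
    have := jacobiSym.mod_right (s * w) odd_one
    rw [Int.natAbs_mul, hs, one_mul, Int.natAbs_natCast] at this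
    rw [← this, jacobiSym.one_right]
  have h2 : jacobiSym p u = -1 := by
    rw [jacobiSym.quadratic_reciprocity_one_mod_four' (hp.odd_of_ne_two hp2) hu4,
      jacobiSym.mod_left' (by exact_mod_cast hu1 : (u : ℤ) % p = (a : ℤ) % p), ha]
  rw [show s * ((p ^ e * w : ℕ) : ℤ) = (p : ℤ) ^ e * (s * w) by push_cast; ring,
    jacobiSym.mul_left, jacobiSym.pow_left, h1, h2, he.neg_one_pow, mul_one]

/-- The quadratic character of a non-square takes the value `-1`. -/
theorem exists_jacobiSym_right_eq_neg_one {n : ℤ} (hn : ¬ IsSquare n) :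
    ∃ u : ℕ, Odd u ∧ jacobiSym n u = -1 := by
  have hn0 : n ≠ 0 := by rintro rfl; exact hn ⟨0, rfl⟩
  have hm0 : n.natAbs ≠ 0 := Int.natAbs_ne_zero.mpr hn0
  have hsgn : n = n.sign * (n.natAbs : ℤ) := (Int.sign_mul_natAbs n).symm
  have hsa : n.sign.natAbs = 1 := Int.natAbs_sign_of_ne_zero hn0
  by_cases hsq : IsSquare n.natAbs
  · -- here `n = -k²`
    obtain ⟨k, hk⟩ := hsq
    have hk0 : k ≠ 0 := by rintro rfl; simp at hk; exact hn0 hk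
    have hnk : n = -1 * (k : ℤ) ^ 2 := by
      rcases Int.natAbs_eq n with h | h
      · exact absurd ⟨(k : ℤ), by rw [h, hk]; push_cast; ring⟩ hn
      · rw [h, hk]; push_cast; ring
    have hu3 : (4 * k - 1) % 4 = 3 := by omega
    have hu : Odd (4 * k - 1) := Nat.odd_iff.mpr (Nat.odd_of_mod_four_eq_three hu3)
    have hcop : Int.gcd (k : ℤ) ((4 * k - 1 : ℕ) : ℤ) = 1 := by
      rw [← Int.isCoprime_iff_gcd_eq_one]
      exact ⟨4, -1, by rw [Nat.cast_sub (by omega)]; push_cast; ring⟩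
    refine ⟨4 * k - 1, hu, ?_⟩
    rw [hnk, jacobiSym.mul_left, jacobiSym.sq_one' hcop, jacobiSym.at_neg_one hu,
      ZMod.χ₄_nat_three_mod_four hu3, mul_one]
  obtain ⟨p, e, w, hp, he, hpw, hm⟩ := exists_odd_padicValNat_of_not_isSquare hm0 hsq
  by_cases hp2 : p ≠ 2
  · rw [hsgn, hm]
    exact exists_jacobiSym_right_eq_neg_one_of_prime hp hp2 he hpw _ hsa
  push Not at hp2
  subst hp2
  have hw0 : w ≠ 0 := by rintro rfl; simp at hpw
  by_cases hwsq : IsSquare w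
  · -- here `n = ± 2 ^ e * k²` with `e` and `k` odd
    obtain ⟨k, rfl⟩ := hwsq
    have hk : Nat.Coprime 2 k := by
      rw [Nat.Prime.coprime_iff_not_dvd Nat.prime_two]
      exact fun h => hpw (h.mul_right k)
    obtain ⟨u, hu8, huk⟩ := Nat.chineseRemainder (hk.pow_left 3) 5 1
    have hu8' : u % 8 = 5 := hu8
    have hu4 : u % 4 = 1 := by omega
    have hu : Odd u := Nat.odd_iff.mpr (Nat.odd_of_mod_four_eq_one hu4)
    have hcop : Int.gcd (k : ℤ) (u : ℤ) = 1 := by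
      rw [Int.gcd_natCast_natCast, Nat.gcd_comm]
      exact huk.gcd_eq.trans (Nat.gcd_one_left k)
    have h2 : jacobiSym 2 u = -1 := by
      rw [jacobiSym.at_two hu, ZMod.χ₈_nat_mod_eight, hu8']
      rfl
    have hs1 : jacobiSym n.sign u = 1 := by
      rcases Int.natAbs_eq n.sign with h | h
      · rw [h, hsa, Nat.cast_one, jacobiSym.one_left]
      · rw [h, hsa, Nat.cast_one, jacobiSym.at_neg_one hu, ZMod.χ₄_nat_one_mod_four hu4]
    refine ⟨u, hu, ?_⟩
    rw [hsgn, hm, show n.sign * ((2 ^ e * (k * k) : ℕ) : ℤ) = n.sign * (2 ^ e * (k : ℤ) ^ 2) by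
      push_cast; ring, jacobiSym.mul_left, jacobiSym.mul_left, jacobiSym.pow_left,
      jacobiSym.sq_one' hcop, hs1, h2, he.neg_one_pow, one_mul, mul_one]
  · obtain ⟨p, e', w', hp, he', hpw', rfl⟩ := exists_odd_padicValNat_of_not_isSquare hw0 hwsq
    have hp2 : p ≠ 2 := by
      rintro rfl
      exact hpw (Dvd.dvd.mul_right (dvd_pow_self 2 he'.pos.ne') w')
    rw [hsgn, hm, show 2 ^ e * (p ^ e' * w') = p ^ e' * (2 ^ e * w') by ring]
    refine exists_jacobiSym_right_eq_neg_one_of_prime hp hp2 he' ?_ _ hsa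
    rw [hp.dvd_mul, not_or]
    exact ⟨fun h => hp2 ((Nat.prime_dvd_prime_iff_eq hp Nat.prime_two).mp
      (hp.dvd_of_dvd_pow h)), hpw'⟩

/-- As a function of the denominator, the Jacobi symbol of a non-square `n` is a nontrivial
character modulo `4 |n|`. -/
theorem abs_sum_quadChar_le {n : ℤ} (hn : ¬ IsSquare n) (x y : ℕ) :
    |∑ v ∈ Finset.Ico x y, quadChar n v| ≤ 4 * n.natAbs := by
  have hn0 : n ≠ 0 := by rintro rfl; exact hn ⟨0, rfl⟩
  have hq : 0 < 4 * n.natAbs := by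
    have := Int.natAbs_pos.mpr hn0
    omega
  obtain ⟨u, hu, hJ⟩ := exists_jacobiSym_right_eq_neg_one hn
  have h := abs_sum_Ico_le_of_periodic hq (quadChar_periodic n) ?_ (abs_quadChar_le_one n) x y
  · exact_mod_cast h
  refine sum_range_eq_zero_of_mul (u := u) hq (quadChar_periodic n) ?_ fun v => ?_
  · refine Nat.Coprime.mul_right
      (Nat.Coprime.pow_right 2 hu.coprime_two_right : u.Coprime (2 ^ 2)) ?_
    by_contra hc
    have := (jacobiSym.eq_zero_iff (a := n) (b := u)).mpr
      ⟨by rintro rfl; simp at hu, by rwa [Int.gcd_eq_natAbs, Int.natAbs_natCast, Nat.gcd_comm]⟩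
    rw [hJ] at this
    exact absurd this (by decide)
  · rw [quadChar_mul, quadChar_of_odd _ hu, hJ]
    simp

open ArithmeticFunction

/-! ### Logarithmic sums of multiplicative functions -/

/-- The arithmetic function `m ↦ f m / m`, for a function `f` of positive integers. -/
def logWeight (f : ℕ → ℝ) : ArithmeticFunction ℝ := ⟨fun m => f m / m, by simp⟩

theorem logWeight_apply (f : ℕ → ℝ) (m : ℕ) : logWeight f m = f m / m := rfl

theorem logWeight_isMultiplicative {f : ℕ → ℝ} (h1 : f 1 = 1)
    (h : ∀ a b, a.Coprime b → f (a * b) = f a * f b) : (logWeight f).IsMultiplicative := by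
  refine ⟨by simp [logWeight_apply, h1], fun {a b} hab => ?_⟩
  simp only [logWeight_apply, h a b hab, Nat.cast_mul]
  ring

/-- The sum of an arithmetic function over the positive integers up to `x`. -/
def partialSum (f : ArithmeticFunction ℝ) (x : ℕ) : ℝ := ∑ m ∈ Finset.Ioc 0 x, f m

theorem partialSum_mono {f : ArithmeticFunction ℝ} (hf : ∀ m, 0 ≤ f m) : Monotone (partialSum f) :=
  fun _ _ h => Finset.sum_le_sum_of_subset_of_nonneg (Finset.Ioc_subset_Ioc_right h)
    fun m _ _ => hf m

theorem partialSum_nonneg {f : ArithmeticFunction ℝ} (hf : ∀ m, 0 ≤ f m) (x : ℕ) :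
    0 ≤ partialSum f x := Finset.sum_nonneg fun m _ => hf m

theorem le_partialSum {f : ArithmeticFunction ℝ} (hf : ∀ m, 0 ≤ f m) {x : ℕ} (hx : 0 < x) :
    f 1 ≤ partialSum f x :=
  Finset.single_le_sum (f := f) (fun m _ => hf m) (Finset.mem_Ioc.mpr ⟨one_pos, hx⟩)

theorem partialSum_mul_le {f g : ArithmeticFunction ℝ} (hf : ∀ m, 0 ≤ f m) (hg : ∀ m, 0 ≤ g m)
    (x : ℕ) : partialSum (f * g) x ≤ partialSum f x * partialSum g x := by
  rw [partialSum, sum_Ioc_mul_eq_sum_prod_filter, partialSum, partialSum, Finset.sum_mul_sum,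
    ← Finset.sum_product']
  exact Finset.sum_le_sum_of_subset_of_nonneg (Finset.filter_subset _ _)
    fun p _ _ => mul_nonneg (hf _) (hg _)

theorem mul_partialSum_le {f g : ArithmeticFunction ℝ} (hf : ∀ m, 0 ≤ f m) (hg : ∀ m, 0 ≤ g m)
    {x y z : ℕ} (hz : x * y ≤ z) : partialSum f x * partialSum g y ≤ partialSum (f * g) z := by
  rcases Nat.eq_zero_or_pos x with rfl | hx
  · simp only [partialSum, Finset.Ioc_self, Finset.sum_empty, zero_mul]
    rw [← partialSum]
    refine partialSum_nonneg (fun m => ?_) z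
    rw [mul_apply]
    exact Finset.sum_nonneg fun p _ => mul_nonneg (hf _) (hg _)
  rcases Nat.eq_zero_or_pos y with rfl | hy
  · simp only [partialSum, Finset.Ioc_self, Finset.sum_empty, mul_zero]
    rw [← partialSum]
    refine partialSum_nonneg (fun m => ?_) z
    rw [mul_apply]
    exact Finset.sum_nonneg fun p _ => mul_nonneg (hf _) (hg _)
  rw [partialSum, partialSum, partialSum, sum_Ioc_mul_eq_sum_prod_filter, Finset.sum_mul_sum,
    ← Finset.sum_product']
  refine Finset.sum_le_sum_of_subset_of_nonneg ?_ fun p _ _ => mul_nonneg (hf _) (hg _)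
  intro p hp
  simp only [Finset.mem_product, Finset.mem_Ioc, Finset.mem_filter] at hp ⊢
  obtain ⟨⟨h1, h2⟩, h3, h4⟩ := hp
  refine ⟨⟨⟨h1, ?_⟩, h3, ?_⟩, (Nat.mul_le_mul h2 h4).trans hz⟩
  · nlinarith
  · nlinarith

theorem nonneg_of_isMultiplicative {f : ArithmeticFunction ℝ} (hf : f.IsMultiplicative)
    (h : ∀ p k, p.Prime → 0 ≤ f (p ^ k)) (m : ℕ) : 0 ≤ f m := by
  rcases eq_or_ne m 0 with rfl | hm
  · simp
  · rw [hf.multiplicative_factorization f hm]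
    exact Finset.prod_nonneg fun p hp => h p _ (Nat.prime_of_mem_primeFactors hp)

theorem logWeight_mul_logWeight_one_prime_pow (f : ℕ → ℝ) {p : ℕ} (hp : p.Prime) (k : ℕ) :
    (logWeight f * logWeight 1) (p ^ k) =
      (∑ i ∈ Finset.range (k + 1), f (p ^ i)) / (p ^ k : ℕ) := by
  rw [mul_apply, Nat.sum_divisorsAntidiagonal (fun a b => logWeight f a * logWeight 1 b),
    Nat.sum_divisors_prime_pow hp, Finset.sum_div]
  refine Finset.sum_congr rfl fun i hi => ?_
  rw [Nat.pow_div (by simpa [Nat.lt_succ_iff] using hi) hp.pos, logWeight_apply, logWeight_apply,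
    ← Nat.sub_add_cancel (by simpa [Nat.lt_succ_iff] using hi : i ≤ k), Nat.add_sub_cancel]
  have : (p : ℝ) ≠ 0 := by exact_mod_cast hp.ne_zero
  push_cast
  rw [pow_add]
  simp
  field_simp

theorem logWeight_one_isMultiplicative : (logWeight 1).IsMultiplicative :=
  logWeight_isMultiplicative rfl (by simp)

/-- The function `m ↦ r(m) / m`, where `r = 1 * χ` for the quadratic character `χ = (n / ·)`. -/
def normFn (n : ℤ) : ArithmeticFunction ℝ := logWeight (quadChar n) * logWeight 1

/-- The convolution complement of `normFn`, that is, `m ↦ (1 * μχ)(m) / m` for the quadratic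
character `χ = (n / ·)`. -/
def conormFn (n : ℤ) : ArithmeticFunction ℝ :=
  logWeight (fun m => moebius m * quadChar n m) * logWeight 1

theorem normFn_nonneg (n : ℤ) (m : ℕ) : 0 ≤ normFn n m := by
  refine nonneg_of_isMultiplicative ((logWeight_isMultiplicative (quadChar_one n)
    fun a b _ => quadChar_mul n a b).mul logWeight_one_isMultiplicative) (fun p k hp => ?_) m
  rw [logWeight_mul_logWeight_one_prime_pow _ hp]
  refine div_nonneg ?_ (Nat.cast_nonneg _)
  have hpow : ∀ i, quadChar n (p ^ i) = quadChar n p ^ i := fun i => by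
    induction i with
    | zero => simp
    | succ i ih => rw [pow_succ, quadChar_mul, ih, pow_succ]
  simp only [hpow]
  rcases quadChar_trichotomy n p with h | h | h <;> rw [h]
  · exact Finset.sum_nonneg fun i _ => by positivity
  · exact Finset.sum_nonneg fun i _ => by positivity
  · rw [neg_one_geom_sum]
    split_ifs <;> norm_num

theorem conormFn_nonneg (n : ℤ) (m : ℕ) : 0 ≤ conormFn n m := by
  refine nonneg_of_isMultiplicative ((logWeight_isMultiplicative (by simp)
    fun a b hab => ?_).mul logWeight_one_isMultiplicative) (fun p k hp => ?_) m
  · rw [quadChar_mul, isMultiplicative_moebius.map_mul_of_coprime hab]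
    push_cast
    ring
  rw [logWeight_mul_logWeight_one_prime_pow _ hp]
  refine div_nonneg ?_ (Nat.cast_nonneg _)
  rcases k with _ | k
  · simp
  · rw [Finset.sum_range_succ', Finset.sum_range_succ', Finset.sum_eq_zero]
    · have := (abs_le.mp (abs_quadChar_le_one n p)).2
      simp [moebius_apply_prime hp]
      exact this
    · intro i _
      rw [moebius_apply_prime_pow hp (by omega), if_neg (by omega)]
      simp

/-- Since `χ * μχ = 1`, the product is the function `m ↦ τ(m) / m`, whatever the character. -/
theorem normFn_mul_conormFn (n : ℤ) : normFn n * conormFn n = logWeight 1 * logWeight 1 := by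
  have h : logWeight (quadChar n) * logWeight (fun m => moebius m * quadChar n m) = 1 := by
    ext m
    rcases eq_or_ne m 0 with rfl | hm
    · simp
    rw [mul_apply]
    have h1 : ∀ p ∈ m.divisorsAntidiagonal, logWeight (quadChar n) p.1 *
        logWeight (fun m => moebius m * quadChar n m) p.2 =
          quadChar n m / m * ((zeta : ArithmeticFunction ℝ) p.1 *
            (moebius : ArithmeticFunction ℝ) p.2) := by
      intro p hp
      obtain ⟨hp, -⟩ := Nat.mem_divisorsAntidiagonal.mp hp
      have h2 : p.1 ≠ 0 := by rintro h; rw [h, zero_mul] at hp; exact hm hp.symm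
      rw [← hp, quadChar_mul, logWeight_apply, logWeight_apply, natCoe_apply, zeta_apply_ne h2,
        intCoe_apply]
      push_cast
      rw [mul_div_mul_comm]
      ring
    rw [Finset.sum_congr rfl h1, ← Finset.mul_sum, ← mul_apply, coe_zeta_mul_coe_moebius]
    rcases eq_or_ne m 1 with rfl | h1
    · simp
    · simp [one_apply_ne h1]
  rw [normFn, conormFn, mul_mul_mul_comm, h, one_mul]

theorem normFn_one (n : ℤ) : normFn n 1 = 1 := by
  simp [normFn, mul_apply, logWeight_apply]

/-- The sum `∑ r(m) / m` over `m ≤ x`, where `r = 1 * χ` for the quadratic character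
`χ = (n / ·)`. -/
def normSum (n : ℤ) (x : ℕ) : ℝ := partialSum (normFn n) x

theorem normSum_mono (n : ℤ) : Monotone (normSum n) := partialSum_mono (normFn_nonneg n)

theorem one_le_normSum (n : ℤ) {x : ℕ} (hx : 0 < x) : 1 ≤ normSum n x :=
  (normFn_one n).symm.le.trans (le_partialSum (normFn_nonneg n) hx)

/-- The harmonic sum up to `x`. -/
def harmonicSum (x : ℕ) : ℝ := partialSum (logWeight 1) x

theorem harmonicSum_eq (x : ℕ) : harmonicSum x = ∑ m ∈ Finset.Ioc 0 x, 1 / (m : ℝ) := rfl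

theorem harmonicSum_eq_harmonic (x : ℕ) : harmonicSum x = (harmonic x : ℝ) := by
  rw [harmonicSum_eq, harmonic_eq_sum_Icc]
  push_cast
  exact Finset.sum_congr rfl fun i _ => one_div _

theorem harmonicSum_le (x : ℕ) : harmonicSum x ≤ 1 + Real.log x := by
  rw [harmonicSum_eq_harmonic]; exact harmonic_le_one_add_log x

theorem le_harmonicSum (x : ℕ) : Real.log (x + 1) ≤ harmonicSum x := by
  rw [harmonicSum_eq_harmonic]; exact_mod_cast log_add_one_le_harmonic x

theorem logWeight_one_nonneg (m : ℕ) : 0 ≤ logWeight 1 m := by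
  rw [logWeight_apply]
  exact div_nonneg zero_le_one (Nat.cast_nonneg m)

theorem harmonicSum_mono : Monotone harmonicSum := partialSum_mono logWeight_one_nonneg

theorem harmonicSum_nonneg (x : ℕ) : 0 ≤ harmonicSum x := partialSum_nonneg logWeight_one_nonneg x

/-- The sums `normSum` at `w` and at a power of `w` are comparable. -/
theorem normSum_mul_sq_le (n : ℤ) {w z s : ℕ} (hzw : z ≤ w) (hs : s * s ≤ z) :
    normSum n w * harmonicSum s ^ 2 ≤ normSum n z * harmonicSum (w * w) ^ 2 := by
  have h1 : normSum n w * partialSum (conormFn n) w ≤ harmonicSum (w * w) ^ 2 := by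
    refine (mul_partialSum_le (normFn_nonneg n) (conormFn_nonneg n) le_rfl).trans ?_
    rw [normFn_mul_conormFn, sq]
    exact partialSum_mul_le logWeight_one_nonneg logWeight_one_nonneg _
  have h2 : harmonicSum s ^ 2 ≤ normSum n z * partialSum (conormFn n) z := by
    rw [sq]
    refine (mul_partialSum_le logWeight_one_nonneg logWeight_one_nonneg hs).trans ?_
    rw [← normFn_mul_conormFn n]
    exact partialSum_mul_le (normFn_nonneg n) (conormFn_nonneg n) z
  have h3 : partialSum (conormFn n) z ≤ partialSum (conormFn n) w :=
    partialSum_mono (conormFn_nonneg n) hzw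
  have h4 : 0 ≤ normSum n w := partialSum_nonneg (normFn_nonneg n) w
  have h5 : 0 ≤ normSum n z := partialSum_nonneg (normFn_nonneg n) z
  calc normSum n w * harmonicSum s ^ 2
      ≤ normSum n w * (normSum n z * partialSum (conormFn n) w) := by
        gcongr
        exact h2.trans (by gcongr)
    _ = normSum n z * (normSum n w * partialSum (conormFn n) w) := by ring
    _ ≤ _ := by gcongr

/-! ### The growth of the logarithmic sums -/

/-- Summation by parts for bounded partial sums and decreasing nonnegative weights. -/
theorem abs_sum_mul_le_of_antitone {a b : ℕ → ℝ} {q : ℝ} {x : ℕ}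
    (ha : ∀ y, |∑ i ∈ Finset.Ico x y, a i| ≤ q) (hb : ∀ i, x ≤ i → b (i + 1) ≤ b i)
    (hb0 : ∀ i, 0 ≤ b i) (y : ℕ) : |∑ i ∈ Finset.Ico x y, a i * b i| ≤ q * b x := by
  rcases le_or_gt y x with hyx | hxy
  · rw [Finset.Ico_eq_empty_of_le hyx]
    simpa using mul_nonneg ((abs_nonneg _).trans (ha x)) (hb0 x)
  have key : ∀ y, x ≤ y → |∑ i ∈ Finset.Ico x y, a i * b i - (∑ i ∈ Finset.Ico x y, a i) * b y| ≤
      q * (b x - b y) := by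
    intro y hy
    induction y, hy using Nat.le_induction with
    | base => simp
    | succ y hy ih =>
      rw [Finset.sum_Ico_succ_top hy]
      have e : ∑ i ∈ Finset.Ico x y, a i * b i + a y * b y -
          (∑ i ∈ Finset.Ico x (y + 1), a i) * b (y + 1) =
          (∑ i ∈ Finset.Ico x y, a i * b i - (∑ i ∈ Finset.Ico x y, a i) * b y) +
            (∑ i ∈ Finset.Ico x (y + 1), a i) * (b y - b (y + 1)) := by
        rw [Finset.sum_Ico_succ_top hy]; ring
      rw [e]
      refine (abs_add_le _ _).trans ?_
      have h1 : |(∑ i ∈ Finset.Ico x (y + 1), a i) * (b y - b (y + 1))| ≤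
          q * (b y - b (y + 1)) := by
        rw [abs_mul, abs_of_nonneg (sub_nonneg.mpr (hb y hy))]
        exact mul_le_mul_of_nonneg_right (ha _) (sub_nonneg.mpr (hb y hy))
      linarith
  have h1 := key y hxy.le
  have h2 : |(∑ i ∈ Finset.Ico x y, a i) * b y| ≤ q * b y := by
    rw [abs_mul, abs_of_nonneg (hb0 y)]
    exact mul_le_mul_of_nonneg_right (ha _) (hb0 y)
  have h3 := abs_add_le (∑ i ∈ Finset.Ico x y, a i * b i - (∑ i ∈ Finset.Ico x y, a i) * b y)
    ((∑ i ∈ Finset.Ico x y, a i) * b y)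
  rw [sub_add_cancel] at h3
  linarith

theorem harmonicSum_succ (k : ℕ) : harmonicSum (k + 1) = harmonicSum k + 1 / (k + 1 : ℕ) := by
  rw [harmonicSum_eq, harmonicSum_eq, Finset.sum_Ioc_succ_top (Nat.zero_le k)]

theorem harmonicSum_sub_le {k l : ℕ} (hk : 0 < k) (hkl : k ≤ l) :
    harmonicSum l - harmonicSum k ≤ Real.log l - Real.log k := by
  induction l, hkl using Nat.le_induction with
  | base => simp
  | succ l hl ih =>
    have hl0 : (0 : ℝ) < l := by exact_mod_cast hk.trans_le hl
    rw [harmonicSum_succ]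
    have h1 : Real.log (l / (l + 1 : ℕ)) ≤ l / (l + 1 : ℕ) - 1 := Real.log_le_sub_one_of_pos
      (by positivity)
    rw [Real.log_div hl0.ne' (by positivity)] at h1
    have h2 : (l : ℝ) / (l + 1 : ℕ) - 1 = - (1 / (l + 1 : ℕ)) := by
      push_cast; field_simp; ring
    linarith

theorem le_harmonicSum_sub {k l : ℕ} (hkl : k ≤ l) :
    Real.log (l + 1) - Real.log (k + 1) ≤ harmonicSum l - harmonicSum k := by
  induction l, hkl using Nat.le_induction with
  | base => simp
  | succ l hl ih =>
    rw [harmonicSum_succ]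
    have h1 : Real.log (((l + 1 : ℕ) + 1) / (l + 1)) ≤ ((l + 1 : ℕ) + 1) / (l + 1) - 1 :=
      Real.log_le_sub_one_of_pos (by positivity)
    rw [Real.log_div (by positivity) (by positivity)] at h1
    have h2 : (((l + 1 : ℕ) : ℝ) + 1) / (l + 1) - 1 = 1 / (l + 1 : ℕ) := by
      push_cast; field_simp; ring
    linarith

theorem abs_harmonicSum_div_sub_le {v w x : ℕ} (hv : 0 < v) (hvw : v ≤ w) (hwx : w ≤ x) :
    |harmonicSum (x / v) - harmonicSum (w / v) - Real.log (x / w)| ≤ 2 * v / w := by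
  have hv0 : (0 : ℝ) < v := by exact_mod_cast hv
  have hw0 : (0 : ℝ) < w := by exact_mod_cast hv.trans_le hvw
  have hx0 : (0 : ℝ) < x := by exact_mod_cast (hv.trans_le hvw).trans_le hwx
  have hk : 0 < w / v := Nat.div_pos hvw hv
  have hl : 0 < x / v := Nat.div_pos (hvw.trans hwx) hv
  have hkl : w / v ≤ x / v := Nat.div_le_div_right hwx
  set k := w / v
  set l := x / v
  have hk0 : (0 : ℝ) < k := by exact_mod_cast hk
  have hl0 : (0 : ℝ) < l := by exact_mod_cast hl
  have hl1 : (l : ℝ) ≤ x / v := Nat.cast_div_le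
  have hk1 : (k : ℝ) ≤ w / v := Nat.cast_div_le
  have hl2 : (x : ℝ) / v ≤ l + 1 := by
    rw [div_le_iff₀ hv0]
    exact_mod_cast (show x ≤ (x / v + 1) * v by rw [mul_comm]; exact (Nat.lt_mul_div_succ x hv).le)
  have hk2 : (w : ℝ) / v ≤ k + 1 := by
    rw [div_le_iff₀ hv0]
    exact_mod_cast (show w ≤ (w / v + 1) * v by rw [mul_comm]; exact (Nat.lt_mul_div_succ w hv).le)
  have hk3 : (w : ℝ) / v ≤ 2 * k := by
    have : (1 : ℝ) ≤ k := by exact_mod_cast hk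
    linarith
  rw [abs_le]
  constructor
  · have h1 := le_harmonicSum_sub hkl
    have h2 : Real.log (x / v) ≤ Real.log (l + 1) := Real.log_le_log (by positivity) hl2
    have h3 : Real.log (k + 1) ≤ Real.log (w / v) + v / w := by
      have h4 : Real.log ((k + 1) / (w / v)) ≤ (k + 1) / (w / v) - 1 :=
        Real.log_le_sub_one_of_pos (by positivity)
      rw [Real.log_div (by positivity) (by positivity)] at h4
      have h5 : (k + 1) / ((w : ℝ) / v) - 1 ≤ v / w := by
        rw [sub_le_iff_le_add, div_le_iff₀ (by positivity)]
        have : ((v : ℝ) / w + 1) * (w / v) = 1 + w / v := by field_simp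
        linarith
      linarith
    rw [Real.log_div hx0.ne' hv0.ne'] at h2
    rw [Real.log_div hw0.ne' hv0.ne'] at h3
    rw [Real.log_div hx0.ne' hw0.ne']
    have h6 : 0 ≤ (v : ℝ) / w := by positivity
    have h7 : 2 * (v : ℝ) / w = 2 * (v / w) := by ring
    linarith
  · have h1 := harmonicSum_sub_le hk hkl
    have h2 : Real.log l ≤ Real.log (x / v) := Real.log_le_log hl0 hl1
    have h3 : Real.log (w / v) ≤ Real.log k + 2 * v / w := by
      have h4 : Real.log ((w / v) / k) ≤ (w / v) / k - 1 :=
        Real.log_le_sub_one_of_pos (by positivity)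
      rw [Real.log_div (by positivity) (by positivity)] at h4
      have h5 : ((w : ℝ) / v) / k - 1 ≤ 2 * v / w := by
        have h6 : ((w : ℝ) / v) / k - 1 ≤ 1 / k := by
          rw [sub_le_iff_le_add, div_le_iff₀ hk0]
          have : (1 / (k : ℝ) + 1) * k = 1 + k := by field_simp
          linarith
        refine h6.trans ?_
        rw [div_le_div_iff₀ hk0 hw0]
        rw [div_le_iff₀ hv0] at hk3
        linarith
      linarith
    rw [Real.log_div hx0.ne' hv0.ne'] at h2
    rw [Real.log_div hw0.ne' hv0.ne'] at h3
    rw [Real.log_div hx0.ne' hw0.ne']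
    linarith

theorem normSum_eq (n : ℤ) (x : ℕ) :
    normSum n x = ∑ v ∈ Finset.Ioc 0 x, quadChar n v / v * harmonicSum (x / v) := by
  rw [normSum, partialSum, normFn, sum_Ioc_mul_eq_sum_sum]
  rfl

/-- The growth of `normSum` from `w` to `x`, by the hyperbola method: the terms with `v ≤ w` give
the truncated value at one of the `L`-series times `log (x / w)`, those with `v > w` cancel. -/
theorem abs_normSum_sub_le {n : ℤ} (hn : ¬ IsSquare n) {w x : ℕ} (hw : 0 < w) (hwx : w ≤ x) :
    |normSum n x - normSum n w - partialSum (logWeight (quadChar n)) w * Real.log (x / w)| ≤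
      2 + 4 * n.natAbs * (1 + Real.log x) / w := by
  have hw0 : (0 : ℝ) < w := by exact_mod_cast hw
  have hx1 : (1 : ℝ) ≤ x := by exact_mod_cast hw.trans_le hwx
  have e : normSum n x = ∑ v ∈ Finset.Ioc 0 w, quadChar n v / v * harmonicSum (x / v) +
      ∑ v ∈ Finset.Ico (w + 1) (x + 1), quadChar n v * (harmonicSum (x / v) / v) := by
    have h1 : Finset.Ico (w + 1) (x + 1) = Finset.Ioc w x := by ext; simp
    rw [normSum_eq, ← Finset.sum_Ioc_consecutive _ (Nat.zero_le w) hwx, h1]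
    congr 1
    exact Finset.sum_congr rfl fun v _ => by ring
  have h2 : |∑ v ∈ Finset.Ico (w + 1) (x + 1), quadChar n v * (harmonicSum (x / v) / v)| ≤
      4 * n.natAbs * (1 + Real.log x) / w := by
    refine (abs_sum_mul_le_of_antitone (fun y => abs_sum_quadChar_le hn _ y) (fun i hi => ?_)
      (fun i => div_nonneg (harmonicSum_nonneg _) (Nat.cast_nonneg _)) _).trans ?_
    · have hi0 : (0 : ℝ) < i := by exact_mod_cast (by omega : 0 < i)
      refine div_le_div₀ (harmonicSum_nonneg _)
        (harmonicSum_mono (Nat.div_le_div_left (Nat.le_succ i) (by omega))) hi0 ?_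
      push_cast
      linarith
    · rw [mul_div_assoc]
      refine mul_le_mul_of_nonneg_left (div_le_div₀ ?_ ?_ hw0 ?_) (by positivity)
      · have := Real.log_nonneg hx1
        linarith
      · refine (harmonicSum_mono (Nat.div_le_self x (w + 1))).trans (harmonicSum_le x)
      · push_cast; linarith
  have h3 : |∑ v ∈ Finset.Ioc 0 w, quadChar n v / v *
      (harmonicSum (x / v) - harmonicSum (w / v) - Real.log (x / w))| ≤ 2 := by
    refine (Finset.abs_sum_le_sum_abs _ _).trans ?_
    have h4 : ∀ v ∈ Finset.Ioc 0 w, |quadChar n v / v *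
        (harmonicSum (x / v) - harmonicSum (w / v) - Real.log (x / w))| ≤ 2 / w := by
      intro v hv
      rw [Finset.mem_Ioc] at hv
      have hv0 : (0 : ℝ) < v := by exact_mod_cast hv.1
      rw [abs_mul, abs_div, abs_of_pos hv0]
      calc |quadChar n v| / v * |harmonicSum (x / v) - harmonicSum (w / v) - Real.log (x / w)|
          ≤ 1 / v * (2 * v / w) := by
            gcongr
            · exact abs_quadChar_le_one n v
            · exact abs_harmonicSum_div_sub_le hv.1 hv.2 hwx
        _ = 2 / w := by field_simp
    refine (Finset.sum_le_sum h4).trans ?_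
    rw [Finset.sum_const, Nat.card_Ioc, nsmul_eq_mul, Nat.sub_zero]
    field_simp
    exact le_rfl
  have e2 : normSum n x - normSum n w - partialSum (logWeight (quadChar n)) w * Real.log (x / w) =
      ∑ v ∈ Finset.Ioc 0 w, quadChar n v / v *
        (harmonicSum (x / v) - harmonicSum (w / v) - Real.log (x / w)) +
      ∑ v ∈ Finset.Ico (w + 1) (x + 1), quadChar n v * (harmonicSum (x / v) / v) := by
    rw [e, normSum_eq n w, partialSum, Finset.sum_mul]
    simp only [mul_sub, Finset.sum_sub_distrib, logWeight_apply]
    ring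
  rw [e2]
  exact (abs_add_le _ _).trans (add_le_add h3 h2)

/-- Beyond a power of the conductor, `normSum` grows at most like a logarithm. -/
theorem normSum_le_mul_log {n : ℤ} (hn : ¬ IsSquare n) {w x : ℕ} (hw2 : 2 ≤ w)
    (hw : (4 * n.natAbs) ^ 2 ≤ w) (hwx : w ≤ x) :
    normSum n x * Real.log w ≤ 17 * Real.log x * normSum n (w * w) := by
  have hw0 : (0 : ℝ) < w := by positivity
  have hw1 : (2 : ℝ) ≤ w := by exact_mod_cast hw2
  set q : ℝ := 4 * n.natAbs with hq
  have hq0 : 0 ≤ q := by positivity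
  have hqw : q ^ 2 ≤ w := by rw [hq]; exact_mod_cast hw
  have hlw : 1 / 2 ≤ Real.log w := by
    have h1 : Real.log 2 ≤ Real.log w := Real.log_le_log two_pos hw1
    have := Real.log_two_gt_d9
    linarith
  have hlx : Real.log w ≤ Real.log x := Real.log_le_log hw0 (by exact_mod_cast hwx)
  -- `q / w ≤ 1 / √w ≤ 2 / log w`
  have hqlog : q * Real.log w ≤ 2 * w := by
    have h1 : Real.log w ≤ 2 * √w := by
      have h2 := Real.log_le_sub_one_of_pos (Real.sqrt_pos.mpr hw0)
      rw [Real.log_sqrt hw0.le] at h2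
      linarith
    have h2 : q ≤ √w := Real.le_sqrt_of_sq_le hqw
    have h3 := Real.mul_self_sqrt hw0.le
    have h4 : 0 ≤ √w := Real.sqrt_nonneg _
    nlinarith
  have hqw' : q ≤ w := by
    by_cases h : q ≤ 1
    · linarith
    · nlinarith
  set F := normSum n (w * w) with hF
  have hF1 : 1 ≤ F := one_le_normSum n (by positivity)
  have hww : w ≤ w * w := Nat.le_mul_self w
  have hFw : normSum n w ≤ F := normSum_mono n hww
  have hFw0 : 1 ≤ normSum n w := one_le_normSum n (by positivity)
  set S := partialSum (logWeight (quadChar n)) w with hS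
  have hSl : S * Real.log w ≤ 8 * F := by
    have h1 := (abs_le.mp (abs_normSum_sub_le hn (by positivity) hww)).1
    have h2 : Real.log ((w * w : ℕ) / w) = Real.log w := by
      congr 1; push_cast; field_simp
    have h3 : Real.log ((w * w : ℕ) : ℝ) = 2 * Real.log w := by
      push_cast; rw [Real.log_mul hw0.ne' hw0.ne']; ring
    rw [h2, h3] at h1
    have h4 : q * (1 + 2 * Real.log w) / w ≤ 5 := by
      rw [div_le_iff₀ hw0]
      linarith
    linarith
  have h1 := (abs_le.mp (abs_normSum_sub_le hn (by positivity) hwx)).2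
  have hlxw : Real.log (x / w) = Real.log x - Real.log w := by
    rw [Real.log_div _ hw0.ne']
    have : 0 < x := by omega
    positivity
  rw [hlxw] at h1
  have h5 : q * (1 + Real.log x) / w * Real.log w ≤ 6 * Real.log x := by
    rw [div_mul_eq_mul_div, div_le_iff₀ hw0]
    have : q * Real.log w * (1 + Real.log x) ≤ 2 * w * (3 * Real.log x) := by
      refine mul_le_mul hqlog (by linarith) (by linarith) (by positivity)
    linarith
  have h6 : S * (Real.log x - Real.log w) * Real.log w ≤ 8 * F * Real.log x := by
    have h7 : S * Real.log w * (Real.log x - Real.log w) ≤ 8 * F * (Real.log x - Real.log w) :=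
      mul_le_mul_of_nonneg_right hSl (by linarith)
    have h8 : 0 ≤ 8 * F * Real.log w := by positivity
    linarith
  have h9 : normSum n x * Real.log w ≤ (normSum n w + S * (Real.log x - Real.log w) + 2 +
      q * (1 + Real.log x) / w) * Real.log w :=
    mul_le_mul_of_nonneg_right (by linarith) (by linarith)
  have h10 : normSum n w * Real.log w ≤ F * Real.log x :=
    mul_le_mul hFw hlx (by linarith) (by linarith)
  have h11 : Real.log x ≤ F * Real.log x := le_mul_of_one_le_left (by linarith) hF1
  linarith

/-! ### Integers without inert primes of odd valuation -/

theorem sum_le_sum_of_injOn {ι κ : Type*} {s : Finset ι} {t : Finset κ} {f : ι → ℝ} {g : κ → ℝ}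
    (e : ι → κ) (he : ∀ i ∈ s, e i ∈ t) (hinj : Set.InjOn e s) (hfg : ∀ i ∈ s, f i ≤ g (e i))
    (hg : ∀ k ∈ t, 0 ≤ g k) : ∑ i ∈ s, f i ≤ ∑ k ∈ t, g k := by
  classical
  calc ∑ i ∈ s, f i ≤ ∑ i ∈ s, g (e i) := Finset.sum_le_sum hfg
    _ = ∑ k ∈ s.image e, g k := (Finset.sum_image hinj).symm
    _ ≤ _ := Finset.sum_le_sum_of_subset_of_nonneg
      (Finset.image_subset_iff.mpr he) fun k hk _ => hg k hk

/-- The squarefree positive integers composed of primes modulo which `n` is a square. -/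
def IsSplitSquarefree (n : ℤ) (u : ℕ) : Prop :=
  Squarefree u ∧ ∀ p : ℕ, p.Prime → p ∣ u → IsSquare (n : ZMod p)

theorem IsSplitSquarefree.of_dvd {n : ℤ} {u v : ℕ} (h : IsSplitSquarefree n u) (hv : v ∣ u) :
    IsSplitSquarefree n v :=
  ⟨h.1.squarefree_of_dvd hv, fun p hp hpv => h.2 p hp (hpv.trans hv)⟩

open Classical in
/-- The squarefree integers up to `x` composed of primes modulo which `n` is a square. -/
def splitSquarefree (n : ℤ) (x : ℕ) : Finset ℕ :=
  (Finset.Ioc 0 x).filter (IsSplitSquarefree n)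

theorem mem_splitSquarefree {n : ℤ} {x u : ℕ} :
    u ∈ splitSquarefree n x ↔ (0 < u ∧ u ≤ x) ∧ IsSplitSquarefree n u := by
  simp [splitSquarefree]

/-- The sum of the reciprocals of the elements of `splitSquarefree n x`. -/
def splitSum (n : ℤ) (x : ℕ) : ℝ := ∑ u ∈ splitSquarefree n x, 1 / (u : ℝ)

theorem splitSum_mono (n : ℤ) : Monotone (splitSum n) := by
  intro x y h
  refine Finset.sum_le_sum_of_subset_of_nonneg (fun u hu => ?_) fun _ _ _ => by positivity
  rw [mem_splitSquarefree] at hu ⊢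
  exact ⟨⟨hu.1.1, hu.1.2.trans h⟩, hu.2⟩

theorem one_le_splitSum (n : ℤ) {x : ℕ} (hx : 0 < x) : 1 ≤ splitSum n x := by
  have h1 : 1 ∈ splitSquarefree n x := by
    rw [mem_splitSquarefree]
    exact ⟨⟨one_pos, hx⟩, squarefree_one, fun p hp h => absurd (Nat.dvd_one.mp h) hp.ne_one⟩
  have := Finset.single_le_sum (f := fun u : ℕ => 1 / (u : ℝ)) (fun u _ => by positivity) h1
  simpa [splitSum] using this

/-- Chebyshev's bound turns the count into the logarithmic sum divided by a logarithm. -/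
theorem card_splitSquarefree_mul_log_le (n : ℤ) (y : ℕ) :
    (splitSquarefree n y).card * Real.log y ≤ 3 * (y * splitSum n y) := by
  rcases Nat.eq_zero_or_pos y with rfl | hy
  · simp
  have hy0 : (0 : ℝ) < y := by exact_mod_cast hy
  have hpos : ∀ u ∈ splitSquarefree n y, (0 : ℝ) < u := fun u hu => by
    exact_mod_cast (mem_splitSquarefree.mp hu).1.1
  have h1 : ∑ u ∈ splitSquarefree n y, Real.log (y / u) ≤ y * splitSum n y := by
    rw [splitSum, Finset.mul_sum]
    refine Finset.sum_le_sum fun u hu => ?_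
    have hu0 := hpos u hu
    have := Real.log_le_sub_one_of_pos (by positivity : (0 : ℝ) < y / u)
    rw [mul_one_div]
    linarith
  have h2 : ∑ u ∈ splitSquarefree n y, Real.log u ≤ 2 * (y * splitSum n y) := by
    have e1 : ∀ u ∈ splitSquarefree n y, Real.log u = ∑ p ∈ u.primeFactors, Real.log p := by
      intro u hu
      conv_lhs => rw [← Nat.prod_primeFactors_of_squarefree (mem_splitSquarefree.mp hu).2.1]
      rw [Nat.cast_prod, Real.log_prod]
      intro p hp
      exact_mod_cast (Nat.prime_of_mem_primeFactors hp).ne_zero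
    have e2 : ∀ u ∈ splitSquarefree n y,
        ∑ p ∈ (Finset.Icc 0 (y / u)).filter Nat.Prime, Real.log p ≤ 2 * (y * (1 / u)) := by
      intro u hu
      have hu0 := hpos u hu
      have h3 := Chebyshev.theta_le_log4_mul_x (x := y / u) (by positivity)
      rw [Chebyshev.theta_eq_sum_Icc, Nat.floor_div_natCast, Nat.floor_natCast] at h3
      refine h3.trans ?_
      have h4 : Real.log 4 ≤ 2 := by
        rw [show (4 : ℝ) = 2 ^ 2 by norm_num, Real.log_pow]
        have := Real.log_two_lt_d9
        push_cast
        linarith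
      rw [mul_one_div]
      gcongr
    rw [Finset.sum_congr rfl e1, splitSum, Finset.mul_sum, Finset.mul_sum]
    refine le_trans ?_ (Finset.sum_le_sum e2)
    rw [Finset.sum_sigma', Finset.sum_sigma']
    refine sum_le_sum_of_injOn (fun x => ⟨x.1 / x.2, x.2⟩) ?_ ?_ (fun x _ => le_rfl) ?_
    · rintro ⟨u, p⟩ hup
      simp only [Finset.mem_sigma, Finset.mem_filter, Finset.mem_Icc] at hup ⊢
      obtain ⟨hu, hp⟩ := hup
      have hpp := Nat.prime_of_mem_primeFactors hp
      have hpd := Nat.dvd_of_mem_primeFactors hp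
      obtain ⟨⟨hu0, huy⟩, hus⟩ := mem_splitSquarefree.mp hu
      have hq : 0 < u / p := Nat.div_pos (Nat.le_of_dvd hu0 hpd) hpp.pos
      refine ⟨mem_splitSquarefree.mpr ⟨⟨hq, (Nat.div_le_self u p).trans huy⟩,
        hus.of_dvd (Nat.div_dvd_of_dvd hpd)⟩, ⟨Nat.zero_le _, ?_⟩, hpp⟩
      rw [Nat.le_div_iff_mul_le hq, Nat.mul_div_cancel' hpd]
      exact huy
    · rintro ⟨u, p⟩ hup ⟨v, q⟩ hvq h
      simp only [Finset.coe_sigma, Set.mem_sigma_iff, Finset.mem_coe] at hup hvq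
      simp only [Sigma.mk.injEq, heq_eq_eq] at h
      obtain ⟨h3, rfl⟩ := h
      have h4 := Nat.dvd_of_mem_primeFactors hup.2
      have h5 := Nat.dvd_of_mem_primeFactors hvq.2
      rw [← Nat.div_mul_cancel h4, ← Nat.div_mul_cancel h5, h3]
    · rintro ⟨u, p⟩ _
      exact Real.log_natCast_nonneg p
  have h3 : (splitSquarefree n y).card * Real.log y =
      ∑ u ∈ splitSquarefree n y, Real.log (y / u) + ∑ u ∈ splitSquarefree n y, Real.log u := by
    rw [← Finset.sum_add_distrib, ← nsmul_eq_mul, ← Finset.sum_const]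
    refine Finset.sum_congr rfl fun u hu => ?_
    rw [Real.log_div hy0.ne' (hpos u hu).ne', sub_add_cancel]
  linarith

open Classical in
/-- The number of positive integers up to `x` which are not divisible to an odd power by any
prime modulo which `n` is not a square. -/
def normCount (n : ℤ) (x : ℕ) : ℕ := ((Finset.Ioc 0 x).filter fun c : ℕ => IsNormLike n c).card

/-- Every `c` is `k² u` with `u` squarefree, and `u` divides out exactly the primes of odd
valuation. -/
theorem normCount_le_sum (n : ℤ) (x : ℕ) :
    (normCount n x : ℝ) ≤ ∑ k ∈ Finset.Ioc 0 x, ((splitSquarefree n (x / k ^ 2)).card : ℝ) := by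
  classical
  have h : ∀ c : ℕ, ∃ p : ℕ × ℕ, p.1 ^ 2 * p.2 = c ∧ Squarefree p.2 := fun c => by
    obtain ⟨u, k, hk, hu⟩ := Nat.sq_mul_squarefree c
    exact ⟨⟨k, u⟩, hk, hu⟩
  choose e he hsq using h
  have h1 : ∀ m : ℕ, (m : ℝ) = ∑ _i ∈ Finset.range m, (1 : ℝ) := by simp
  rw [normCount, Finset.cast_card]
  simp only [Finset.cast_card (R := ℝ)]
  rw [Finset.sum_sigma']
  refine sum_le_sum_of_injOn (fun c => ⟨(e c).1, (e c).2⟩) ?_ ?_ (fun _ _ => le_rfl)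
    (fun _ _ => zero_le_one)
  · intro c hc
    simp only [Finset.mem_filter, Finset.mem_Ioc] at hc
    obtain ⟨⟨hc0, hcx⟩, hcn⟩ := hc
    have hk0 : (e c).1 ≠ 0 := by
      intro h
      have := he c
      rw [h] at this
      simp at this
      omega
    have hu0 : (e c).2 ≠ 0 := (hsq c).ne_zero
    have hk : (e c).1 ≤ c := by
      calc (e c).1 ≤ (e c).1 ^ 2 * (e c).2 := by
            nlinarith [Nat.pos_of_ne_zero hk0, Nat.pos_of_ne_zero hu0]
        _ = c := he c
    simp only [Finset.mem_sigma, Finset.mem_Ioc]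
    refine ⟨⟨Nat.pos_of_ne_zero hk0, hk.trans hcx⟩, mem_splitSquarefree.mpr
      ⟨⟨Nat.pos_of_ne_zero hu0, ?_⟩, hsq c, fun p hp hpu => hcn p hp ?_⟩⟩
    · rw [Nat.le_div_iff_mul_le (by positivity), mul_comm, he c]
      exact hcx
    · have : Fact p.Prime := ⟨hp⟩
      have h2 : padicValNat p (e c).2 = 1 := by
        refine le_antisymm ?_ (one_le_padicValNat_of_dvd hu0 hpu)
        have := (hsq c).natFactorization_le_one p
        rwa [Nat.factorization_def _ hp] at this
      rw [padicValInt.of_nat, ← he c, padicValNat.mul (pow_ne_zero _ hk0) hu0, padicValNat.pow, h2]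
      exact odd_two_mul_add_one _
  · intro c _ c' _ h
    simp only [Sigma.mk.injEq, heq_eq_eq] at h
    rw [← he c, ← he c', h.1, h.2]

theorem exists_sum_sqrt_div_sq_le : ∃ C : ℝ, 0 < C ∧
    ∀ s : Finset ℕ, ∑ k ∈ s, √k / (k : ℝ) ^ 2 ≤ C := by
  have hs : Summable fun k : ℕ => √k / (k : ℝ) ^ 2 := by
    have := Real.summable_one_div_nat_rpow.mpr (by norm_num : (1 : ℝ) < 3 / 2)
    refine this.congr fun k => ?_
    rcases Nat.eq_zero_or_pos k with rfl | hk
    · norm_num [Real.zero_rpow]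
    have hk0 : (0 : ℝ) < k := by exact_mod_cast hk
    rw [Real.sqrt_eq_rpow, ← Real.rpow_natCast, ← Real.rpow_sub hk0, one_div,
      ← Real.rpow_neg hk0.le]
    norm_num
  refine ⟨∑' k : ℕ, √k / (k : ℝ) ^ 2 + 1, ?_, fun s => ?_⟩
  · have : 0 ≤ ∑' k : ℕ, √k / (k : ℝ) ^ 2 := tsum_nonneg fun k => by positivity
    linarith
  · have := hs.sum_le_tsum s fun k _ => by positivity
    linarith

/-- The bound for squarefree integers, summed over the square parts `k²`; the terms with large `k`
are controlled by the convergence of `∑ √k / k²`. -/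
theorem exists_normCount_mul_log_le : ∃ C : ℝ, 0 < C ∧ ∀ (n : ℤ) (x : ℕ),
    normCount n x * Real.log x ≤ C * (x * splitSum n x) := by
  obtain ⟨C, hC, hsum⟩ := exists_sum_sqrt_div_sq_le
  refine ⟨4 * C, by positivity, fun n x => ?_⟩
  rcases Nat.eq_zero_or_pos x with rfl | hx
  · simp
  have hx1 : (1 : ℝ) ≤ x := by exact_mod_cast hx
  have hD : 1 ≤ splitSum n x := one_le_splitSum n hx
  have key : ∀ k ∈ Finset.Ioc 0 x, ((splitSquarefree n (x / k ^ 2)).card : ℝ) * Real.log x ≤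
      4 * (x * splitSum n x) * (√k / (k : ℝ) ^ 2) := by
    intro k hk
    have hk1 : 0 < k := (Finset.mem_Ioc.mp hk).1
    have hk0 : (1 : ℝ) ≤ k := by exact_mod_cast hk1
    set y := x / k ^ 2 with hy
    have hyx : (y : ℝ) ≤ x / (k : ℝ) ^ 2 := by
      have := Nat.cast_div_le (m := x) (n := k ^ 2) (α := ℝ)
      exact_mod_cast this
    have hU : ((splitSquarefree n y).card : ℝ) ≤ y := by
      have h2 : (splitSquarefree n y).card ≤ y := by
        rw [splitSquarefree]
        classical
        refine (Finset.card_filter_le _ _).trans ?_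
        simp
      exact_mod_cast h2
    have hU0 : (0 : ℝ) ≤ (splitSquarefree n y).card := Nat.cast_nonneg _
    rcases Nat.eq_zero_or_pos y with hy0 | hy0
    · have h3 : (splitSquarefree n y).card = 0 := by
        rw [hy0]
        simp [splitSquarefree]
      rw [h3]
      simp only [Nat.cast_zero, zero_mul]
      positivity
    have hy1 : (1 : ℝ) ≤ y := by exact_mod_cast hy0
    have hlog : Real.log x ≤ 1 + Real.log y + 2 * Real.log k := by
      have h1 : (x : ℝ) ≤ 2 * y * (k : ℝ) ^ 2 := by
        have : x ≤ k ^ 2 * (y + 1) := (Nat.lt_mul_div_succ x (by positivity)).le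
        have h2 : (x : ℝ) ≤ (k : ℝ) ^ 2 * (y + 1) := by exact_mod_cast this
        have h4 : (k : ℝ) ^ 2 * (y + 1) ≤ (k : ℝ) ^ 2 * (2 * y) := by gcongr; linarith
        linarith
      have h2 := Real.log_le_log (by linarith) h1
      rw [Real.log_mul (by positivity) (by positivity), Real.log_mul (by positivity)
        (by positivity), Real.log_pow] at h2
      have := Real.log_two_lt_d9
      push_cast at h2
      linarith
    have hlogk : Real.log k ≤ 2 * √k - 2 := by
      have h2 := Real.log_le_sub_one_of_pos (Real.sqrt_pos.mpr (by linarith : (0 : ℝ) < k))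
      rw [Real.log_sqrt (by linarith)] at h2
      linarith
    have h4 := card_splitSquarefree_mul_log_le n y
    have h5 : splitSum n y ≤ splitSum n x := splitSum_mono n (Nat.div_le_self _ _)
    have hlogk0 : 0 ≤ Real.log k := Real.log_nonneg hk0
    calc ((splitSquarefree n y).card : ℝ) * Real.log x
        ≤ (splitSquarefree n y).card * (1 + Real.log y + 2 * Real.log k) := by gcongr
      _ = (splitSquarefree n y).card * Real.log y +
          (splitSquarefree n y).card * (1 + 2 * Real.log k) := by ring
      _ ≤ 3 * (y * splitSum n x) + y * (1 + 2 * Real.log k) := by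
          refine add_le_add (h4.trans (by gcongr)) (by gcongr)
      _ ≤ 3 * (y * splitSum n x) + y * splitSum n x * (1 + 2 * Real.log k) := by
          gcongr
          exact le_mul_of_one_le_right (by positivity) hD
      _ = y * splitSum n x * (4 + 2 * Real.log k) := by ring
      _ ≤ y * splitSum n x * (4 * √k) := by gcongr; linarith
      _ ≤ x / (k : ℝ) ^ 2 * splitSum n x * (4 * √k) := by gcongr
      _ = _ := by ring
  calc (normCount n x : ℝ) * Real.log x
      ≤ (∑ k ∈ Finset.Ioc 0 x, ((splitSquarefree n (x / k ^ 2)).card : ℝ)) * Real.log x :=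
        mul_le_mul_of_nonneg_right (normCount_le_sum n x) (Real.log_nonneg hx1)
    _ ≤ ∑ k ∈ Finset.Ioc 0 x, 4 * (x * splitSum n x) * (√k / (k : ℝ) ^ 2) := by
        rw [Finset.sum_mul]
        exact Finset.sum_le_sum key
    _ ≤ 4 * (x * splitSum n x) * C := by
        rw [← Finset.mul_sum]
        exact mul_le_mul_of_nonneg_left (hsum _) (by positivity)
    _ = _ := by ring

/-- The sum of the reciprocals of the divisors of `m`. -/
def divisorSum (m : ℕ) : ℝ := ∑ e ∈ m.divisors, 1 / (e : ℝ)

theorem divisorSum_nonneg (m : ℕ) : 0 ≤ divisorSum m := Finset.sum_nonneg fun _ _ => by positivity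

theorem divisorSum_mul_le (a b : ℕ) : divisorSum (a * b) ≤ divisorSum a * divisorSum b := by
  rw [divisorSum, divisorSum, divisorSum, Finset.sum_mul_sum, ← Finset.sum_product']
  have h : ∀ e : ℕ, ∃ p : ℕ × ℕ, e ∈ (a * b).divisors →
      p.1 * p.2 = e ∧ p.1 ∈ a.divisors ∧ p.2 ∈ b.divisors := by
    intro e
    by_cases he : e ∈ (a * b).divisors
    · rw [Nat.mem_divisors] at he
      obtain ⟨x, y, hx, hy, hxy⟩ := exists_dvd_and_dvd_of_dvd_mul he.1
      exact ⟨⟨x, y⟩, fun _ => ⟨hxy.symm, Nat.mem_divisors.mpr ⟨hx, left_ne_zero_of_mul he.2⟩,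
        Nat.mem_divisors.mpr ⟨hy, right_ne_zero_of_mul he.2⟩⟩⟩
    · exact ⟨⟨0, 0⟩, fun h => absurd h he⟩
  choose s hs using h
  refine sum_le_sum_of_injOn s (fun e he => ?_) (fun e he e' he' h => ?_) (fun e he => ?_)
    fun _ _ => by positivity
  · exact Finset.mem_product.mpr (hs e he).2
  · rw [← (hs e he).1, ← (hs e' he').1, h]
  · rw [div_mul_div_comm, one_mul]
    exact_mod_cast (by rw [(hs e he).1] : (1 : ℝ) / e ≤ 1 / ((s e).1 * (s e).2 : ℕ))

open Classical in
/-- The function `u ↦ 1 / u` on the integers `u` composed of primes `p` with `(n / p) = 1`. -/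
def splitFn (n : ℤ) : ArithmeticFunction ℝ :=
  logWeight fun u => if ∀ p : ℕ, p.Prime → p ∣ u → quadChar n p = 1 then 1 else 0

theorem splitFn_nonneg (n : ℤ) (u : ℕ) : 0 ≤ splitFn n u := by
  rw [splitFn, logWeight_apply]
  refine div_nonneg ?_ (Nat.cast_nonneg u)
  split_ifs <;> norm_num

theorem splitFn_eq_zero {n : ℤ} {p u : ℕ} (hp : p.Prime) (hpu : p ∣ u) (h : quadChar n p ≠ 1) :
    splitFn n u = 0 := by
  rw [splitFn, logWeight_apply, if_neg (fun h' => h (h' p hp hpu)), zero_div]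

theorem quadChar_eq_one {n : ℤ} {u : ℕ} (hu : u ≠ 0)
    (h : ∀ p : ℕ, p.Prime → p ∣ u → quadChar n p = 1) : quadChar n u = 1 := by
  induction u using Nat.recOnMul with
  | zero => exact absurd rfl hu
  | one => simp
  | prime p hp => exact h p hp dvd_rfl
  | mul a b iha ihb =>
    rw [quadChar_mul, iha (left_ne_zero_of_mul hu) fun p hp hpa => h p hp (hpa.mul_right b),
      ihb (right_ne_zero_of_mul hu) fun p hp hpb => h p hp (hpb.mul_left a), one_mul]

/-- On integers composed of primes `p` with `(n / p) = 1`, both sides are the number of divisors of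
`m` divided by `m`. -/
theorem splitFn_mul_self_le (n : ℤ) (m : ℕ) : (splitFn n * splitFn n) m ≤ normFn n m := by
  rcases eq_or_ne m 0 with rfl | hm
  · simp
  by_cases h : ∀ p : ℕ, p.Prime → p ∣ m → quadChar n p = 1
  · rw [mul_apply, normFn, mul_apply]
    refine Finset.sum_le_sum fun p hp => ?_
    have hpm := (Nat.mem_divisorsAntidiagonal.mp hp).1
    have h1 : p.1 ∣ m := Dvd.intro _ hpm
    have h2 : p.2 ∣ m := Dvd.intro_left _ hpm
    rw [splitFn, logWeight_apply, logWeight_apply, logWeight_apply, logWeight_apply,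
      quadChar_eq_one (ne_zero_of_dvd_ne_zero hm h1) fun q hq hqp => h q hq (hqp.trans h1),
      if_pos fun q hq hqp => h q hq (hqp.trans h1), if_pos fun q hq hqp => h q hq (hqp.trans h2)]
    simp
  · refine le_trans (le_of_eq ?_) (normFn_nonneg n m)
    rw [mul_apply]
    refine Finset.sum_eq_zero fun p hp => ?_
    have hpm := (Nat.mem_divisorsAntidiagonal.mp hp).1
    push Not at h
    obtain ⟨q, hq, hqm, hne⟩ := h
    rw [← hpm] at hqm
    rcases (Nat.Prime.dvd_mul hq).mp hqm with h1 | h1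
    · rw [splitFn_eq_zero hq h1 hne, zero_mul]
    · rw [splitFn_eq_zero hq h1 hne, mul_zero]

/-- The ramified primes contribute at most the factor `divisorSum (2 * |n|)`. -/
theorem splitSum_le (n : ℤ) (hn : n ≠ 0) (x : ℕ) :
    splitSum n x ≤ divisorSum (2 * n.natAbs) * partialSum (splitFn n) x := by
  have hN : 2 * n.natAbs ≠ 0 := by simpa using hn
  rw [splitSum, divisorSum, partialSum, Finset.sum_mul_sum, ← Finset.sum_product']
  refine sum_le_sum_of_injOn (fun u => (u.gcd (2 * n.natAbs), u / u.gcd (2 * n.natAbs)))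
    (fun u hu => ?_) (fun u hu v hv h => ?_) (fun u hu => ?_) fun p _ =>
      mul_nonneg (by positivity) (splitFn_nonneg n _)
  · obtain ⟨⟨hu0, hux⟩, -⟩ := mem_splitSquarefree.mp hu
    refine Finset.mem_product.mpr ⟨Nat.mem_divisors.mpr ⟨Nat.gcd_dvd_right _ _, hN⟩,
      Finset.mem_Ioc.mpr ⟨Nat.div_pos (Nat.le_of_dvd hu0 (Nat.gcd_dvd_left _ _))
        (Nat.gcd_pos_of_pos_left _ hu0), (Nat.div_le_self _ _).trans hux⟩⟩
  · simp only [Prod.mk.injEq] at h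
    rw [← Nat.mul_div_cancel' (Nat.gcd_dvd_left u (2 * n.natAbs)), h.2, h.1,
      Nat.mul_div_cancel' (Nat.gcd_dvd_left v (2 * n.natAbs))]
  · obtain ⟨⟨hu0, hux⟩, hsq, hsplit⟩ := mem_splitSquarefree.mp hu
    set g := u.gcd (2 * n.natAbs) with hg
    have hgu : g ∣ u := Nat.gcd_dvd_left _ _
    obtain ⟨w, hw⟩ := hgu
    have hg0 : 0 < g := Nat.gcd_pos_of_pos_left _ hu0
    have huw : u / g = w := by rw [hw, Nat.mul_div_cancel_left _ hg0]
    have hcond : ∀ p : ℕ, p.Prime → p ∣ w → quadChar n p = 1 := by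
      intro p hp hpw
      have hpg : ¬ p ∣ 2 * n.natAbs := by
        intro hpn
        have h1 : p ∣ g := Nat.dvd_gcd (hpw.trans (Dvd.intro_left g hw.symm)) hpn
        have h2 : p * p ∣ u := hw ▸ mul_dvd_mul h1 hpw
        exact hp.not_isUnit (hsq p h2)
      have hp2 : p ≠ 2 := by rintro rfl; exact hpg (dvd_mul_right _ _)
      have hpn : ¬ p ∣ n.natAbs := fun h => hpg (h.mul_left 2)
      have : Fact p.Prime := ⟨hp⟩
      have h3 := hsplit p hp (hpw.trans (Dvd.intro_left g hw.symm))
      have h4 : (n : ZMod p) ≠ 0 := by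
        rw [Ne, ZMod.intCast_zmod_eq_zero_iff_dvd]
        exact fun h => hpn (Int.natCast_dvd.mp h)
      rw [quadChar_of_odd n (hp.odd_of_ne_two hp2), ← jacobiSym.legendreSym.to_jacobiSym,
        (legendreSym.eq_one_iff p h4).mpr h3, Int.cast_one]
    simp only
    rw [huw, splitFn, logWeight_apply, if_pos hcond, div_mul_div_comm, one_mul, hw]
    push_cast
    exact le_rfl

/-- The square of `splitSum` is bounded by `normSum`, as `splitFn * splitFn ≤ normFn`. -/
theorem splitSum_sq_le (n : ℤ) (hn : n ≠ 0) (x : ℕ) :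
    splitSum n x ^ 2 ≤ divisorSum (2 * n.natAbs) ^ 2 * normSum n (x * x) := by
  have h1 : partialSum (splitFn n) x ^ 2 ≤ normSum n (x * x) := by
    rw [sq]
    refine (mul_partialSum_le (splitFn_nonneg n) (splitFn_nonneg n) le_rfl).trans ?_
    exact Finset.sum_le_sum fun m _ => splitFn_mul_self_le n m
  have h0 : 0 ≤ splitSum n x := Finset.sum_nonneg fun _ _ => by positivity
  calc splitSum n x ^ 2 ≤ (divisorSum (2 * n.natAbs) * partialSum (splitFn n) x) ^ 2 := by
        gcongr; exact splitSum_le n hn x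
    _ = divisorSum (2 * n.natAbs) ^ 2 * partialSum (splitFn n) x ^ 2 := by ring
    _ ≤ _ := by gcongr

/-! ### The average of the logarithmic sums over a family of characters -/

/-- Expanding the square of `divisorSum` reduces weighted sums to sums over multiples of `lcm(d,
e)`. -/
theorem sum_divisorSum_sq_mul (f : ℕ → ℝ) (A : ℕ) :
    ∑ a ∈ Finset.Ioc 0 A, divisorSum a ^ 2 * f a =
      ∑ d ∈ Finset.Ioc 0 A, ∑ e ∈ Finset.Ioc 0 A, 1 / ((d : ℝ) * e) *
        ∑ m ∈ Finset.Ioc 0 (A / d.lcm e), f (d.lcm e * m) := by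
  have h1 : ∀ a ∈ Finset.Ioc 0 A, divisorSum a ^ 2 * f a =
      ∑ d ∈ Finset.Ioc 0 A, ∑ e ∈ Finset.Ioc 0 A,
        if d ∣ a ∧ e ∣ a then 1 / ((d : ℝ) * e) * f a else 0 := by
    intro a ha
    have hdiv : a.divisors = (Finset.Ioc 0 A).filter (· ∣ a) := by
      ext d
      rw [Finset.mem_Ioc] at ha
      simp only [Nat.mem_divisors, Finset.mem_filter, Finset.mem_Ioc]
      constructor
      · rintro ⟨h, -⟩
        exact ⟨⟨Nat.pos_of_dvd_of_pos h ha.1, (Nat.le_of_dvd ha.1 h).trans ha.2⟩, h⟩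
      · rintro ⟨-, h⟩
        exact ⟨h, ha.1.ne'⟩
    rw [divisorSum, sq, hdiv, Finset.sum_mul_sum, Finset.sum_mul, Finset.sum_filter]
    refine Finset.sum_congr rfl fun d _ => ?_
    split_ifs with hd
    · rw [Finset.sum_mul, Finset.sum_filter]
      refine Finset.sum_congr rfl fun e _ => ?_
      simp only [hd, true_and]
      split_ifs
      · rw [div_mul_div_comm, one_mul]
      · rfl
    · simp [hd]
  rw [Finset.sum_congr rfl h1, Finset.sum_comm]
  refine Finset.sum_congr rfl fun d hd => ?_
  rw [Finset.sum_comm]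
  refine Finset.sum_congr rfl fun e he => ?_
  rw [Finset.mem_Ioc] at hd he
  have hl : 0 < d.lcm e := Nat.lcm_pos hd.1 he.1
  rw [← Finset.sum_filter, Finset.mul_sum]
  refine (Finset.sum_nbij (fun m => d.lcm e * m) ?_ ?_ ?_ fun m _ => rfl).symm
  · intro m hm
    simp only [Finset.mem_Ioc, Finset.mem_filter] at hm ⊢
    refine ⟨⟨Nat.mul_pos hl hm.1, ?_⟩, (Nat.dvd_lcm_left d e).mul_right m,
      (Nat.dvd_lcm_right d e).mul_right m⟩
    rw [mul_comm]
    exact (Nat.le_div_iff_mul_le hl).mp hm.2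
  · intro m _ m' _ h
    exact Nat.eq_of_mul_eq_mul_left hl h
  · intro a ha
    simp only [Finset.coe_filter, Finset.mem_Ioc, Set.mem_ofPred_eq] at ha
    obtain ⟨m, rfl⟩ := Nat.lcm_dvd ha.2.1 ha.2.2
    refine ⟨m, ?_, rfl⟩
    simp only [Finset.coe_Ioc, Set.mem_Ioc]
    refine ⟨Nat.pos_of_mul_pos_left ha.1.1, (Nat.le_div_iff_mul_le hl).mpr ?_⟩
    rw [mul_comm]
    exact ha.1.2

/-- The mean square of `divisorSum` is bounded, since `lcm(d, e) ≥ √d √e`. -/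
theorem exists_sum_divisorSum_sq_le : ∃ C : ℝ, 0 < C ∧ ∀ A : ℕ,
    ∑ a ∈ Finset.Ioc 0 A, divisorSum a ^ 2 ≤ C * A := by
  obtain ⟨C, hC, hsum⟩ := exists_sum_sqrt_div_sq_le
  refine ⟨C ^ 2, by positivity, fun A => ?_⟩
  have h := sum_divisorSum_sq_mul (fun _ => 1) A
  simp only [mul_one] at h
  rw [h]
  have key : ∀ d ∈ Finset.Ioc 0 A, ∀ e ∈ Finset.Ioc 0 A, 1 / ((d : ℝ) * e) *
      ∑ _m ∈ Finset.Ioc 0 (A / d.lcm e), (1 : ℝ) ≤ A * (√d / (d : ℝ) ^ 2 * (√e / (e : ℝ) ^ 2)) := by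
    intro d hd e he
    rw [Finset.mem_Ioc] at hd he
    have hd0 : (0 : ℝ) < d := by exact_mod_cast hd.1
    have he0 : (0 : ℝ) < e := by exact_mod_cast he.1
    have hl : 0 < d.lcm e := Nat.lcm_pos hd.1 he.1
    have hl0 : (0 : ℝ) < d.lcm e := by exact_mod_cast hl
    have h1 : ∑ _m ∈ Finset.Ioc 0 (A / d.lcm e), (1 : ℝ) ≤ A / d.lcm e := by
      simp only [Finset.sum_const, Nat.card_Ioc, Nat.sub_zero, nsmul_eq_mul, mul_one]
      exact Nat.cast_div_le
    have h2 : √d * √e ≤ d.lcm e := by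
      rw [← Real.sqrt_mul hd0.le, Real.sqrt_le_left hl0.le, sq]
      have h3 : d ≤ d.lcm e := Nat.le_of_dvd hl (Nat.dvd_lcm_left d e)
      have h4 : e ≤ d.lcm e := Nat.le_of_dvd hl (Nat.dvd_lcm_right d e)
      exact_mod_cast Nat.mul_le_mul h3 h4
    have hsd : √(d : ℝ) * √d = d := Real.mul_self_sqrt hd0.le
    have hse : √(e : ℝ) * √e = e := Real.mul_self_sqrt he0.le
    have hsd0 : 0 < √(d : ℝ) := Real.sqrt_pos.mpr hd0
    have hse0 : 0 < √(e : ℝ) := Real.sqrt_pos.mpr he0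
    calc 1 / ((d : ℝ) * e) * ∑ _m ∈ Finset.Ioc 0 (A / d.lcm e), (1 : ℝ)
        ≤ 1 / ((d : ℝ) * e) * (A / (√d * √e)) := by
          refine mul_le_mul_of_nonneg_left (h1.trans ?_) (by positivity)
          exact div_le_div_of_nonneg_left (Nat.cast_nonneg A) (by positivity) h2
      _ = A * (√d / (d : ℝ) ^ 2 * (√e / (e : ℝ) ^ 2)) := by
          field_simp
          rw [Real.sq_sqrt hd0.le, Real.sq_sqrt he0.le]
          ring
  refine (Finset.sum_le_sum fun d hd => Finset.sum_le_sum fun e he => key d hd e he).trans ?_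
  have h0 : 0 ≤ ∑ k ∈ Finset.Ioc 0 A, √k / (k : ℝ) ^ 2 := Finset.sum_nonneg fun _ _ => by positivity
  simp only [← Finset.mul_sum]
  rw [← Finset.sum_mul, mul_comm]
  have := hsum (Finset.Ioc 0 A)
  gcongr
  nlinarith

theorem abs_sum_divisorSum_sq_mul_quadChar_le {v : ℕ} (hv : ¬ IsSquare v) (A : ℕ) :
    |∑ a ∈ Finset.Ioc 0 A, divisorSum a ^ 2 * quadChar a v| ≤ v * harmonicSum A ^ 2 := by
  rw [sum_divisorSum_sq_mul fun a => quadChar a v, harmonicSum_eq, sq, Finset.sum_mul_sum,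
    Finset.mul_sum]
  refine (Finset.abs_sum_le_sum_abs _ _).trans (Finset.sum_le_sum fun d _ => ?_)
  rw [Finset.mul_sum]
  refine (Finset.abs_sum_le_sum_abs _ _).trans (Finset.sum_le_sum fun e _ => ?_)
  have h1 : |∑ m ∈ Finset.Ioc 0 (A / d.lcm e), quadChar ((d.lcm e * m : ℕ) : ℤ) v| ≤ v := by
    have h2 : ∀ m : ℕ, quadChar ((d.lcm e * m : ℕ) : ℤ) v =
        quadChar (d.lcm e : ℕ) v * quadChar m v := fun m => by
      rw [Nat.cast_mul, quadChar_mul_left]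
    have h3 : Finset.Ioc 0 (A / d.lcm e) = Finset.Ico 1 (A / d.lcm e + 1) := by ext; simp; omega
    simp only [h2]
    rw [← Finset.mul_sum, abs_mul, h3]
    refine (mul_le_mul (abs_quadChar_le_one _ v) (abs_sum_quadChar_left_le hv 1 _)
      (abs_nonneg _) zero_le_one).trans ?_
    rw [one_mul]
  rw [abs_mul, abs_of_nonneg (by positivity : (0 : ℝ) ≤ 1 / ((d : ℝ) * e)), div_mul_div_comm,
    one_mul, mul_comm (v : ℝ)]
  gcongr

theorem harmonicSum_pow_four_le (A : ℕ) : harmonicSum A ^ 4 ≤ 256 * A := by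
  rcases Nat.eq_zero_or_pos A with rfl | hA
  · simp [harmonicSum_eq]
  have hA0 : (0 : ℝ) < A := by exact_mod_cast hA
  have h1 : harmonicSum A ≤ 4 * √√(A : ℝ) := by
    have h2 := Real.log_le_sub_one_of_pos (Real.sqrt_pos.mpr (Real.sqrt_pos.mpr hA0))
    rw [Real.log_sqrt (Real.sqrt_nonneg _), Real.log_sqrt hA0.le] at h2
    have := harmonicSum_le A
    linarith
  calc harmonicSum A ^ 4 ≤ (4 * √√(A : ℝ)) ^ 4 := by
        gcongr; exact harmonicSum_nonneg A
    _ = 256 * ((√√(A : ℝ)) ^ 2) ^ 2 := by ring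
    _ = 256 * A := by rw [Real.sq_sqrt (Real.sqrt_nonneg _), Real.sq_sqrt hA0.le]

theorem exists_sum_isSquare_inv_le : ∃ C : ℝ, 0 < C ∧ ∀ z : ℕ,
    ∑ v ∈ (Finset.Ioc 0 z).filter IsSquare, 1 / (v : ℝ) ≤ C := by
  obtain ⟨C, hC, hsum⟩ := exists_sum_sqrt_div_sq_le
  refine ⟨C, hC, fun z => ?_⟩
  refine (sum_le_sum_of_injOn (t := Finset.Ioc 0 z) (g := fun k : ℕ => √k / (k : ℝ) ^ 2)
    Nat.sqrt ?_ ?_ ?_ fun _ _ => by positivity).trans (hsum _)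
  · intro v hv
    simp only [Finset.mem_filter, Finset.mem_Ioc] at hv ⊢
    exact ⟨Nat.sqrt_pos.mpr hv.1.1, (Nat.sqrt_le_self v).trans hv.1.2⟩
  · intro v hv w hw h
    simp only [Finset.coe_filter, Set.mem_ofPred_eq] at hv hw
    obtain ⟨r, rfl⟩ := hv.2
    obtain ⟨t, rfl⟩ := hw.2
    rw [Nat.sqrt_eq, Nat.sqrt_eq] at h
    rw [h]
  · intro v hv
    simp only [Finset.mem_filter, Finset.mem_Ioc] at hv
    obtain ⟨⟨h0, -⟩, r, rfl⟩ := hv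
    rw [Nat.sqrt_eq]
    have hr : 0 < r := Nat.pos_of_mul_pos_left h0
    have hr1 : (1 : ℝ) ≤ √r := by
      rw [Real.one_le_sqrt]; exact_mod_cast hr
    push_cast
    rw [← sq]
    gcongr

/-- On average over `a` and `b`, the logarithmic sums for `n = ± a b` are no larger than for the
trivial reason that square `v` contribute. -/
theorem exists_sum_normSum_le : ∃ C : ℝ, 0 < C ∧ ∀ (s : ℤ) (A z : ℕ), z ^ 2 ≤ 4 * A →
    ∑ a ∈ Finset.Ioc 0 A, ∑ b ∈ Finset.Ioc 0 A,
      divisorSum a ^ 2 * divisorSum b ^ 2 * normSum (s * (a * b)) z ≤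
        C * ((A : ℝ) ^ 2 * harmonicSum z) := by
  classical
  obtain ⟨C₀, hC₀, hsum⟩ := exists_sum_isSquare_inv_le
  obtain ⟨C₁, hC₁, hw⟩ := exists_sum_divisorSum_sq_le
  refine ⟨C₁ ^ 2 * C₀ + 1024, by positivity, fun s A z hz => ?_⟩
  let W : ℕ → ℝ := fun v => ∑ a ∈ Finset.Ioc 0 A, divisorSum a ^ 2 * quadChar a v
  have e : ∑ a ∈ Finset.Ioc 0 A, ∑ b ∈ Finset.Ioc 0 A,
      divisorSum a ^ 2 * divisorSum b ^ 2 * normSum (s * (a * b)) z =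
      ∑ v ∈ Finset.Ioc 0 z, quadChar s v / v * harmonicSum (z / v) * W v ^ 2 := by
    simp only [normSum_eq, Finset.mul_sum]
    rw [Finset.sum_congr rfl fun a _ => Finset.sum_comm, Finset.sum_comm]
    refine Finset.sum_congr rfl fun v _ => ?_
    rw [sq (W v), Finset.sum_mul_sum, Finset.mul_sum]
    refine Finset.sum_congr rfl fun a _ => ?_
    rw [Finset.mul_sum]
    refine Finset.sum_congr rfl fun b _ => ?_
    rw [quadChar_mul_left, quadChar_mul_left]
    ring
  rw [e]
  have hH := harmonicSum_nonneg z
  have hWsq : ∀ v, W v ^ 2 ≤ (C₁ * A) ^ 2 := by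
    intro v
    rw [← sq_abs]
    refine pow_le_pow_left₀ (abs_nonneg _) (le_trans ?_ (hw A)) 2
    refine (Finset.abs_sum_le_sum_abs _ _).trans (Finset.sum_le_sum fun a _ => ?_)
    rw [abs_mul, abs_of_nonneg (by positivity : 0 ≤ divisorSum a ^ 2)]
    exact mul_le_of_le_one_right (by positivity) (abs_quadChar_le_one _ _)
  have hterm : ∀ v ∈ Finset.Ioc 0 z, quadChar s v / v * harmonicSum (z / v) * W v ^ 2 ≤
      harmonicSum z *
        (if IsSquare v then (C₁ * A) ^ 2 * (1 / (v : ℝ)) else z * harmonicSum A ^ 4) := by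
    intro v hv
    rw [Finset.mem_Ioc] at hv
    have hv0 : (0 : ℝ) < v := by exact_mod_cast hv.1
    have h1 : quadChar s v / v * harmonicSum (z / v) * W v ^ 2 ≤
        1 / v * harmonicSum z * W v ^ 2 := by
      gcongr
      · exact harmonicSum_nonneg _
      · exact (abs_le.mp (abs_quadChar_le_one s v)).2
      · exact harmonicSum_mono (Nat.div_le_self z v)
    refine h1.trans ?_
    split_ifs with hsq
    · calc 1 / v * harmonicSum z * W v ^ 2 ≤ 1 / v * harmonicSum z * (C₁ * A) ^ 2 := by
            exact mul_le_mul_of_nonneg_left (hWsq v) (by positivity)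
        _ = _ := by ring
    -- the bound `v` for the character sum is so small because `v ≤ z` is about `√A`
    · have h2 : W v ^ 2 ≤ (v * harmonicSum A ^ 2) ^ 2 := by
        rw [← sq_abs]
        exact pow_le_pow_left₀ (abs_nonneg _) (abs_sum_divisorSum_sq_mul_quadChar_le hsq A) 2
      calc 1 / v * harmonicSum z * W v ^ 2
          ≤ 1 / v * harmonicSum z * (v * harmonicSum A ^ 2) ^ 2 := by
            gcongr
        _ = harmonicSum z * (v * harmonicSum A ^ 4) := by field_simp
        _ ≤ _ := by
            gcongr
            exact hv.2
  refine (Finset.sum_le_sum hterm).trans ?_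
  rw [← Finset.mul_sum, Finset.sum_ite, ← Finset.mul_sum]
  have hs1 : ∑ v ∈ (Finset.Ioc 0 z).filter IsSquare, 1 / (v : ℝ) ≤ C₀ := hsum z
  have hs2 : ∑ v ∈ (Finset.Ioc 0 z).filter (fun v => ¬ IsSquare v), (z : ℝ) * harmonicSum A ^ 4 ≤
      1024 * (A : ℝ) ^ 2 := by
    rw [Finset.sum_const, nsmul_eq_mul]
    have hcard : (((Finset.Ioc 0 z).filter (fun v => ¬ IsSquare v)).card : ℝ) ≤ z := by
      have := Finset.card_filter_le (Finset.Ioc 0 z) (fun v => ¬ IsSquare v)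
      rw [Nat.card_Ioc, Nat.sub_zero] at this
      exact_mod_cast this
    have hz' : (z : ℝ) ^ 2 ≤ 4 * A := by exact_mod_cast hz
    calc _ ≤ (z : ℝ) * (z * harmonicSum A ^ 4) := by
          gcongr
      _ = (z : ℝ) ^ 2 * harmonicSum A ^ 4 := by ring
      _ ≤ (4 * A) * (256 * A) := by
          refine mul_le_mul hz' (harmonicSum_pow_four_le A) (by positivity) (by positivity)
      _ = _ := by ring
  calc _ ≤ harmonicSum z * ((C₁ * A) ^ 2 * C₀ + 1024 * (A : ℝ) ^ 2) := by gcongr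
    _ = _ := by ring

/-- The count of `c ≤ x` in terms of the logarithmic sum for a character of small conductor. -/
theorem exists_normCount_sq_le : ∃ C : ℝ, 0 < C ∧ ∀ (s : ℤ) (a b A x : ℕ), s.natAbs = 1 →
    0 < a → 0 < b → a ≤ A → b ≤ A → 2 ≤ x → A ≤ x ^ 2 → ¬ IsSquare (s * (a * b) : ℤ) →
    (normCount (s * (a * b)) x : ℝ) ^ 2 * (Real.log x * Real.log (A + 1)) ≤
      C * ((x : ℝ) ^ 2 * (divisorSum a ^ 2 * divisorSum b ^ 2 *
        normSum (s * (a * b)) (Nat.sqrt A + 1))) := by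
  obtain ⟨C, hC, hcount⟩ := exists_normCount_mul_log_le
  refine ⟨C ^ 2 * (9 / 4) * (17 * 24) * (16 * 34 ^ 2), by positivity, ?_⟩
  intro s a b A x hs ha hb haA hbA hx hAx hn
  set n : ℤ := s * (a * b) with hn_def
  have hn0 : n ≠ 0 := by
    rintro h
    exact hn (h ▸ ⟨0, rfl⟩)
  have hnabs : n.natAbs = a * b := by
    rw [hn_def, Int.natAbs_mul, hs, one_mul, Int.natAbs_mul, Int.natAbs_natCast,
      Int.natAbs_natCast]
  have hA : 1 ≤ A := ha.trans_le haA
  set z := Nat.sqrt A + 1 with hz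
  set L := Real.log (A + 1) with hL
  -- `w` exceeds the square of the conductor `4 a b` and is bounded by a power of `A`
  set w := 16 * (A + 1) ^ 4 with hw
  have hA1 : (1 : ℝ) ≤ A := by exact_mod_cast hA
  have hx2 : (2 : ℝ) ≤ x := by exact_mod_cast hx
  have hlog2 := Real.log_two_gt_d9
  have hlog2' := Real.log_two_lt_d9
  have hL2 : Real.log 2 ≤ L := Real.log_le_log two_pos (by linarith)
  have hlx2 : Real.log 2 ≤ Real.log x := Real.log_le_log two_pos hx2
  have hlw : Real.log w = 4 * Real.log 2 + 4 * L := by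
    rw [hw]
    push_cast
    rw [Real.log_mul (by norm_num) (by positivity), Real.log_pow,
      show (16 : ℝ) = 2 ^ 4 by norm_num, Real.log_pow]
    push_cast
    rw [hL]
  have hLx : L ≤ 3 * Real.log x := by
    have h1 : (A : ℝ) + 1 ≤ 2 * (x : ℝ) ^ 2 := by
      have : (A : ℝ) ≤ (x : ℝ) ^ 2 := by exact_mod_cast hAx
      nlinarith
    have h2 := Real.log_le_log (by linarith) h1
    rw [Real.log_mul two_ne_zero (by positivity), Real.log_pow] at h2
    push_cast at h2
    linarith
  have hF0 : ∀ y, 0 ≤ normSum n y := fun y => partialSum_nonneg (normFn_nonneg n) y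
  have step1 : normSum n (w * w) ≤ 16 * 34 ^ 2 * normSum n z := by
    have hzw : z ≤ w * w := by
      have h1 : Nat.sqrt A ≤ A := Nat.sqrt_le_self A
      have h2 : A + 1 ≤ (A + 1) ^ 4 := Nat.le_self_pow (by norm_num) _
      have h3 : w ≤ w * w := Nat.le_mul_self w
      omega
    have h1 := normSum_mul_sq_le n hzw (Nat.sqrt_le z)
    have h2 : L ≤ 4 * harmonicSum (Nat.sqrt z) := by
      have h3 : A + 1 ≤ (Nat.sqrt z + 1) ^ 4 := by
        have h4 : A + 1 ≤ z ^ 2 := by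
          have := Nat.lt_succ_sqrt A
          rw [sq]
          exact this
        have h5 : z ≤ (Nat.sqrt z + 1) ^ 2 := by
          have := (Nat.lt_succ_sqrt z).le
          rw [sq]
          exact this
        calc A + 1 ≤ z ^ 2 := h4
          _ ≤ ((Nat.sqrt z + 1) ^ 2) ^ 2 := Nat.pow_le_pow_left h5 2
          _ = _ := by ring
      have h6 : ((A : ℝ) + 1) ≤ ((Nat.sqrt z : ℝ) + 1) ^ 4 := by exact_mod_cast h3
      have h7 := Real.log_le_log (by linarith) h6
      rw [Real.log_pow] at h7
      have h8 := le_harmonicSum (Nat.sqrt z)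
      push_cast at h7
      linarith
    have h3 : harmonicSum (w * w * (w * w)) ≤ 34 * L := by
      have h4 := harmonicSum_le (w * w * (w * w))
      have hw0 : (w : ℝ) ≠ 0 := by rw [hw]; positivity
      have h5 : Real.log ((w * w * (w * w) : ℕ) : ℝ) = 4 * Real.log w := by
        push_cast
        rw [Real.log_mul (by positivity) (by positivity), Real.log_mul hw0 hw0]
        ring
      rw [h5, hlw] at h4
      linarith
    have hL0 : 0 < L := by linarith
    have h4 : normSum n (w * w) * (L / 4) ^ 2 ≤ normSum n z * (34 * L) ^ 2 := by
      refine le_trans ?_ (h1.trans ?_)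
      · refine mul_le_mul_of_nonneg_left ?_ (hF0 _)
        exact pow_le_pow_left₀ (by positivity) (by linarith) 2
      · refine mul_le_mul_of_nonneg_left ?_ (hF0 _)
        exact pow_le_pow_left₀ (harmonicSum_nonneg _) h3 2
    have h5 : normSum n (w * w) * L ^ 2 ≤ 16 * 34 ^ 2 * normSum n z * L ^ 2 := by
      linarith
    exact le_of_mul_le_mul_right h5 (by positivity)
  have step2 : normSum n (x * x) * L ≤ 17 * 24 * Real.log x * normSum n (w * w) := by
    have hw1 : L ≤ Real.log w := by rw [hlw]; linarith
    have hlxx : Real.log ((x * x : ℕ) : ℝ) = 2 * Real.log x := by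
      push_cast
      rw [Real.log_mul (by positivity) (by positivity)]
      ring
    rcases le_total w (x * x) with h | h
    · have hqw : (4 * n.natAbs) ^ 2 ≤ w := by
        rw [hnabs, hw]
        have h1 : a * b ≤ (A + 1) * (A + 1) := Nat.mul_le_mul (by omega) (by omega)
        calc (4 * (a * b)) ^ 2 ≤ (4 * ((A + 1) * (A + 1))) ^ 2 := by gcongr
          _ = _ := by ring
      have hw2 : 2 ≤ w := by
        have : 1 ≤ (A + 1) ^ 4 := Nat.one_le_pow _ _ (by omega)
        omega
      have h1 := normSum_le_mul_log hn hw2 hqw h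
      rw [hlxx] at h1
      have h2 : normSum n (x * x) * L ≤ normSum n (x * x) * Real.log w :=
        mul_le_mul_of_nonneg_left hw1 (hF0 _)
      have h3 : 0 ≤ Real.log x * normSum n (w * w) := mul_nonneg (by linarith) (hF0 _)
      linarith
    · have h1 := normSum_mono n (h.trans (Nat.le_mul_self w))
      have h2 : normSum n (x * x) * L ≤ normSum n (w * w) * (3 * Real.log x) :=
        mul_le_mul h1 hLx (by linarith) (hF0 _)
      have h3 : 0 ≤ Real.log x * normSum n (w * w) := mul_nonneg (by linarith) (hF0 _)
      linarith
  have step3 : (normCount n x * Real.log x) ^ 2 ≤ C ^ 2 * (x : ℝ) ^ 2 *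
      (9 / 4 * (divisorSum a ^ 2 * divisorSum b ^ 2)) * normSum n (x * x) := by
    have h1 := hcount n x
    have h2 : divisorSum (2 * n.natAbs) ≤ 3 / 2 * (divisorSum a * divisorSum b) := by
      rw [hnabs]
      refine (divisorSum_mul_le 2 (a * b)).trans ?_
      have h3 : divisorSum 2 = 3 / 2 := by
        rw [divisorSum, Nat.Prime.divisors Nat.prime_two, Finset.sum_pair (by norm_num)]
        norm_num
      rw [h3]
      gcongr
      exact divisorSum_mul_le a b
    have h4 : divisorSum (2 * n.natAbs) ^ 2 ≤ 9 / 4 * (divisorSum a ^ 2 * divisorSum b ^ 2) := by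
      calc _ ≤ (3 / 2 * (divisorSum a * divisorSum b)) ^ 2 :=
            pow_le_pow_left₀ (divisorSum_nonneg _) h2 2
        _ = _ := by ring
    calc (normCount n x * Real.log x) ^ 2 ≤ (C * (x * splitSum n x)) ^ 2 :=
          pow_le_pow_left₀ (mul_nonneg (Nat.cast_nonneg _) (by linarith)) h1 2
      _ = C ^ 2 * (x : ℝ) ^ 2 * splitSum n x ^ 2 := by ring
      _ ≤ C ^ 2 * (x : ℝ) ^ 2 * (9 / 4 * (divisorSum a ^ 2 * divisorSum b ^ 2) *
          normSum n (x * x)) := by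
          refine mul_le_mul_of_nonneg_left ((splitSum_sq_le n hn0 x).trans ?_) (by positivity)
          exact mul_le_mul_of_nonneg_right h4 (hF0 _)
      _ = _ := by ring
  -- combine: the count is bounded by `normSum` at `x²`, this by `normSum` at `w²`, and this by
  -- `normSum` at `√A`
  have hlx0 : 0 < Real.log x := by linarith
  refine le_of_mul_le_mul_right ?_ hlx0
  set P := divisorSum a ^ 2 * divisorSum b ^ 2
  have hP : 0 ≤ P := by positivity
  calc (normCount n x : ℝ) ^ 2 * (Real.log x * L) * Real.log x
      = (normCount n x * Real.log x) ^ 2 * L := by ring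
    _ ≤ C ^ 2 * (x : ℝ) ^ 2 * (9 / 4 * P) * normSum n (x * x) * L :=
        mul_le_mul_of_nonneg_right step3 (by linarith)
    _ = C ^ 2 * (x : ℝ) ^ 2 * (9 / 4 * P) * (normSum n (x * x) * L) := by ring
    _ ≤ C ^ 2 * (x : ℝ) ^ 2 * (9 / 4 * P) * (17 * 24 * Real.log x * normSum n (w * w)) := by
        gcongr
    _ ≤ C ^ 2 * (x : ℝ) ^ 2 * (9 / 4 * P) *
        (17 * 24 * Real.log x * (16 * 34 ^ 2 * normSum n z)) := by
        gcongr
    _ = _ := by ring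

/-! ### Counting the locally soluble tuples -/

theorem isNormLike_natAbs {n c : ℤ} : IsNormLike n c.natAbs ↔ IsNormLike n c := by
  simp only [IsNormLike, padicValInt, Int.natAbs_natCast]

theorem isNormLike_one_right (n : ℤ) : IsNormLike n 1 := by
  intro p _ h
  simp at h

theorem normCount_le (n : ℤ) (x : ℕ) : normCount n x ≤ x := by
  classical
  refine (Finset.card_filter_le _ _).trans ?_
  simp

open Classical in
/-- The factor `3` accounts for the signs and for `c = 0`, as `normCount` is at least one. -/
theorem card_filter_isNormLike_le (n : ℤ) {M : ℕ} (hM : 0 < M) :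
    ((Finset.Icc (-M : ℤ) M).filter (IsNormLike n)).card ≤ 3 * normCount n M := by
  set E := (Finset.Ioc 0 M).filter fun c : ℕ => IsNormLike n c
  have hE : E.card = normCount n M := rfl
  have h1 : 1 ≤ E.card := by
    refine Finset.card_pos.mpr ⟨1, ?_⟩
    rw [Finset.mem_filter, Finset.mem_Ioc]
    exact ⟨⟨one_pos, hM⟩, by exact_mod_cast isNormLike_one_right n⟩
  have hsub : (Finset.Icc (-M : ℤ) M).filter (IsNormLike n) ⊆
      {0} ∪ (E.image (fun c : ℕ => (c : ℤ)) ∪ E.image (fun c : ℕ => -(c : ℤ))) := by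
    intro c hc
    rw [Finset.mem_filter, Finset.mem_Icc] at hc
    rcases eq_or_ne c 0 with rfl | h0
    · simp
    have hmem : c.natAbs ∈ E := by
      rw [Finset.mem_filter, Finset.mem_Ioc]
      exact ⟨by omega, isNormLike_natAbs.mpr hc.2⟩
    rw [Finset.mem_union, Finset.mem_union, Finset.mem_image, Finset.mem_image]
    rcases le_total 0 c with h | h
    · exact Or.inr (Or.inl ⟨_, hmem, by omega⟩)
    · exact Or.inr (Or.inr ⟨_, hmem, by omega⟩)
  have h2 := (Finset.card_le_card hsub).trans (Finset.card_union_le _ _)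
  have h3 := Finset.card_union_le (E.image (fun c : ℕ => (c : ℤ))) (E.image (fun c : ℕ => -(c : ℤ)))
  have h4 := Finset.card_image_le (s := E) (f := fun c : ℕ => (c : ℤ))
  have h5 := Finset.card_image_le (s := E) (f := fun c : ℕ => -(c : ℤ))
  rw [Finset.card_singleton] at h2
  omega

/-- The sum of squares of counts over the pairs `(a, b)` in a box whose product is not a square
up to the sign `s`. -/
theorem exists_sum_normCount_sq_le_of_not_isSquare : ∃ C : ℝ, 0 < C ∧ ∀ (s : ℤ) (R T : ℕ),
    s.natAbs = 1 → 2 ≤ R → R ^ 2 ≤ T →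
    ∑ x ∈ (Finset.Ioc 0 R ×ˢ Finset.Ioc 0 R).filter
      (fun x : ℕ × ℕ => ¬ IsSquare (s * (x.1 * x.2) : ℤ)),
        (normCount (s * (x.1 * x.2)) (T / max x.1 x.2) : ℝ) ^ 2 ≤ C * (T : ℝ) ^ 2 := by
  obtain ⟨C₁, hC₁, hcount⟩ := exists_normCount_sq_le
  obtain ⟨C₂, hC₂, hsum⟩ := exists_sum_normSum_le
  refine ⟨24 * (C₁ * C₂), by positivity, fun s R T hs hR hRT => ?_⟩
  have hR0 : (2 : ℝ) ≤ R := by exact_mod_cast hR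
  have hlog2 := Real.log_two_gt_d9
  have hlogR : Real.log 2 ≤ Real.log R := Real.log_le_log two_pos hR0
  have hlogR0 : 0 < Real.log R := by linarith
  set S := (Finset.Ioc 0 R ×ˢ Finset.Ioc 0 R).filter
      (fun x : ℕ × ℕ => ¬ IsSquare (s * (x.1 * x.2) : ℤ)) with hS
  set g : ℕ × ℕ → ℝ := fun x => (normCount (s * (x.1 * x.2)) (T / max x.1 x.2) : ℝ) ^ 2
  have hmaps : ∀ x ∈ S, Nat.log 2 (max x.1 x.2) ∈ Finset.range (Nat.log 2 R + 1) := by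
    intro x hx
    simp only [hS, Finset.mem_filter, Finset.mem_product, Finset.mem_Ioc] at hx
    rw [Finset.mem_range, Nat.lt_succ_iff]
    exact Nat.log_mono_right (max_le hx.1.1.2 hx.1.2.2)
  rw [← Finset.sum_fiberwise_of_maps_to hmaps]
  have hblock : ∀ j ∈ Finset.range (Nat.log 2 R + 1),
      ∑ x ∈ S with Nat.log 2 (max x.1 x.2) = j, g x ≤
        8 * (C₁ * C₂) * (T : ℝ) ^ 2 / Real.log R := by
    intro j hj
    -- the pairs with `A / 2 ≤ max(a, b) < A`
    set A := 2 ^ (j + 1) with hA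
    have hA2 : 2 ≤ A := by rw [hA, pow_succ]; have := Nat.one_le_two_pow (n := j); omega
    have hA2' : (2 : ℝ) ≤ A := by exact_mod_cast hA2
    set z := Nat.sqrt A + 1
    set K := C₁ * ((2 * T / A : ℝ) ^ 2) / (Real.log R * Real.log (A + 1))
    have hlogA : 1 ≤ Real.log (A + 1) := by
      rw [Real.le_log_iff_exp_le (by positivity)]
      have := Real.exp_one_lt_d9
      linarith
    have hK : 0 ≤ K := by positivity
    have hterm : ∀ x ∈ S.filter (fun x => Nat.log 2 (max x.1 x.2) = j),
        x ∈ Finset.Ioc 0 A ×ˢ Finset.Ioc 0 A ∧ g x ≤ K * (divisorSum x.1 ^ 2 * divisorSum x.2 ^ 2 *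
          normSum (s * (x.1 * x.2)) z) := by
      rintro ⟨a, b⟩ hx
      simp only [hS, Finset.mem_filter, Finset.mem_product, Finset.mem_Ioc] at hx
      obtain ⟨⟨⟨⟨ha0, haR⟩, hb0, hbR⟩, hsq⟩, hj⟩ := hx
      have hm0 : max a b ≠ 0 := by omega
      have hlt : max a b < A := by rw [hA, ← hj]; exact Nat.lt_pow_succ_log_self one_lt_two _
      have hle : 2 ^ j ≤ max a b := by rw [← hj]; exact Nat.pow_log_le_self 2 hm0
      have hA2m : A ≤ 2 * max a b := by rw [hA, pow_succ]; omega
      have haA : a ≤ A := (le_max_left a b).trans hlt.le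
      have hbA : b ≤ A := (le_max_right a b).trans hlt.le
      refine ⟨by simp only [Finset.mem_product, Finset.mem_Ioc]; omega, ?_⟩
      set x := T / max a b with hx
      have hmR : max a b ≤ R := max_le haR hbR
      have hRx : R ≤ x := by
        rw [hx, Nat.le_div_iff_mul_le (by omega)]
        calc R * max a b ≤ R * R := Nat.mul_le_mul_left R hmR
          _ = R ^ 2 := (sq R).symm
          _ ≤ T := hRT
      have hAx : A ≤ x ^ 2 := by
        calc A ≤ 2 * R := by omega
          _ ≤ R * R := Nat.mul_le_mul_right R hR
          _ ≤ x * x := Nat.mul_le_mul hRx hRx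
          _ = x ^ 2 := (sq x).symm
      have h1 := hcount s a b A x hs ha0 hb0 haA hbA (hR.trans hRx) hAx hsq
      have hxT : (x : ℝ) ≤ 2 * T / A := by
        rw [le_div_iff₀ (by linarith)]
        have h2 : x * A ≤ 2 * T := by
          calc x * A ≤ x * (2 * max a b) := Nat.mul_le_mul_left x hA2m
            _ = 2 * (T / max a b * max a b) := by rw [hx]; ring
            _ ≤ 2 * T := Nat.mul_le_mul_left 2 (Nat.div_mul_le_self T _)
        exact_mod_cast h2
      have hlogx : Real.log R ≤ Real.log x :=
        Real.log_le_log (by linarith) (by exact_mod_cast hRx)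
      set P := divisorSum a ^ 2 * divisorSum b ^ 2 * normSum (s * (a * b)) z
      have hP : 0 ≤ P := mul_nonneg (by positivity) (partialSum_nonneg (normFn_nonneg _) _)
      change (normCount (s * (a * b)) x : ℝ) ^ 2 ≤ K * P
      rw [show K * P = C₁ * ((2 * T / A : ℝ) ^ 2 * P) / (Real.log R * Real.log (A + 1)) by
        simp only [K]; ring, le_div_iff₀ (by positivity)]
      calc (normCount (s * (a * b)) x : ℝ) ^ 2 * (Real.log R * Real.log (A + 1))
          ≤ (normCount (s * (a * b)) x : ℝ) ^ 2 * (Real.log x * Real.log (A + 1)) := by gcongr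
        _ ≤ C₁ * ((x : ℝ) ^ 2 * P) := h1
        _ ≤ _ := by gcongr
    calc ∑ x ∈ S with Nat.log 2 (max x.1 x.2) = j, g x
        ≤ ∑ x ∈ Finset.Ioc 0 A ×ˢ Finset.Ioc 0 A, K * (divisorSum x.1 ^ 2 * divisorSum x.2 ^ 2 *
          normSum (s * (x.1 * x.2)) z) := by
          refine (Finset.sum_le_sum fun x hx => (hterm x hx).2).trans ?_
          refine Finset.sum_le_sum_of_subset_of_nonneg (fun x hx => (hterm x hx).1) fun x _ _ => ?_
          exact mul_nonneg hK (mul_nonneg (by positivity) (partialSum_nonneg (normFn_nonneg _) _))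
      _ = K * ∑ a ∈ Finset.Ioc 0 A, ∑ b ∈ Finset.Ioc 0 A,
          divisorSum a ^ 2 * divisorSum b ^ 2 * normSum (s * (a * b)) z := by
          rw [← Finset.mul_sum, Finset.sum_product]
      _ ≤ K * (C₂ * ((A : ℝ) ^ 2 * harmonicSum z)) := by
          refine mul_le_mul_of_nonneg_left (hsum s A z ?_) hK
          have h1 : 1 ≤ Nat.sqrt A := Nat.sqrt_pos.mpr (by omega)
          have h2 := Nat.sqrt_le' A
          calc z ^ 2 ≤ (2 * Nat.sqrt A) ^ 2 := Nat.pow_le_pow_left (by omega) 2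
            _ = 4 * Nat.sqrt A ^ 2 := by ring
            _ ≤ 4 * A := Nat.mul_le_mul_left 4 h2
      _ ≤ K * (C₂ * ((A : ℝ) ^ 2 * (2 * Real.log (A + 1)))) := by
          have h1 := harmonicSum_le z
          have h2 : Real.log z ≤ Real.log (A + 1) := by
            refine Real.log_le_log (by simp only [z]; positivity) ?_
            have : z ≤ A + 1 := Nat.succ_le_succ (Nat.sqrt_le_self A)
            exact_mod_cast this
          gcongr
          linarith
      _ = 8 * (C₁ * C₂) * (T : ℝ) ^ 2 / Real.log R := by
          simp only [K]
          have : Real.log ((A : ℝ) + 1) ≠ 0 := by positivity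
          have : (A : ℝ) ≠ 0 := by positivity
          field_simp
          ring
  refine (Finset.sum_le_sum hblock).trans ?_
  rw [Finset.sum_const, Finset.card_range, nsmul_eq_mul, mul_div_assoc', div_le_iff₀ hlogR0]
  have hnum : ((Nat.log 2 R + 1 : ℕ) : ℝ) ≤ 3 * Real.log R := by
    have h1 : ((2 ^ Nat.log 2 R : ℕ) : ℝ) ≤ R := by
      exact_mod_cast Nat.pow_log_le_self 2 (by omega)
    have h2 := Real.log_le_log (by positivity) h1
    push_cast at h2 ⊢
    rw [Real.log_pow] at h2
    nlinarith [Nat.cast_nonneg (α := ℝ) (Nat.log 2 R)]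
  have hT : 0 ≤ 8 * (C₁ * C₂) * (T : ℝ) ^ 2 := by positivity
  nlinarith

theorem isSquare_of_coprime_mul {a b : ℕ} (h : a.Coprime b) (hsq : IsSquare (a * b)) :
    IsSquare a := by
  obtain ⟨c, hc⟩ := hsq
  obtain ⟨d, hd⟩ := exists_associated_pow_of_mul_eq_pow
    (Nat.isUnit_iff.mpr h : IsUnit (gcd a b)) (hc.trans (sq c).symm)
  exact ⟨d, by rw [← sq]; exact (associated_iff_eq.mp hd).symm⟩

/-- If the product of coprime `a` and `b` is a square up to sign, then so are `a` and `b`, and the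
trivial bound gives the convergent sum of `1 / (a b)` over squares. -/
theorem exists_sum_normCount_sq_le : ∃ C : ℝ, 0 < C ∧ ∀ (s : ℤ) (R T : ℕ),
    s.natAbs = 1 → R ^ 2 ≤ T →
    ∑ x ∈ (Finset.Ioc 0 R ×ˢ Finset.Ioc 0 R).filter (fun x : ℕ × ℕ => x.1.Coprime x.2),
        (normCount (s * (x.1 * x.2)) (T / max x.1 x.2) : ℝ) ^ 2 ≤ C * (T : ℝ) ^ 2 := by
  obtain ⟨C₁, hC₁, hnsq⟩ := exists_sum_normCount_sq_le_of_not_isSquare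
  obtain ⟨C₂, hC₂, hsq⟩ := exists_sum_isSquare_inv_le
  refine ⟨C₁ + 1 + C₂ ^ 2, by positivity, fun s R T hs hRT => ?_⟩
  set S := (Finset.Ioc 0 R ×ˢ Finset.Ioc 0 R).filter (fun x : ℕ × ℕ => x.1.Coprime x.2)
  set g : ℕ × ℕ → ℝ := fun x => (normCount (s * (x.1 * x.2)) (T / max x.1 x.2) : ℝ) ^ 2
  have hg0 : ∀ x, 0 ≤ g x := fun x => sq_nonneg _
  have hgT : ∀ x, g x ≤ ((T : ℝ) / (max x.1 x.2 : ℕ)) ^ 2 := by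
    intro x
    refine pow_le_pow_left₀ (Nat.cast_nonneg _) ?_ 2
    exact (Nat.cast_le.mpr (normCount_le _ _)).trans Nat.cast_div_le
  have hT0 : (0 : ℝ) ≤ (T : ℝ) ^ 2 := by positivity
  rw [← Finset.sum_filter_not_add_sum_filter S (fun x : ℕ × ℕ => IsSquare (s * (x.1 * x.2) : ℤ))]
  have h1 : ∑ x ∈ S with ¬ IsSquare (s * (x.1 * x.2) : ℤ), g x ≤ (C₁ + 1) * (T : ℝ) ^ 2 := by
    -- for `R = 1` there is only the pair `(1, 1)`
    rcases lt_or_ge R 2 with hR | hR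
    · have hsub : S.filter (fun x : ℕ × ℕ => ¬ IsSquare (s * (x.1 * x.2) : ℤ)) ⊆
          {((1 : ℕ), (1 : ℕ))} := by
        rintro ⟨a, b⟩ hx
        simp only [S, Finset.mem_filter, Finset.mem_product, Finset.mem_Ioc] at hx
        rw [Finset.mem_singleton, Prod.mk.injEq]
        omega
      refine (Finset.sum_le_sum_of_subset_of_nonneg hsub fun x _ _ => hg0 x).trans ?_
      rw [Finset.sum_singleton]
      have := hgT (1, 1)
      rw [max_self, Nat.cast_one, div_one] at this
      nlinarith
    · refine le_trans (Finset.sum_le_sum_of_subset_of_nonneg ?_ fun x _ _ => hg0 x)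
        ((hnsq s R T hs hR hRT).trans ?_)
      · exact Finset.filter_subset_filter _ (Finset.filter_subset _ _)
      · nlinarith
  have h2 : ∑ x ∈ S with IsSquare (s * (x.1 * x.2) : ℤ), g x ≤ C₂ ^ 2 * (T : ℝ) ^ 2 := by
    have hterm : ∀ x ∈ S.filter (fun x : ℕ × ℕ => IsSquare (s * (x.1 * x.2) : ℤ)),
        x ∈ (Finset.Ioc 0 R).filter IsSquare ×ˢ (Finset.Ioc 0 R).filter IsSquare ∧
          g x ≤ (T : ℝ) ^ 2 * (1 / x.1 * (1 / x.2)) := by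
      rintro ⟨a, b⟩ hx
      simp only [S, Finset.mem_filter, Finset.mem_product, Finset.mem_Ioc] at hx
      obtain ⟨⟨⟨⟨ha0, haR⟩, hb0, hbR⟩, hcop⟩, hsq⟩ := hx
      have hsq' : IsSquare (a * b) := by
        obtain ⟨r, hr⟩ := hsq
        refine ⟨r.natAbs, ?_⟩
        have := congrArg Int.natAbs hr
        rwa [Int.natAbs_mul, hs, one_mul, Int.natAbs_mul, Int.natAbs_mul, Int.natAbs_natCast,
          Int.natAbs_natCast] at this
      have hasq := isSquare_of_coprime_mul hcop hsq'
      have hbsq := isSquare_of_coprime_mul hcop.symm (mul_comm a b ▸ hsq')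
      refine ⟨by simp only [Finset.mem_product, Finset.mem_filter, Finset.mem_Ioc]; tauto, ?_⟩
      refine (hgT (a, b)).trans ?_
      have ha1 : (0 : ℝ) < a := by exact_mod_cast ha0
      have hb1 : (0 : ℝ) < b := by exact_mod_cast hb0
      rw [div_pow, div_mul_div_comm, one_mul, ← div_eq_mul_one_div]
      refine div_le_div_of_nonneg_left hT0 (by positivity) ?_
      rw [sq]
      exact mul_le_mul (Nat.cast_le.mpr (le_max_left a b)) (Nat.cast_le.mpr (le_max_right a b))
        hb1.le (Nat.cast_nonneg _)
    refine (Finset.sum_le_sum fun x hx => (hterm x hx).2).trans ?_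
    refine (Finset.sum_le_sum_of_subset_of_nonneg (fun x hx => (hterm x hx).1)
      fun x _ _ => by positivity).trans ?_
    rw [← Finset.mul_sum, Finset.sum_product]
    dsimp only
    rw [← Finset.sum_mul_sum, mul_comm, ← sq]
    have h0 : 0 ≤ ∑ v ∈ (Finset.Ioc 0 R).filter IsSquare, 1 / (v : ℝ) :=
      Finset.sum_nonneg fun _ _ => by positivity
    exact mul_le_mul_of_nonneg_right (pow_le_pow_left₀ h0 (hsq R) 2) hT0
  linarith

/-! ### The upper bound for the number of tuples -/

open Classical in
/-- The quadruples of integers `((a, b), (c, d))` that parametrise (four to one) the points of `Y`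
of height at most `T ^ 2` whose fibres have points over every `ℚ_p`. -/
def solubleTuples (T : ℕ) : Finset ((ℤ × ℤ) × ℤ × ℤ) :=
  ((Finset.Icc (-T : ℤ) T ×ˢ Finset.Icc (-T : ℤ) T) ×ˢ
    (Finset.Icc (-T : ℤ) T ×ˢ Finset.Icc (-T : ℤ) T)).filter fun t =>
      IsCoprime t.1.1 t.1.2 ∧ IsCoprime t.2.1 t.2.2 ∧ IsPadicSoluble t.1.1 t.1.2 t.2.1 t.2.2 ∧
        max t.1.1.natAbs t.1.2.natAbs * max t.2.1.natAbs t.2.2.natAbs ≤ T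

theorem max_natAbs_pos {a b : ℤ} (h : IsCoprime a b) : 0 < max a.natAbs b.natAbs := by
  rcases eq_or_ne a 0 with rfl | ha
  · rw [isCoprime_zero_left, Int.isUnit_iff] at h
    omega
  · exact lt_max_of_lt_left (Int.natAbs_pos.mpr ha)

theorem mem_solubleTuples {T : ℕ} {t : (ℤ × ℤ) × ℤ × ℤ} : t ∈ solubleTuples T ↔
    IsCoprime t.1.1 t.1.2 ∧ IsCoprime t.2.1 t.2.2 ∧ IsPadicSoluble t.1.1 t.1.2 t.2.1 t.2.2 ∧
      max t.1.1.natAbs t.1.2.natAbs * max t.2.1.natAbs t.2.2.natAbs ≤ T := by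
  simp only [solubleTuples, Finset.mem_filter, Finset.mem_product, Finset.mem_Icc,
    and_iff_right_iff_imp]
  rintro ⟨h1, h2, -, h⟩
  have h3 := Nat.le_mul_of_pos_right (max t.1.1.natAbs t.1.2.natAbs) (max_natAbs_pos h2)
  have h4 := Nat.le_mul_of_pos_left (max t.2.1.natAbs t.2.2.natAbs) (max_natAbs_pos h1)
  omega

/-- For fixed `(a, b)`, both `c` and `d` are counted by `normCount` for `n = -ab`. -/
theorem card_filter_solubleTuples_fst_le {T : ℕ} {x : ℤ × ℤ} (hx : IsCoprime x.1 x.2)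
    (hT : max x.1.natAbs x.2.natAbs ≤ T) :
    ((solubleTuples T).filter fun t => t.1 = x).card ≤
      9 * normCount (-(x.1 * x.2)) (T / max x.1.natAbs x.2.natAbs) ^ 2 := by
  classical
  set M := T / max x.1.natAbs x.2.natAbs with hM
  have hM0 : 0 < M := Nat.div_pos hT (max_natAbs_pos hx)
  set E := (Finset.Icc (-M : ℤ) M).filter (IsNormLike (-(x.1 * x.2)))
  have hE := card_filter_isNormLike_le (-(x.1 * x.2)) hM0
  calc ((solubleTuples T).filter fun t => t.1 = x).card ≤ (E ×ˢ E).card := by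
        refine Finset.card_le_card_of_injOn Prod.snd ?_ ?_
        · rintro ⟨y, c, d⟩ ht
          rw [Finset.mem_coe, Finset.mem_filter, mem_solubleTuples] at ht
          obtain ⟨⟨-, hcd, hsol, hle⟩, rfl⟩ := ht
          have hle' : max c.natAbs d.natAbs ≤ M := by
            rw [hM, Nat.le_div_iff_mul_le (max_natAbs_pos hx), mul_comm]
            exact hle
          have hc := hsol.isNormLike hcd
          have hd := hsol.swap.isNormLike hcd.symm
          simp only [E, Finset.coe_product, Set.mem_prod, Finset.mem_coe, Finset.mem_filter,
            Finset.mem_Icc]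
          exact ⟨⟨by omega, hc⟩, by omega, hd⟩
        · rintro ⟨y, c, d⟩ ht ⟨y', c', d'⟩ ht' h
          rw [Finset.mem_coe, Finset.mem_filter] at ht ht'
          exact Prod.ext (ht.2.trans ht'.2.symm) h
    _ = E.card * E.card := Finset.card_product _ _
    _ ≤ (3 * normCount (-(x.1 * x.2)) M) * (3 * normCount (-(x.1 * x.2)) M) :=
        Nat.mul_le_mul hE hE
    _ = _ := by ring

/-- The sum over pairs of integers with signs. The pairs with `a b = 0` are `(0, ±1)` and `(±1, 0)`.
-/
theorem exists_sum_int_normCount_sq_le : ∃ C : ℝ, 0 < C ∧ ∀ (R T : ℕ), R ^ 2 ≤ T →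
    ∀ Q : Finset (ℤ × ℤ), (∀ x ∈ Q, IsCoprime x.1 x.2 ∧ max x.1.natAbs x.2.natAbs ≤ R) →
    ∑ x ∈ Q, (normCount (-(x.1 * x.2)) (T / max x.1.natAbs x.2.natAbs) : ℝ) ^ 2 ≤
      C * (T : ℝ) ^ 2 := by
  obtain ⟨C, hC, hmain⟩ := exists_sum_normCount_sq_le
  refine ⟨4 * C + 4, by positivity, fun R T hRT Q hQ => ?_⟩
  have hT0 : (0 : ℝ) ≤ (T : ℝ) ^ 2 := by positivity
  rw [← Finset.sum_filter_not_add_sum_filter Q (fun x : ℤ × ℤ => x.1 * x.2 = 0)]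
  have h1 : ∑ x ∈ Q with x.1 * x.2 = 0,
      (normCount (-(x.1 * x.2)) (T / max x.1.natAbs x.2.natAbs) : ℝ) ^ 2 ≤ 4 * (T : ℝ) ^ 2 := by
    have hsub : Q.filter (fun x : ℤ × ℤ => x.1 * x.2 = 0) ⊆ {(0, 1), (0, -1), (1, 0), (-1, 0)} := by
      rintro ⟨a, b⟩ hx
      obtain ⟨hx, h0⟩ := Finset.mem_filter.mp hx
      have hcop := (hQ _ hx).1
      simp only [Finset.mem_insert, Finset.mem_singleton, Prod.mk.injEq]
      rcases mul_eq_zero.mp h0 with h | h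
      · dsimp only at h hcop
        rw [h, isCoprime_zero_left, Int.isUnit_iff] at hcop
        omega
      · dsimp only at h hcop
        rw [h, isCoprime_zero_right, Int.isUnit_iff] at hcop
        omega
    have hcard : ((Q.filter (fun x : ℤ × ℤ => x.1 * x.2 = 0)).card : ℝ) ≤ 4 := by
      exact_mod_cast (Finset.card_le_card hsub).trans Finset.card_le_four
    refine (Finset.sum_le_card_nsmul _ _ ((T : ℝ) ^ 2) fun x _ => ?_).trans ?_
    · refine pow_le_pow_left₀ (Nat.cast_nonneg _) (Nat.cast_le.mpr ?_) 2
      exact (normCount_le _ _).trans (Nat.div_le_self _ _)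
    · rw [nsmul_eq_mul]
      gcongr
  have h2 : ∑ x ∈ Q with ¬ x.1 * x.2 = 0,
      (normCount (-(x.1 * x.2)) (T / max x.1.natAbs x.2.natAbs) : ℝ) ^ 2 ≤
        4 * C * (T : ℝ) ^ 2 := by
    set U : Finset (ℤ × ℤ) := {1, -1} ×ˢ {1, -1}
    set S := (Finset.Ioc 0 R ×ˢ Finset.Ioc 0 R).filter (fun x : ℕ × ℕ => x.1.Coprime x.2)
    refine (sum_le_sum_of_injOn (t := U ×ˢ S)
      (g := fun y : (ℤ × ℤ) × ℕ × ℕ => (normCount (-(y.1.1 * y.1.2) * (y.2.1 * y.2.2))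
        (T / max y.2.1 y.2.2) : ℝ) ^ 2)
      (fun x => ((x.1.sign, x.2.sign), (x.1.natAbs, x.2.natAbs))) ?_ ?_ ?_
      fun _ _ => sq_nonneg _).trans ?_
    · rintro ⟨a, b⟩ hx
      obtain ⟨hx, h0⟩ := Finset.mem_filter.mp hx
      obtain ⟨hcop, hle⟩ := hQ _ hx
      obtain ⟨ha, hb⟩ := mul_ne_zero_iff.mp h0
      dsimp only at ha hb hcop hle
      simp only [U, S, Finset.mem_product, Finset.mem_filter, Finset.mem_insert,
        Finset.mem_singleton, Finset.mem_Ioc]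
      refine ⟨⟨?_, ?_⟩, ⟨⟨?_, ?_⟩, ?_⟩⟩
      · rcases lt_or_gt_of_ne ha with h | h
        · exact Or.inr (Int.sign_eq_neg_one_of_neg h)
        · exact Or.inl (Int.sign_eq_one_of_pos h)
      · rcases lt_or_gt_of_ne hb with h | h
        · exact Or.inr (Int.sign_eq_neg_one_of_neg h)
        · exact Or.inl (Int.sign_eq_one_of_pos h)
      · omega
      · omega
      · exact Int.isCoprime_iff_gcd_eq_one.mp hcop
    · rintro ⟨a, b⟩ - ⟨a', b'⟩ - h
      simp only [Prod.mk.injEq] at h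
      obtain ⟨⟨h1, h2⟩, h3, h4⟩ := h
      rw [← Int.sign_mul_natAbs a, ← Int.sign_mul_natAbs b, h1, h2, h3, h4, Int.sign_mul_natAbs,
        Int.sign_mul_natAbs]
    · rintro ⟨a, b⟩ -
      dsimp only
      have e : -(a.sign * b.sign) * ((a.natAbs : ℤ) * (b.natAbs : ℤ)) = -(a * b) := by
        conv_rhs => rw [← Int.sign_mul_natAbs a, ← Int.sign_mul_natAbs b]
        ring
      rw [e]
    · rw [Finset.sum_product]
      have hU : U.card = 4 := by decide
      refine (Finset.sum_le_card_nsmul U _ (C * (T : ℝ) ^ 2) ?_).trans ?_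
      · rintro ⟨e₁, e₂⟩ he
        refine hmain (-(e₁ * e₂)) R T ?_ hRT
        simp only [U, Finset.mem_product, Finset.mem_insert, Finset.mem_singleton] at he
        rcases he with ⟨rfl | rfl, rfl | rfl⟩ <;> norm_num
      · rw [hU, nsmul_eq_mul]
        push_cast
        linarith
  linarith

/-- By symmetry one counts the tuples with `max(|a|, |b|) ≤ √T` only. -/
theorem exists_card_solubleTuples_le : ∃ C : ℝ, 0 < C ∧ ∀ T : ℕ,
    ((solubleTuples T).card : ℝ) ≤ C * (T : ℝ) ^ 2 := by
  classical
  obtain ⟨C, hC, hmain⟩ := exists_sum_int_normCount_sq_le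
  refine ⟨2 * (9 * C), by positivity, fun T => ?_⟩
  set R := Nat.sqrt T
  have hRT : R ^ 2 ≤ T := Nat.sqrt_le' T
  set L := (solubleTuples T).filter fun t => max t.1.1.natAbs t.1.2.natAbs ≤ R
  have hsub : solubleTuples T ⊆ L ∪ L.image Prod.swap := by
    rintro ⟨⟨a, b⟩, c, d⟩ ht
    have ht' := mem_solubleTuples.mp ht
    obtain ⟨hab, hcd, hsol, hle⟩ := ht'
    dsimp only at hab hcd hsol hle
    rw [Finset.mem_union, Finset.mem_image]
    rcases le_total (max a.natAbs b.natAbs) (max c.natAbs d.natAbs) with h | h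
    · left
      refine Finset.mem_filter.mpr ⟨ht, Nat.le_sqrt.mpr ?_⟩
      exact (Nat.mul_le_mul_left _ h).trans hle
    · right
      refine ⟨((c, d), (a, b)), Finset.mem_filter.mpr ⟨mem_solubleTuples.mpr
        ⟨hcd, hab, hsol.symm, by rwa [mul_comm]⟩, Nat.le_sqrt.mpr ?_⟩, rfl⟩
      exact (Nat.mul_le_mul_right _ h).trans hle
  have h1 : (solubleTuples T).card ≤ 2 * L.card := by
    have := (Finset.card_le_card hsub).trans (Finset.card_union_le _ _)
    have h2 := Finset.card_image_le (s := L) (f := Prod.swap)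
    omega
  have hQ : ∀ x ∈ L.image Prod.fst, IsCoprime x.1 x.2 ∧ max x.1.natAbs x.2.natAbs ≤ R := by
    intro x hx
    obtain ⟨t, ht, rfl⟩ := Finset.mem_image.mp hx
    obtain ⟨ht, hle⟩ := Finset.mem_filter.mp ht
    exact ⟨(mem_solubleTuples.mp ht).1, hle⟩
  have h2 : (L.card : ℝ) ≤ 9 * ∑ x ∈ L.image Prod.fst,
      (normCount (-(x.1 * x.2)) (T / max x.1.natAbs x.2.natAbs) : ℝ) ^ 2 := by
    rw [Finset.card_eq_sum_card_image Prod.fst L, Finset.mul_sum]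
    push_cast
    refine Finset.sum_le_sum fun x hx => ?_
    obtain ⟨hcop, hle⟩ := hQ x hx
    have h3 := card_filter_solubleTuples_fst_le hcop (hle.trans (Nat.sqrt_le_self T))
    have h4 : (L.filter fun t => t.1 = x).card ≤ ((solubleTuples T).filter fun t => t.1 = x).card :=
      Finset.card_le_card (Finset.filter_subset_filter _ (Finset.filter_subset _ _))
    exact_mod_cast h4.trans h3
  have h3 := hmain R T hRT (L.image Prod.fst) hQ
  have h4 : ((solubleTuples T).card : ℝ) ≤ 2 * L.card := by exact_mod_cast h1
  linarith

/-! ### The count of coprime pairs -/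

theorem sum_one_div_sq_le (T : ℕ) : ∑ d ∈ Finset.Icc 2 T, 1 / (d : ℝ) ^ 2 ≤ 3 / 4 := by
  rcases lt_or_ge T 2 with hT | hT
  · rw [Finset.Icc_eq_empty (by omega), Finset.sum_empty]
    norm_num
  suffices h : ∑ d ∈ Finset.Icc 2 T, 1 / (d : ℝ) ^ 2 ≤ 3 / 4 - 1 / (T : ℝ) by
    have : (0 : ℝ) ≤ 1 / T := by positivity
    linarith
  induction T, hT using Nat.le_induction with
  | base => norm_num
  | succ T hT ih =>
    rw [Finset.sum_Icc_succ_top (by omega)]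
    have hT0 : (0 : ℝ) < T := by exact_mod_cast (by omega : 0 < T)
    have h : 1 / ((T + 1 : ℕ) : ℝ) ^ 2 ≤ 1 / T - 1 / ((T + 1 : ℕ) : ℝ) := by
      push_cast
      rw [div_sub_div _ _ (by positivity) (by positivity), div_le_div_iff₀ (by positivity)
        (by positivity)]
      nlinarith
    linarith

/-- The coprime pairs of positive integers up to `T`. -/
def coprimePairs (T : ℕ) : Finset (ℕ × ℕ) :=
  (Finset.Ioc 0 T ×ˢ Finset.Ioc 0 T).filter fun x => x.1.Coprime x.2

/-- At least a quarter of all pairs are coprime, because `∑ 1 / d² ≤ 3 / 4` over `d ≥ 2`. -/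
theorem sq_le_card_coprimePairs (T : ℕ) : (T : ℝ) ^ 2 ≤ 4 * ((coprimePairs T).card : ℝ) := by
  set S := Finset.Ioc 0 T ×ˢ Finset.Ioc 0 T
  have hsub : S.filter (fun x => ¬ x.1.Coprime x.2) ⊆ (Finset.Icc 2 T).biUnion fun d =>
      ((Finset.Ioc 0 T).filter (d ∣ ·)) ×ˢ ((Finset.Ioc 0 T).filter (d ∣ ·)) := by
    rintro ⟨a, b⟩ hx
    simp only [S, Finset.mem_filter, Finset.mem_product, Finset.mem_Ioc] at hx
    obtain ⟨⟨⟨ha0, haT⟩, hb0, hbT⟩, hcop⟩ := hx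
    have hg0 : 0 < a.gcd b := Nat.gcd_pos_of_pos_left b ha0
    have hgT : a.gcd b ≤ T := (Nat.gcd_le_left b ha0).trans haT
    have hg1 : a.gcd b ≠ 1 := hcop
    simp only [Finset.mem_biUnion, Finset.mem_product, Finset.mem_filter, Finset.mem_Ioc,
      Finset.mem_Icc]
    exact ⟨a.gcd b, by omega, ⟨⟨ha0, haT⟩, Nat.gcd_dvd_left a b⟩, ⟨hb0, hbT⟩, Nat.gcd_dvd_right a b⟩
  have h1 : ((S.filter (fun x => ¬ x.1.Coprime x.2)).card : ℝ) ≤ 3 / 4 * (T : ℝ) ^ 2 := by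
    have h2 := (Finset.card_le_card hsub).trans Finset.card_biUnion_le
    calc ((S.filter (fun x => ¬ x.1.Coprime x.2)).card : ℝ)
        ≤ ∑ d ∈ Finset.Icc 2 T, ((T / d : ℕ) : ℝ) * ((T / d : ℕ) : ℝ) := by
          simp only [Finset.card_product, Nat.Ioc_filter_dvd_card_eq_div] at h2
          exact_mod_cast h2
      _ ≤ ∑ d ∈ Finset.Icc 2 T, (T : ℝ) ^ 2 * (1 / (d : ℝ) ^ 2) := by
          refine Finset.sum_le_sum fun d _ => ?_
          rw [mul_one_div, ← div_pow, sq]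
          exact mul_le_mul Nat.cast_div_le Nat.cast_div_le (Nat.cast_nonneg _) (by positivity)
      _ ≤ (T : ℝ) ^ 2 * (3 / 4) := by
          rw [← Finset.mul_sum]
          exact mul_le_mul_of_nonneg_left (sum_one_div_sq_le T) (by positivity)
      _ = _ := mul_comm _ _
  have h3 := Finset.card_filter_add_card_filter_not (s := S) (fun x => x.1.Coprime x.2)
  have h4 : S.card = T * T := by simp [S]
  have h5 : ((coprimePairs T).card : ℝ) + (S.filter (fun x => ¬ x.1.Coprime x.2)).card =
      (T : ℝ) ^ 2 := by
    rw [sq]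
    exact_mod_cast h3.trans h4
  linarith

/-! ### The bounds for the counting function -/

theorem exists_nloc_le : ∃ C : ℝ, 0 < C ∧ ∀ {X' : Scheme.{0}} (f : X' ⟶ X) (B : ℝ), 0 ≤ B →
    (locSolublePoints (f ≫ X.π) B).Finite ∧ (Nloc (f ≫ X.π) B : ℝ) ≤ C * B := by
  obtain ⟨C, hC, hcard⟩ := exists_card_solubleTuples_le
  refine ⟨C, hC, fun f B hB => ?_⟩
  set T := ⌊√B⌋₊
  have hTB : (T : ℝ) ^ 2 ≤ B := by
    have h1 : (T : ℝ) ≤ √B := Nat.floor_le (Real.sqrt_nonneg B)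
    calc (T : ℝ) ^ 2 ≤ √B ^ 2 := pow_le_pow_left₀ (Nat.cast_nonneg _) h1 2
      _ = B := Real.sq_sqrt hB
  have key : ∀ y : Spec (.of ℚ) ⟶ Y, ∃ t : (ℤ × ℤ) × ℤ × ℤ, y ∈ locSolublePoints (f ≫ X.π) B →
      t ∈ solubleTuples T ∧ ∃ hv, y ≫ Y.ι = P3.point (fun i => ((![t.1.1 * t.2.1, t.1.2 * t.2.2,
        t.1.1 * t.2.2, t.1.2 * t.2.1] i : ℤ) : ℚ)) hv := by
    intro y
    by_cases hy : y ∈ locSolublePoints (f ≫ X.π) B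
    · obtain ⟨a, b, c, d, hab, hcd, hsol, hle, hv⟩ := exists_of_mem_locSolublePoints hy
      refine ⟨((a, b), c, d), fun _ => ⟨mem_solubleTuples.mpr ⟨hab, hcd, hsol, ?_⟩, hv⟩⟩
      refine Nat.le_floor (Real.le_sqrt_of_sq_le ?_)
      exact_mod_cast hle
    · exact ⟨0, fun h => absurd h hy⟩
  choose φ hφ using key
  have hmaps : ∀ y ∈ locSolublePoints (f ≫ X.π) B, φ y ∈ (solubleTuples T : Set _) :=
    fun y hy => (hφ y hy).1
  have hinj : Set.InjOn φ (locSolublePoints (f ≫ X.π) B) := by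
    intro y hy y' hy' h
    obtain ⟨-, hv, e⟩ := hφ y hy
    obtain ⟨-, hv', e'⟩ := hφ y' hy'
    rw [← cancel_mono Y.ι, e, e']
    simp only [h]
  refine ⟨Set.Finite.of_injOn hmaps hinj (Finset.finite_toSet _), ?_⟩
  have h1 := Set.ncard_le_ncard_of_injOn φ hmaps hinj (Finset.finite_toSet _)
  rw [Set.ncard_coe_finset] at h1
  calc (Nloc (f ≫ X.π) B : ℝ) ≤ (solubleTuples T).card := Nat.cast_le.mpr h1
    _ ≤ C * (T : ℝ) ^ 2 := hcard T
    _ ≤ C * B := by gcongr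

theorem le_nloc {X' : Scheme.{0}} {f : X' ⟶ X} (hf : IsDesingularisation f) {B : ℝ} (hB : 1 ≤ B)
    (hfin : (locSolublePoints (f ≫ X.π) B).Finite) : 1 / 16 * B ≤ (Nloc (f ≫ X.π) B : ℝ) := by
  set T := ⌊√B⌋₊
  have hsq : √B ^ 2 = B := Real.sq_sqrt (by linarith)
  have hTB : (T : ℝ) ≤ √B := Nat.floor_le (Real.sqrt_nonneg B)
  have hT1 : 1 ≤ T := Nat.le_floor (by rwa [Nat.cast_one, Real.one_le_sqrt])
  have hBT : B ≤ 4 * (T : ℝ) ^ 2 := by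
    have h1 : √B < T + 1 := Nat.lt_floor_add_one _
    have h2 : (1 : ℝ) ≤ T := by exact_mod_cast hT1
    have h3 := Real.sqrt_nonneg B
    nlinarith
  have key : ∀ x : ℕ × ℕ, ∃ y : Spec (.of ℚ) ⟶ Y, x ∈ coprimePairs T →
      y ∈ locSolublePoints (f ≫ X.π) B ∧ ∃ hv, y ≫ Y.ι =
        P3.point (fun i => ((![(x.1 : ℤ), -(x.2 : ℤ), -(x.1 : ℤ), (x.2 : ℤ)] i : ℤ) : ℚ)) hv := by
    rintro ⟨a, b⟩
    by_cases hx : (a, b) ∈ coprimePairs T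
    · have hx' := hx
      simp only [coprimePairs, Finset.mem_filter, Finset.mem_product, Finset.mem_Ioc] at hx'
      obtain ⟨⟨⟨ha0, haT⟩, hb0, hbT⟩, hcop⟩ := hx'
      have hle : (((max (a : ℤ).natAbs (b : ℤ).natAbs) ^ 2 : ℕ) : ℝ) ≤ B := by
        rw [Int.natAbs_natCast, Int.natAbs_natCast, ← hsq]
        push_cast
        refine pow_le_pow_left₀ (by positivity) (le_trans ?_ hTB) 2
        exact max_le (by exact_mod_cast haT) (by exact_mod_cast hbT)
      obtain ⟨y, hy, hv⟩ := mem_locSolublePoints hf (Int.natCast_pos.mpr ha0)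
        (Int.natCast_pos.mpr hb0) (Nat.isCoprime_iff_coprime.mpr hcop) hle
      exact ⟨y, fun _ => ⟨hy, hv⟩⟩
    · obtain ⟨y, -⟩ := mem_locSolublePoints (B := 1) hf one_pos one_pos isCoprime_one_left
        (by norm_num)
      exact ⟨y, fun h => absurd h hx⟩
  choose ψ hψ using key
  have hinj : Set.InjOn ψ (coprimePairs T : Set (ℕ × ℕ)) := by
    rintro ⟨a, b⟩ hx ⟨a', b'⟩ hx' h
    rw [Finset.mem_coe] at hx hx'
    obtain ⟨-, hv, e⟩ := hψ _ hx
    obtain ⟨-, hv', e'⟩ := hψ _ hx'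
    rw [h, e', P3.point_eq_pt, P3.point_eq_pt] at e
    have hprop := P3.mul_eq_mul_of_pt_eq e 0 3
    simp only [coprimePairs, Finset.mem_filter, Finset.mem_product, Finset.mem_Ioc] at hx hx'
    have hmul : a' * b = a * b' := by
      have h1 : (a' : ℚ) * b = a * b' := by simpa using hprop
      exact_mod_cast h1
    have haa : a = a' := by
      refine Nat.dvd_antisymm ?_ ?_
      · exact hx.2.dvd_of_dvd_mul_right ⟨b', hmul⟩
      · exact hx'.2.dvd_of_dvd_mul_right ⟨b, hmul.symm⟩
    subst haa
    rw [Nat.eq_of_mul_eq_mul_left hx.1.1.1 hmul]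
  have h1 := Set.ncard_le_ncard_of_injOn ψ (fun x hx => (hψ x hx).1) hinj hfin
  rw [Set.ncard_coe_finset] at h1
  have h2 : ((coprimePairs T).card : ℝ) ≤ Nloc (f ≫ X.π) B := Nat.cast_le.mpr h1
  have h3 := sq_le_card_coprimePairs T
  linarith

end QuadricFamily

end

theorem theorem1p1 :
    ∃ c C : ℝ, 0 < c ∧ 0 < C ∧
      ∀ (X' : Scheme.{0}) (f : X' ⟶ QuadricFamily.X), QuadricFamily.IsDesingularisation f →
        ∀ B : ℝ, 1 ≤ B →
          (QuadricFamily.locSolublePoints (f ≫ QuadricFamily.X.π) B).Finite ∧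
          c * B ≤ (QuadricFamily.Nloc (f ≫ QuadricFamily.X.π) B : ℝ) ∧
          (QuadricFamily.Nloc (f ≫ QuadricFamily.X.π) B : ℝ) ≤ C * B := by
  obtain ⟨C, hC, hupper⟩ := QuadricFamily.exists_nloc_le
  refine ⟨1 / 16, C, by norm_num, hC, fun X' f hf B hB => ?_⟩
  obtain ⟨hfin, hle⟩ := hupper f B (by linarith)
  exact ⟨hfin, QuadricFamily.le_nloc hf hB hfin, hle⟩
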